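/- Let $\Omega\subset\mathbb R\times\mathbb R^2$ be an open set of points $(t,x_1,x_2)$ containing $(t_0,\mathbf x^0)$, and let $u,v,T_{11},T_{12},T_{22},\rho:\Omega\to\mathbb R$ be real analytic functions satisfying on $\Omega$ the two-dimensional balance laws of linear momentum and mass $$\partial_1(\rho u^2-T_{11})+\partial_2(\rho uv-T_{12})=-\partial_t(\rho u),\qquad \partial_1(\rho uv-T_{12})+\partial_2(\rho v^2-T_{22})=-\partial_t(\rho v),$$ $$\partial_1(\rho u)+\partial_2(\rho v)=-\partial_t\rho .$$ Assume $T_{12}-\rho uv\neq 0$ at $(t_0,\mathbf x^0)$, and put $L=\rho v^2-T_{22}$, $M=-\rho uv+T_{12}$, $N=\rho u^2-T_{11}$. Then there are $\varepsilon>0$ with $B:=\{(t,\mathbf x):|t-t_0|<\varepsilon,\ |\mathbf x-\mathbf x^0|<\varepsilon\}\subset\Omega$, a real analytic evolving Riemannian metric $\mathbf g=(g_{ij}(t,\mathbf x))_{i,j=1,2}$ on $B$ (symmetric and positive definite at every point), and a real analytic map $\mathbf y:B\to\mathbb R^3$ such that the following holds everywhere on $B$. 1. Isometric immersion: $\partial_i\mathbf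 y\cdot\partial_j\mathbf y=g_{ij}$ for $i,j=1,2$, so that $\mathbf y(t,\cdot)$ is, for each $t$, an isometric immersion into $\mathbb R^3$ of the two-dimensional Riemannian manifold with metric $\mathbf g(t,\cdot)$. 2. The surface is defined by the mechanical solution: with $\mathbf n=\dfrac{\partial_1\mathbf y\times\partial_2\mathbf y}{|\partial_1\mathbf y\times\partial_2\mathbf y|}$, the second fundamental form is $$\mathbf n\cdot\partial_{11}\mathbf y=\sqrt{\det\mathbf g}\,L,\qquad \mathbf n\cdot\partial_{12}\mathbf y=\sqrt{\det\mathbf g}\,M,\qquad \mathbf n\cdot\partial_{22}\mathbf y=\sqrt{\det\mathbf g}\,N.$$ 3. With $\Gamma^k_{ij}$ the Christoffel symbols and $\kappa$ the Gauss curvature of $\mathbf g(t,\cdot)$, the Gauss--Codazzi equations hold: $$\partial_1N-\partial_2M=-\Gamma^1_{22}L+2\Gamma^1_{12}M-\Gamma^1_{11}N,\quad \partial_1M-\partial_2L=\Gamma^2_{22}L-2\Gamma^2_{12}M+\Gamma^2_{11}N,\quad LN-M^2=\kappa,$$ and the momenta evolve by $$\partial_t(\rho u)=\Gamma^1_{22}L-2\Gamma^1_{12}M+\Gamma^1_{11}N,\qquad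 \partial_t(\rho v)=\Gamma^2_{22}L-2\Gamma^2_{12}M+\Gamma^2_{11}N.$$ -/

import Mathlib

open Set Matrix

noncomputable section

namespace Continuum

/-- Space-time: a time `t` together with Cartesian spatial coordinates `(x₁, x₂)`
(indices `0, 1` in `Fin 2`). -/
abbrev SpaceTime : Type := ℝ × EuclideanSpace ℝ (Fin 2)

/-- The target space `ℝ³` with its Euclidean inner product. -/
abbrev E3 : Type := EuclideanSpace ℝ (Fin 3)

/-- Time derivative `∂ₜ f`. -/
def dt {F : Type*} [NormedAddCommGroup F] [NormedSpace ℝ F]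
    (f : SpaceTime → F) (p : SpaceTime) : F :=
  fderiv ℝ f p (1, 0)

/-- Spatial partial derivative `∂ᵢ f`. -/
def dx {F : Type*} [NormedAddCommGroup F] [NormedSpace ℝ F]
    (i : Fin 2) (f : SpaceTime → F) (p : SpaceTime) : F :=
  fderiv ℝ f p (0, EuclideanSpace.single i 1)

/-! ### Mechanics -/

/-- The mechanical fields: velocity `(u, v)`, symmetric Cauchy stress `(T₁₁, T₁₂, T₂₂)`,
density `ρ`. -/
structure Fields where
  u : SpaceTime → ℝ
  v : SpaceTime → ℝ
  T11 : SpaceTime → ℝ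
  T12 : SpaceTime → ℝ
  T22 : SpaceTime → ℝ
  ρ : SpaceTime → ℝ

/-- All the mechanical fields are real analytic in space-time on `Ω`. -/
def Fields.AnalyticOn (S : Fields) (Ω : Set SpaceTime) : Prop :=
  AnalyticOnNhd ℝ S.u Ω ∧ AnalyticOnNhd ℝ S.v Ω ∧ AnalyticOnNhd ℝ S.T11 Ω ∧
    AnalyticOnNhd ℝ S.T12 Ω ∧ AnalyticOnNhd ℝ S.T22 Ω ∧ AnalyticOnNhd ℝ S.ρ Ω

/-- Balance of linear momentum (spatial form, no body force) at the point `p`. -/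
def Fields.BalanceMomentum (S : Fields) (p : SpaceTime) : Prop :=
  dx 0 (fun q => S.ρ q * S.u q ^ 2 - S.T11 q) p
      + dx 1 (fun q => S.ρ q * S.u q * S.v q - S.T12 q) p
    = -dt (fun q => S.ρ q * S.u q) p ∧
  dx 0 (fun q => S.ρ q * S.u q * S.v q - S.T12 q) p
      + dx 1 (fun q => S.ρ q * S.v q ^ 2 - S.T22 q) p
    = -dt (fun q => S.ρ q * S.v q) p

/-- Balance of mass at the point `p`. -/
def Fields.BalanceMass (S : Fields) (p : SpaceTime) : Prop :=
  dx 0 (fun q => S.ρ q * S.u q) p + dx 1 (fun q => S.ρ q * S.v q) p = -dt S.ρ p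

/-- `L = ρ v² - T₂₂`. -/
def Fields.L (S : Fields) (p : SpaceTime) : ℝ := S.ρ p * S.v p ^ 2 - S.T22 p

/-- `M = -ρ u v + T₁₂`. -/
def Fields.M (S : Fields) (p : SpaceTime) : ℝ := -(S.ρ p * S.u p * S.v p) + S.T12 p

/-- `N = ρ u² - T₁₁`. -/
def Fields.N (S : Fields) (p : SpaceTime) : ℝ := S.ρ p * S.u p ^ 2 - S.T11 p

/-- The symmetric matrix with entries `L, M, M, N`. -/
def Fields.form (S : Fields) (p : SpaceTime) : Matrix (Fin 2) (Fin 2) ℝ :=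
  !![S.L p, S.M p; S.M p, S.N p]

/-! ### Intrinsic geometry of a time-dependent metric -/

/-- A time-dependent metric in coordinates, `g p i j = g_{ij}(t, x)`. -/
abbrev MetricField : Type := SpaceTime → Matrix (Fin 2) (Fin 2) ℝ

/-- `g` is a real analytic evolving Riemannian metric on `B`. -/
def IsEvolvingMetric (g : MetricField) (B : Set SpaceTime) : Prop :=
  (∀ i j, AnalyticOnNhd ℝ (fun p => g p i j) B) ∧ ∀ p ∈ B, (g p).PosDef

/-- Christoffel symbols
`Γ^k_{ij} = ½ g^{kl} (∂_j g_{il} + ∂_i g_{jl} - ∂_l g_{ij})`; written `christoffel g k i j`. -/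
def christoffel (g : MetricField) (k i j : Fin 2) (p : SpaceTime) : ℝ :=
  (1 / 2) * ∑ l, (g p)⁻¹ k l *
    (dx j (fun q => g q i l) p + dx i (fun q => g q j l) p - dx l (fun q => g q i j) p)

/-- Riemann curvature tensor
`R_{iljk} = g_{lm} (∂_k Γ^m_{ij} - ∂_j Γ^m_{ik} + Γ^n_{ij} Γ^m_{nk} - Γ^n_{ik} Γ^m_{nj})`. -/
def riemann (g : MetricField) (i l j k : Fin 2) (p : SpaceTime) : ℝ :=
  ∑ m, g p l m *
    (dx k (christoffel g m i j) p - dx j (christoffel g m i k) p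
      + ∑ n, (christoffel g n i j p * christoffel g m n k p
              - christoffel g n i k p * christoffel g m n j p))

/-- Gauss curvature `κ = R₁₂₁₂ / det g`. -/
def gaussCurvature (g : MetricField) (p : SpaceTime) : ℝ :=
  riemann g 0 1 0 1 p / (g p).det

/-- The combination `Γ^k_{22} L - 2 Γ^k_{12} M + Γ^k_{11} N`. -/
def codazziTerm (S : Fields) (g : MetricField) (k : Fin 2) (p : SpaceTime) : ℝ :=
  christoffel g k 1 1 p * S.L p - 2 * christoffel g k 0 1 p * S.M p
    + christoffel g k 0 0 p * S.N p

/-- The Codazzi equations and the Gauss equation for `(L, M, N)` and `g` at `p`, where `(L, M, N)`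
is the second fundamental form divided by `√(det g)`. -/
def GaussCodazzi (S : Fields) (g : MetricField) (p : SpaceTime) : Prop :=
  dx 0 S.N p - dx 1 S.M p = -codazziTerm S g 0 p ∧
  dx 0 S.M p - dx 1 S.L p = codazziTerm S g 1 p ∧
  S.L p * S.N p - S.M p ^ 2 = gaussCurvature g p

/-- The momentum evolution equations in geometric form at `p`:
`∂ₜ(ρu) = Γ¹₂₂ L - 2 Γ¹₁₂ M + Γ¹₁₁ N` and `∂ₜ(ρv) = Γ²₂₂ L - 2 Γ²₁₂ M + Γ²₁₁ N`. -/
def GeometricMomentum (S : Fields) (g : MetricField) (p : SpaceTime) : Prop :=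
  dt (fun q => S.ρ q * S.u q) p = codazziTerm S g 0 p ∧
  dt (fun q => S.ρ q * S.v q) p = codazziTerm S g 1 p

/-! ### Extrinsic geometry of a time-dependent parametrized surface -/

/-- The cross product of `ℝ³`. -/
def cross (a b : E3) : E3 := WithLp.toLp 2 (crossProduct (WithLp.ofLp a) (WithLp.ofLp b))

/-- First fundamental form: `∂ᵢy · ∂ⱼy`. -/
def firstForm (y : SpaceTime → E3) (p : SpaceTime) (i j : Fin 2) : ℝ :=
  inner ℝ (dx i y p) (dx j y p)

/-- Unit normal `(∂₁y × ∂₂y) / |∂₁y × ∂₂y|`. -/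
def unitNormal (y : SpaceTime → E3) (p : SpaceTime) : E3 :=
  ‖cross (dx 0 y p) (dx 1 y p)‖⁻¹ • cross (dx 0 y p) (dx 1 y p)

/-- Second fundamental form: `n · ∂ᵢ∂ⱼy`. -/
def secondForm (y : SpaceTime → E3) (p : SpaceTime) (i j : Fin 2) : ℝ :=
  inner ℝ (unitNormal y p) (dx i (dx j y) p)

/-- At each instant, `y` is an isometric immersion of `g` (first fundamental form `g`) whose second
fundamental form is `√(det g)` times `(L, M, N)`. As `g` is positive definite, `∂₁y, ∂₂y` are
linearly independent. -/
def RealizesAt (S : Fields) (g : MetricField) (y : SpaceTime → E3) (p : SpaceTime) : Prop :=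
  ∀ i j : Fin 2, firstForm y p i j = g p i j ∧
    secondForm y p i j = Real.sqrt (g p).det * S.form p i j

end Continuum

end

/-! The surface is constructed directly and the metric is read off from it, so the Gauss equation
comes for free. Let `z`, `w` be the derivatives of the immersion along two directions `e`, `f`, and
let ν = z × w, not normalised. The condition on the second fundamental form becomes ν·∂∂y = |ν|² (L,
M, N), which contains no square root. For such a surface the Codazzi equations are linear in the
tangential coefficients A, B of ∂ₑz in the frame (z, w, ν), and the coefficient of A, respectively
B, is N. Where N ≠ 0 they can be solved, and ∂ₑy = z, ∂ₑw = ∂_f z, ∂ₑz = A z + B w + L ν, completed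
by an equation for q = 1/|ν|², is a quasilinear system with polynomial nonlinearities and only
`f`-derivatives on the right. Time is a mere parameter. Cauchy–Kovalevskaya solves it
(`exists_frame_system`).

The system imposes only the L component. The defects of the M and N components satisfy a linear
homogeneous Cauchy problem, because the Codazzi equations have been built in (`fderiv_defects`). An
explicit initial strip makes them vanish on the initial hyperplane, so by uniqueness they vanish
nearby (`exists_surface_of_forms`). The condition N ≠ 0 is arranged by a shear of the spatial
coordinates, since N + 2cM + c²L cannot vanish for every c when M ≠ 0.

For the resulting surface the Christoffel symbols of the induced metric are the tangential
coefficients of the second derivatives. The Codazzi equations follow from the same defect identity,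
now read with zero defects, and the Gauss equation from commuting third derivatives. The divergences
in the momentum balance are the left sides of the Codazzi equations up to sign, which gives the
evolution of the momenta.

Cauchy–Kovalevskaya itself rests on a weighted ℓ¹ norm on power series for which ∂ᵢ⁻¹(f ∂ⱼg) has
norm at most θ‖f‖‖g‖ (`nrm_integ_mul_pderiv_le`). For small θ the Picard iterates stay bounded, and
they converge coefficientwise because each iteration settles one more order in xᵢ. -/

noncomputable section

/-! ### A weighted ℓ¹ norm on formal power series -/

namespace FormalCauchy

open MvPowerSeries Finsupp
open scoped NNReal ENNReal

variable {σ : Type*}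

/-- Weights for which `∂ᵢ⁻¹ ∂ⱼ` is bounded on the weighted `ℓ¹` space of power series. -/
def wt (i j : σ) (R θ : ℝ≥0) (n : σ →₀ ℕ) : ℝ≥0 :=
  θ ^ n i * R ^ n.degree / ((n i + n j).choose (n i) : ℝ≥0)

/-- The left side is a single term of the Vandermonde sum for the right side. -/
lemma choose_mul_choose_le (a b c d : ℕ) :
    (a + b).choose a * (c + d).choose c ≤ (a + c + (b + d)).choose (a + c) := by
  rw [show a + c + (b + d) = (a + b) + (c + d) by ring, Nat.add_choose_eq (a + b) (c + d) (a + c)]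
  have hmem : (a, c) ∈ Finset.HasAntidiagonal.antidiagonal (a + c) := by
    rw [Finset.HasAntidiagonal.mem_antidiagonal]
  exact Finset.single_le_sum (f := fun ij : ℕ × ℕ => (a + b).choose ij.1 * (c + d).choose ij.2)
    (fun _ _ => Nat.zero_le _) hmem

lemma choose_self_add_pos (a b : ℕ) : 0 < (((a + b).choose a : ℕ) : ℝ≥0) :=
  Nat.cast_pos.2 (Nat.choose_pos (Nat.le_add_right a b))

variable {i j : σ} {R θ : ℝ≥0}

lemma wt_zero : wt i j R θ 0 = 1 := by simp [wt]

/-- Submultiplicativity of the weights is what makes the weighted norm submultiplicative; the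
binomial in the denominator is supermultiplicative by Vandermonde. -/
lemma wt_add_le (m n : σ →₀ ℕ) : wt i j R θ (m + n) ≤ wt i j R θ m * wt i j R θ n := by
  unfold wt
  have h := choose_mul_choose_le (m i) (m j) (n i) (n j)
  rw [div_mul_div_comm]
  simp only [Finsupp.add_apply, map_add]
  have h' : ((m i + m j).choose (m i) : ℝ≥0) * ((n i + n j).choose (n i) : ℝ≥0)
      ≤ ((m i + n i + (m j + n j)).choose (m i + n i) : ℝ≥0) := by exact_mod_cast h
  calc _ ≤ θ ^ (m i + n i) * R ^ (m.degree + n.degree) /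
        (((m i + m j).choose (m i) : ℝ≥0) * ((n i + n j).choose (n i) : ℝ≥0)) :=
        div_le_div_of_nonneg_left zero_le
          (mul_pos (choose_self_add_pos _ _) (choose_self_add_pos _ _)) h'
    _ = _ := by rw [pow_add, pow_add]; congr 1; ring

lemma wt_le (hθ : θ ≤ 1) (n : σ →₀ ℕ) : wt i j R θ n ≤ R ^ n.degree := by
  unfold wt
  apply NNReal.div_le_of_le_mul
  have h1 : (1 : ℝ≥0) ≤ ((n i + n j).choose (n i) : ℝ≥0) := by
    exact_mod_cast Nat.choose_pos (Nat.le_add_right _ _)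
  have h2 : θ ^ n i ≤ 1 := pow_le_one₀ zero_le hθ
  calc _ ≤ 1 * R ^ n.degree := by gcongr
    _ ≤ _ := by rw [mul_comm]; gcongr

lemma wt_mono {θ' : ℝ≥0} (h : θ ≤ θ') (n : σ →₀ ℕ) : wt i j R θ n ≤ wt i j R θ' n := by
  unfold wt; gcongr

/-- Since a binomial coefficient is at most a power of two, finiteness of the weighted norm implies
absolute convergence on an ordinary polydisc of radius θR/2. -/
lemma le_wt [Fintype σ] (hij : i ≠ j) (hθ : θ ≤ 1) (n : σ →₀ ℕ) :
    (θ * R / 2) ^ n.degree ≤ wt i j R θ n := by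
  classical
  unfold wt
  rw [le_div_iff₀ (choose_self_add_pos _ _)]
  have hle : n i + n j ≤ n.degree := by
    rw [Finsupp.degree_eq_sum, ← Finset.sum_pair hij]
    exact Finset.sum_le_sum_of_subset (Finset.subset_univ _)
  have h1 : ((n i + n j).choose (n i) : ℝ≥0) ≤ 2 ^ n.degree := by
    have := (Nat.choose_le_two_pow (n i + n j) (n i)).trans (Nat.pow_le_pow_right two_pos hle)
    exact_mod_cast this
  have h2 : θ ^ n.degree ≤ θ ^ n i := pow_le_pow_of_le_one zero_le hθ (by omega)
  calc _ = θ ^ n.degree * R ^ n.degree / 2 ^ n.degree * ((n i + n j).choose (n i) : ℝ≥0) := by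
        rw [div_pow, mul_pow]
    _ ≤ θ ^ n i * R ^ n.degree / 2 ^ n.degree * 2 ^ n.degree := by gcongr
    _ = _ := div_mul_cancel₀ _ (by positivity)

lemma wt_add_single_le (hij : i ≠ j) (n : σ →₀ ℕ) :
    wt i j R θ (n + single i 1) ≤ θ * R * wt i j R θ n := by
  unfold wt
  have hj : (single i 1 : σ →₀ ℕ) j = 0 := by simp [hij]
  simp only [Finsupp.add_apply, map_add, degree_single, single_eq_same, hj, add_zero]
  have h : ((n i + n j).choose (n i) : ℝ≥0) ≤ ((n i + 1 + n j).choose (n i + 1) : ℝ≥0) := by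
    have : (n i + n j).choose (n i) ≤ (n i + 1 + n j).choose (n i + 1) := by
      rw [show n i + 1 + n j = (n i + n j) + 1 by ring, Nat.choose_succ_succ]
      exact Nat.le_add_right _ _
    exact_mod_cast this
  calc _ ≤ θ ^ (n i + 1) * R ^ (n.degree + 1) / ((n i + n j).choose (n i) : ℝ≥0) :=
        div_le_div_of_nonneg_left zero_le (choose_self_add_pos _ _) h
    _ = _ := by rw [pow_succ, pow_succ]; field_simp

/-- The factor `a' + 1` produced by ∂ⱼ is to be absorbed by the factor `k + k' + 1` gained from
∂ᵢ⁻¹. Vandermonde merges the two binomials, and raising the lower index by one exchanges `k + k' +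
1` for `a + a' + 1`, which is at least `a' + 1`. -/
lemma choose_key (k a k' a' : ℕ) :
    (a' + 1) * ((k + a).choose k * (k' + (a' + 1)).choose k')
      ≤ (k + k' + 1) * (k + k' + 1 + (a + a')).choose (k + k' + 1) := by
  have h1 := choose_mul_choose_le k a k' (a' + 1)
  have h2 := Nat.choose_succ_right_eq (k + k' + (a + (a' + 1))) (k + k')
  rw [show k + k' + (a + (a' + 1)) - (k + k') = a + a' + 1 by omega] at h2
  rw [show k + k' + 1 + (a + a') = k + k' + (a + (a' + 1)) by ring]
  nlinarith

lemma wt_key (hij : i ≠ j) (p q : σ →₀ ℕ) :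
    (q j + 1 : ℝ≥0) * wt i j R θ (p + q + single i 1)
      ≤ ((p + q) i + 1 : ℝ≥0) * (θ * (wt i j R θ p * wt i j R θ (q + single j 1))) := by
  unfold wt
  have hj : (single i 1 : σ →₀ ℕ) j = 0 := by simp [hij]
  have hi : (single j 1 : σ →₀ ℕ) i = 0 := by simp [hij.symm]
  simp only [Finsupp.add_apply, map_add, degree_single, single_eq_same, hj, hi, add_zero]
  have h := choose_key (p i) (p j) (q i) (q j)
  have h' : (q j + 1 : ℝ≥0) * (((p i + p j).choose (p i) : ℝ≥0) *
      ((q i + (q j + 1)).choose (q i) : ℝ≥0)) ≤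
      (p i + q i + 1 : ℝ≥0) * ((p i + q i + 1 + (p j + q j)).choose (p i + q i + 1) : ℝ≥0) := by
    exact_mod_cast h
  rw [div_mul_div_comm, ← mul_div_assoc, ← mul_div_assoc, ← mul_div_assoc,
    div_le_div_iff₀ (choose_self_add_pos _ _)
      (mul_pos (choose_self_add_pos _ _) (choose_self_add_pos _ _))]
  push_cast
  calc _ = (θ ^ (p i + q i + 1) * R ^ (p.degree + q.degree + 1)) *
        ((q j + 1 : ℝ≥0) * (((p i + p j).choose (p i) : ℝ≥0) *
        ((q i + (q j + 1)).choose (q i) : ℝ≥0))) := by ring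
    _ ≤ (θ ^ (p i + q i + 1) * R ^ (p.degree + q.degree + 1)) * _ := mul_le_mul_of_nonneg_left h' zero_le
    _ = _ := by ring

/-- The weighted `ℓ¹` norm of a power series. -/
def nrm (i j : σ) (R θ : ℝ≥0) (f : MvPowerSeries σ ℝ) : ℝ≥0∞ :=
  ∑' n, ‖coeff n f‖ₑ * wt i j R θ n

lemma nrm_zero : nrm i j R θ 0 = 0 := by simp [nrm]

lemma nrm_add_le (f g : MvPowerSeries σ ℝ) :
    nrm i j R θ (f + g) ≤ nrm i j R θ f + nrm i j R θ g := by
  unfold nrm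
  rw [← ENNReal.tsum_add]
  refine ENNReal.tsum_le_tsum fun n => ?_
  rw [← add_mul, map_add]
  gcongr
  exact enorm_add_le _ _

lemma nrm_sum_le {ι : Type*} (s : Finset ι) (f : ι → MvPowerSeries σ ℝ) :
    nrm i j R θ (∑ k ∈ s, f k) ≤ ∑ k ∈ s, nrm i j R θ (f k) := by
  classical
  induction s using Finset.induction_on with
  | empty => simp [nrm_zero]
  | insert a s ha ih =>
    rw [Finset.sum_insert ha, Finset.sum_insert ha]
    exact (nrm_add_le _ _).trans (by gcongr)

lemma tsum_antidiagonal_mul [DecidableEq σ] (a b : (σ →₀ ℕ) → ℝ≥0∞) :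
    ∑' n, ∑ pq ∈ Finset.HasAntidiagonal.antidiagonal n, a pq.1 * b pq.2
      = (∑' n, a n) * ∑' n, b n := by
  have h : (∑' n, a n) * ∑' n, b n = ∑' pq : (σ →₀ ℕ) × (σ →₀ ℕ), a pq.1 * b pq.2 := by
    rw [ENNReal.tsum_prod (f := fun p q => a p * b q), ← ENNReal.tsum_mul_right]
    exact tsum_congr fun p => ENNReal.tsum_mul_left.symm
  rw [h, ← Finset.HasAntidiagonal.sigmaAntidiagonalEquivProd.tsum_eq, ENNReal.tsum_sigma']
  refine tsum_congr fun n => ?_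
  rw [← Finset.tsum_subtype]
  rfl

lemma enorm_sum_le' {ι : Type*} (s : Finset ι) (f : ι → ℝ) :
    ‖∑ k ∈ s, f k‖ₑ ≤ ∑ k ∈ s, ‖f k‖ₑ := by
  simp only [enorm_eq_nnnorm]
  exact_mod_cast nnnorm_sum_le s f

lemma nrm_mul_le (f g : MvPowerSeries σ ℝ) :
    nrm i j R θ (f * g) ≤ nrm i j R θ f * nrm i j R θ g := by
  classical
  unfold nrm
  rw [← tsum_antidiagonal_mul]
  refine ENNReal.tsum_le_tsum fun n => ?_
  rw [coeff_mul]
  refine (mul_le_mul_left (enorm_sum_le' _ _) _).trans ?_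
  rw [Finset.sum_mul]
  refine Finset.sum_le_sum fun pq hpq => ?_
  rw [← Finset.HasAntidiagonal.mem_antidiagonal.1 hpq, enorm_mul]
  have := wt_add_le (i := i) (j := j) (R := R) (θ := θ) pq.1 pq.2
  calc _ ≤ ‖coeff pq.1 f‖ₑ * ‖coeff pq.2 g‖ₑ *
        ((wt i j R θ pq.1 : ℝ≥0∞) * (wt i j R θ pq.2 : ℝ≥0∞)) := by
        gcongr; exact_mod_cast this
    _ = _ := by ring

lemma nrm_C (a : ℝ) : nrm i j R θ (C a) = ‖a‖ₑ := by
  classical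
  unfold nrm
  rw [tsum_eq_single 0]
  · simp [wt_zero]
  · intro n hn
    simp [coeff_C, hn]

lemma nrm_mono {θ' : ℝ≥0} (h : θ ≤ θ') (f : MvPowerSeries σ ℝ) :
    nrm i j R θ f ≤ nrm i j R θ' f :=
  ENNReal.tsum_le_tsum fun n => by gcongr; exact wt_mono h n

/-- Formal integration in the variable `i`, with zero integration constant. -/
def integ (i : σ) (f : MvPowerSeries σ ℝ) : MvPowerSeries σ ℝ :=
  fun n => if n i = 0 then 0 else coeff (n - single i 1) f / n i

lemma coeff_integ (i : σ) (f : MvPowerSeries σ ℝ) (n : σ →₀ ℕ) :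
    coeff n (integ i f) = if n i = 0 then 0 else coeff (n - single i 1) f / n i := rfl

lemma coeff_add_single_integ (i : σ) (f : MvPowerSeries σ ℝ) (n : σ →₀ ℕ) :
    coeff (n + single i 1) (integ i f) = coeff n f / (n i + 1) := by
  rw [coeff_integ]; simp

lemma pderiv_integ (i : σ) (f : MvPowerSeries σ ℝ) : pderiv ℝ i (integ i f) = f := by
  ext n
  rw [coeff_pderiv, coeff_add_single_integ]
  field_simp

lemma nrm_integ (f : MvPowerSeries σ ℝ) :
    nrm i j R θ (integ i f)
      = ∑' n : σ →₀ ℕ, ‖coeff n f / (n i + 1)‖ₑ * wt i j R θ (n + single i 1) := by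
  unfold nrm
  have hinj : Function.Injective fun n : σ →₀ ℕ => n + single i 1 := add_left_injective _
  rw [← hinj.tsum_eq]
  · exact tsum_congr fun n => by rw [coeff_add_single_integ]
  · intro n hn
    have hni : n i ≠ 0 := by
      rintro h0
      simp [coeff_integ, h0] at hn
    refine ⟨n - single i 1, ?_⟩
    ext k
    by_cases hk : k = i
    · subst hk; simp; omega
    · simp [hk]

lemma enorm_div_succ (x : ℝ) (k : ℕ) : ‖x / (k + 1)‖ₑ = ‖x‖ₑ * ((k + 1 : ℝ≥0)⁻¹ : ℝ≥0) := by
  rw [div_eq_mul_inv, enorm_mul]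
  congr 1
  rw [enorm_eq_nnnorm]
  congr 1
  ext
  simp
  positivity

/-- Each integration raises the exponent of xᵢ by one, which brings a factor θ; this makes the terms
of order zero small. -/
lemma nrm_integ_le (hij : i ≠ j) (f : MvPowerSeries σ ℝ) :
    nrm i j R θ (integ i f) ≤ (θ * R : ℝ≥0) * nrm i j R θ f := by
  rw [nrm_integ, nrm, ← ENNReal.tsum_mul_left]
  refine ENNReal.tsum_le_tsum fun n => ?_
  rw [enorm_div_succ, mul_assoc, ← ENNReal.coe_mul, mul_left_comm, ← ENNReal.coe_mul]
  refine mul_le_mul_right (ENNReal.coe_le_coe.2 ?_) _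
  have h1 : ((n i + 1 : ℝ≥0)⁻¹) ≤ 1 := inv_le_one_of_one_le₀ (by simp)
  calc _ ≤ 1 * (θ * R * wt i j R θ n) := by gcongr; exact wt_add_single_le hij n
    _ = _ := one_mul _

/-- The loss of a derivative in xⱼ is compensated exactly by the integration in xᵢ, coefficient by
coefficient via `wt_key`. Hence a single norm suffices, without a scale of shrinking domains. -/
lemma nrm_integ_mul_pderiv_le (hij : i ≠ j) (f g : MvPowerSeries σ ℝ) :
    nrm i j R θ (integ i (f * pderiv ℝ j g)) ≤ θ * (nrm i j R θ f * nrm i j R θ g) := by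
  classical
  have hinj : Function.Injective fun n : σ →₀ ℕ => n + single j 1 := add_left_injective _
  have hg : ∑' q : σ →₀ ℕ, ‖coeff (q + single j 1) g‖ₑ * wt i j R θ (q + single j 1)
      ≤ nrm i j R θ g :=
    ENNReal.tsum_comp_le_tsum_of_injective hinj fun n => ‖coeff n g‖ₑ * wt i j R θ n
  refine le_trans ?_ (mul_le_mul_right (mul_le_mul_right hg _) _)
  rw [nrm_integ, nrm, ← tsum_antidiagonal_mul, ← ENNReal.tsum_mul_left]
  refine ENNReal.tsum_le_tsum fun n => ?_
  rw [coeff_mul, Finset.sum_div, Finset.mul_sum]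
  refine (mul_le_mul_left (enorm_sum_le' _ _) _).trans ?_
  rw [Finset.sum_mul]
  refine Finset.sum_le_sum fun pq hpq => ?_
  rw [← Finset.HasAntidiagonal.mem_antidiagonal.1 hpq, enorm_div_succ, coeff_pderiv, enorm_mul,
    enorm_mul]
  have he : ‖((pq.2 j : ℝ) + 1)‖ₑ = ((pq.2 j + 1 : ℝ≥0) : ℝ≥0∞) := by
    rw [enorm_eq_nnnorm]; congr 1; ext; simp; positivity
  rw [he]
  have key := wt_key (R := R) (θ := θ) hij pq.1 pq.2
  have key' : ((pq.1 + pq.2) i + 1 : ℝ≥0)⁻¹ * ((pq.2 j + 1 : ℝ≥0) *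
      wt i j R θ (pq.1 + pq.2 + single i 1))
      ≤ θ * (wt i j R θ pq.1 * wt i j R θ (pq.2 + single j 1)) := by
    rw [inv_mul_le_iff₀ (by positivity)]; exact key
  calc _ = ‖coeff pq.1 f‖ₑ * ‖coeff (pq.2 + single j 1) g‖ₑ *
        ((((pq.1 + pq.2) i + 1 : ℝ≥0)⁻¹ * ((pq.2 j + 1 : ℝ≥0) *
      wt i j R θ (pq.1 + pq.2 + single i 1)) : ℝ≥0) : ℝ≥0∞) := by
        push_cast; ring
    _ ≤ ‖coeff pq.1 f‖ₑ * ‖coeff (pq.2 + single j 1) g‖ₑ *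
        ((θ * (wt i j R θ pq.1 * wt i j R θ (pq.2 + single j 1)) : ℝ≥0) : ℝ≥0∞) := by
        gcongr
    _ = _ := by push_cast; ring

end FormalCauchy

/-! ### Picard iteration for the formal Cauchy problem -/

namespace FormalCauchy

open MvPowerSeries Finsupp
open scoped NNReal ENNReal

variable {σ : Type*} {i j : σ} {R θ : ℝ≥0}

/-- The bound does not depend on θ, so θ can be chosen after it. -/
lemma exists_nrm_aeval_le {τ : Type*} (i j : σ) (R : ℝ≥0) (P : MvPolynomial τ ℝ)
    {B : ℝ≥0∞} (hB : B ≠ ∞) :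
    ∃ c : ℝ≥0∞, c ≠ ∞ ∧ ∀ (θ : ℝ≥0) (v : τ → MvPowerSeries σ ℝ),
      (∀ k, nrm i j R θ (v k) ≤ B) → nrm i j R θ (MvPolynomial.aeval v P) ≤ c := by
  induction P using MvPolynomial.induction_on with
  | C a =>
    refine ⟨‖a‖ₑ, enorm_ne_top, fun θ v _ => ?_⟩
    rw [MvPolynomial.aeval_C]
    exact (nrm_C (σ := σ) a).le
  | add p q hp hq =>
    obtain ⟨c, hc, h⟩ := hp
    obtain ⟨d, hd, h'⟩ := hq
    refine ⟨c + d, ENNReal.add_ne_top.2 ⟨hc, hd⟩, fun θ v hv => ?_⟩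
    rw [map_add]
    exact (nrm_add_le _ _).trans (add_le_add (h θ v hv) (h' θ v hv))
  | mul_X p k hp =>
    obtain ⟨c, hc, h⟩ := hp
    refine ⟨c * B, ENNReal.mul_ne_top hc hB, fun θ v hv => ?_⟩
    rw [map_mul, MvPolynomial.aeval_X]
    exact (nrm_mul_le _ _).trans (mul_le_mul' (h θ v hv) (hv k))

/-- Two power series agree up to terms of degree at least `k` in the variable `i`. -/
def AgreeUpTo (i : σ) (k : ℕ) (f g : MvPowerSeries σ ℝ) : Prop :=
  ∀ n : σ →₀ ℕ, n i < k → coeff n f = coeff n g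

namespace AgreeUpTo

variable {k : ℕ} {f g f' g' : MvPowerSeries σ ℝ}

lemma rfl' : AgreeUpTo i k f f := fun _ _ => rfl

lemma symm (h : AgreeUpTo i k f g) : AgreeUpTo i k g f := fun n hn => (h n hn).symm

lemma trans (h : AgreeUpTo i k f g) (h' : AgreeUpTo i k g f') : AgreeUpTo i k f f' :=
  fun n hn => (h n hn).trans (h' n hn)

lemma mono {l : ℕ} (hl : l ≤ k) (h : AgreeUpTo i k f g) : AgreeUpTo i l f g :=
  fun n hn => h n (hn.trans_le hl)

lemma add (h : AgreeUpTo i k f g) (h' : AgreeUpTo i k f' g') :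
    AgreeUpTo i k (f + f') (g + g') := fun n hn => by
  rw [map_add, map_add, h n hn, h' n hn]

lemma sum {ι : Type*} {s : Finset ι} {F G : ι → MvPowerSeries σ ℝ}
    (h : ∀ l ∈ s, AgreeUpTo i k (F l) (G l)) :
    AgreeUpTo i k (∑ l ∈ s, F l) (∑ l ∈ s, G l) := fun n hn => by
  rw [map_sum, map_sum]
  exact Finset.sum_congr rfl fun l hl => h l hl n hn

lemma mul (h : AgreeUpTo i k f g) (h' : AgreeUpTo i k f' g') :
    AgreeUpTo i k (f * f') (g * g') := fun n hn => by
  classical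
  rw [coeff_mul, coeff_mul]
  refine Finset.sum_congr rfl fun pq hpq => ?_
  have := Finset.HasAntidiagonal.mem_antidiagonal.1 hpq
  have h2 : pq.1 i + pq.2 i = n i := by rw [← this]; rfl
  rw [h _ (by omega), h' _ (by omega)]

lemma pderiv (hij : i ≠ j) (h : AgreeUpTo i k f g) :
    AgreeUpTo i k (pderiv ℝ j f) (pderiv ℝ j g) := fun n hn => by
  rw [coeff_pderiv, coeff_pderiv, h]
  simpa [hij.symm] using hn

/-- Integration gains one order in xᵢ, whereas products, polynomials and ∂ⱼ lose none; the Picard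
operator therefore improves agreement by one order. -/
lemma integ (h : AgreeUpTo i k f g) :
    AgreeUpTo i (k + 1) (integ i f) (FormalCauchy.integ i g) := fun n hn => by
  rw [coeff_integ, coeff_integ]
  split_ifs with h0
  · rfl
  · rw [h]
    simp
    omega

lemma aeval {τ : Type*} {v w : τ → MvPowerSeries σ ℝ} (h : ∀ l, AgreeUpTo i k (v l) (w l))
    (P : MvPolynomial τ ℝ) :
    AgreeUpTo i k (MvPolynomial.aeval v P) (MvPolynomial.aeval w P) := by
  induction P using MvPolynomial.induction_on with
  | C a => simp only [MvPolynomial.aeval_C]; exact rfl'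
  | add p q hp hq => simp only [map_add]; exact hp.add hq
  | mul_X p l hp => simp only [map_mul, MvPolynomial.aeval_X]; exact hp.mul (h l)

end AgreeUpTo

section Picard

variable {ι κ : Type*} [Fintype ι]

/-- The Picard operator of the Cauchy problem `∂ᵢ U = P(a, U) ∂ⱼ U + Q(a, U)`, `U = u₀` at
`xᵢ = 0`. -/
def picard (i j : σ) (P : ι → ι → MvPolynomial (κ ⊕ ι) ℝ) (Q : ι → MvPolynomial (κ ⊕ ι) ℝ)
    (a : κ → MvPowerSeries σ ℝ) (u₀ U : ι → MvPowerSeries σ ℝ) (k : ι) : MvPowerSeries σ ℝ :=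
  u₀ k + ∑ l, integ i (MvPolynomial.aeval (Sum.elim a U) (P k l) * pderiv ℝ j (U l))
    + integ i (MvPolynomial.aeval (Sum.elim a U) (Q k))

lemma exists_fixedPoint [Fintype κ] (hij : i ≠ j) (R : ℝ≥0)
    (P : ι → ι → MvPolynomial (κ ⊕ ι) ℝ) (Q : ι → MvPolynomial (κ ⊕ ι) ℝ)
    (a : κ → MvPowerSeries σ ℝ) (u₀ : ι → MvPowerSeries σ ℝ)
    (ha : ∀ k, nrm i j R 1 (a k) ≠ ∞) (hu : ∀ k, nrm i j R 1 (u₀ k) ≠ ∞) :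
    ∃ θ : ℝ≥0, 0 < θ ∧ θ ≤ 1 ∧ ∃ U : ι → MvPowerSeries σ ℝ,
      (∀ k, U k = picard i j P Q a u₀ U k) ∧ ∀ k, nrm i j R θ (U k) ≠ ∞ := by
  -- The summand 1 leaves room for the integral terms of the Picard operator, beyond the initial
  -- data.
  set B : ℝ≥0∞ := ∑ k, nrm i j R 1 (a k) + ∑ k, nrm i j R 1 (u₀ k) + 1 with hBdef
  have hB : B ≠ ∞ := by
    refine ENNReal.add_ne_top.2 ⟨ENNReal.add_ne_top.2 ⟨?_, ?_⟩, ENNReal.one_ne_top⟩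
    · exact ENNReal.sum_ne_top.2 fun k _ => ha k
    · exact ENNReal.sum_ne_top.2 fun k _ => hu k
  choose c hc hcP using fun k l => exists_nrm_aeval_le i j R (P k l) hB
  choose d hd hdQ using fun k => exists_nrm_aeval_le i j R (Q k) hB
  set K : ℝ≥0∞ := ∑ k, (∑ l, c k l * B + R * d k) with hKdef
  have hK : K ≠ ∞ := by
    refine ENNReal.sum_ne_top.2 fun k _ => ENNReal.add_ne_top.2 ⟨?_, ?_⟩
    · exact ENNReal.sum_ne_top.2 fun l _ => ENNReal.mul_ne_top (hc k l) hB
    · exact ENNReal.mul_ne_top ENNReal.coe_ne_top (hd k)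
  -- `K` dominates the integral terms up to the factor θ, and this choice makes θK ≤ 1.
  set θ : ℝ≥0 := (K.toNNReal + 1)⁻¹ with hθdef
  have hθ0 : 0 < θ := by positivity
  have hθ1 : θ ≤ 1 := inv_le_one_of_one_le₀ (by simp)
  have hθK : (θ : ℝ≥0∞) * K ≤ 1 := by
    rw [← ENNReal.coe_toNNReal hK, ← ENNReal.coe_mul]
    have : θ * K.toNNReal ≤ 1 := by
      rw [hθdef, inv_mul_le_iff₀ (by positivity), mul_one]
      simp
    exact_mod_cast this
  refine ⟨θ, hθ0, hθ1, ?_⟩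
  have hstep : ∀ U : ι → MvPowerSeries σ ℝ, (∀ k, nrm i j R θ (U k) ≤ B) →
      ∀ k, nrm i j R θ (picard i j P Q a u₀ U k) ≤ B := by
    intro U hU k
    have hv : ∀ s, nrm i j R θ (Sum.elim a U s) ≤ B := by
      rintro (s | s)
      · refine (nrm_mono hθ1 _).trans ?_
        refine le_trans (Finset.single_le_sum (f := fun k => nrm i j R 1 (a k))
          (fun _ _ => zero_le) (Finset.mem_univ s)) ?_
        rw [hBdef, add_assoc]
        exact le_self_add
      · exact hU s
    have h1 : nrm i j R θ (u₀ k) ≤ ∑ k, nrm i j R 1 (a k) + ∑ k, nrm i j R 1 (u₀ k) := by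
      refine (nrm_mono hθ1 _).trans (le_trans ?_ le_add_self)
      exact Finset.single_le_sum (f := fun k => nrm i j R 1 (u₀ k))
          (fun _ _ => zero_le) (Finset.mem_univ k)
    have h2 : ∀ l, nrm i j R θ
        (integ i (MvPolynomial.aeval (Sum.elim a U) (P k l) * pderiv ℝ j (U l)))
        ≤ θ * (c k l * B) := fun l =>
      (nrm_integ_mul_pderiv_le hij _ _).trans
        (mul_le_mul' le_rfl (mul_le_mul' (hcP k l θ _ hv) (hU l)))
    have h3 : nrm i j R θ (integ i (MvPolynomial.aeval (Sum.elim a U) (Q k)))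
        ≤ θ * (R * d k) := by
      refine (nrm_integ_le hij _).trans ?_
      rw [ENNReal.coe_mul, mul_assoc]
      exact mul_le_mul' le_rfl (mul_le_mul' le_rfl (hdQ k θ _ hv))
    calc _ ≤ nrm i j R θ (u₀ k) + ∑ l, θ * (c k l * B) + θ * (R * d k) := by
          refine (nrm_add_le _ _).trans (add_le_add ((nrm_add_le _ _).trans ?_) h3)
          refine add_le_add le_rfl ((nrm_sum_le _ _).trans (Finset.sum_le_sum fun l _ => h2 l))
      _ = nrm i j R θ (u₀ k) + θ * (∑ l, c k l * B + R * d k) := by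
          rw [← Finset.mul_sum, mul_add, add_assoc]
      _ ≤ nrm i j R θ (u₀ k) + θ * K := by
          gcongr
          exact Finset.single_le_sum (f := fun k => ∑ l, c k l * B + R * d k)
            (fun _ _ => zero_le) (Finset.mem_univ k)
      _ ≤ B := add_le_add h1 hθK
  -- Boundedness of the iterates is all the norm has to provide; no contraction estimate is needed,
  -- since convergence is formal.
  set W : ℕ → ι → MvPowerSeries σ ℝ := fun m => (picard i j P Q a u₀)^[m] 0 with hW
  have hWs : ∀ m, W (m + 1) = picard i j P Q a u₀ (W m) := fun m =>
    Function.iterate_succ_apply' _ _ _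
  have hWB : ∀ m k, nrm i j R θ (W m k) ≤ B := by
    intro m
    induction m with
    | zero => intro k; simp [hW, nrm_zero]
    | succ m ih => rw [hWs]; exact hstep _ ih
  have hcong : ∀ (m : ℕ) (U V : ι → MvPowerSeries σ ℝ), (∀ k, AgreeUpTo i m (U k) (V k)) →
      ∀ k, AgreeUpTo i (m + 1) (picard i j P Q a u₀ U k) (picard i j P Q a u₀ V k) := by
    intro m U V h k
    have hv : ∀ s, AgreeUpTo i m (Sum.elim a U s) (Sum.elim a V s) := by
      rintro (s | s)
      · exact AgreeUpTo.rfl'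
      · exact h s
    refine (AgreeUpTo.rfl'.add (AgreeUpTo.sum fun l _ => ?_)).add (AgreeUpTo.aeval hv _).integ
    exact ((AgreeUpTo.aeval hv _).mul ((h l).pderiv hij)).integ
  have hW1 : ∀ m k, AgreeUpTo i m (W m k) (W (m + 1) k) := by
    intro m
    induction m with
    | zero => intro k n hn; omega
    | succ m ih =>
      intro k
      rw [hWs m, hWs (m + 1)]
      exact hcong m _ _ ih k
  have hWm : ∀ m l, m ≤ l → ∀ k, AgreeUpTo i m (W m k) (W l k) := by
    intro m l hml k
    induction l, hml using Nat.le_induction with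
    | base => exact AgreeUpTo.rfl'
    | succ l hl ih => exact ih.trans ((hW1 l k).mono hl)
  -- The coefficient at `n` no longer changes from the iterate `n i + 1` on.
  set U : ι → MvPowerSeries σ ℝ := fun k n => coeff n (W (n i + 1) k) with hU
  have hUW : ∀ m k, AgreeUpTo i m (U k) (W m k) := by
    intro m k n hn
    exact hWm (n i + 1) m hn k n (Nat.lt_succ_self _)
  refine ⟨U, fun k => ?_, fun k => ?_⟩
  · ext n
    have h1 := hcong (n i) U (W (n i)) (hUW (n i)) k
    rw [← hWs] at h1
    exact ((hUW (n i + 1) k).trans h1.symm) n (Nat.lt_succ_self _)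
  -- Any finite partial sum of the norm of the limit is a partial sum for some iterate, so the bound
  -- passes to the limit.
  · refine ne_top_of_le_ne_top hB ?_
    refine ENNReal.summable.tsum_le_of_sum_le fun s => ?_
    obtain ⟨m, hm⟩ : ∃ m, ∀ n ∈ s, n i < m :=
      ⟨s.sup (fun n => n i) + 1, fun n hn => Nat.lt_succ_of_le (Finset.le_sup (f := fun n => n i) hn)⟩
    refine le_trans (le_of_eq ?_) ((ENNReal.sum_le_tsum s).trans (hWB m k))
    exact Finset.sum_congr rfl fun n hn => by rw [hUW m k n (hm n hn)]

end Picard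

end FormalCauchy

/-! ### Convergent power series and their sums -/

namespace FormalCauchy

open MvPowerSeries Finsupp
open scoped NNReal ENNReal Topology

variable {σ : Type*}

/-- Absolute convergence on the closed polydisc of radius `r`. -/
def Conv (r : ℝ) (f : MvPowerSeries σ ℝ) : Prop :=
  Summable fun n : σ →₀ ℕ => |coeff n f| * r ^ n.degree

lemma Conv.mono {r s : ℝ} {f : MvPowerSeries σ ℝ} (h : Conv s f) (hr : 0 ≤ r) (hrs : r ≤ s) :
    Conv r f :=
  Summable.of_nonneg_of_le (fun _ => by positivity) (fun _ => by gcongr) h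

lemma Conv.nrm_one_ne_top {i j : σ} {R : ℝ≥0} {f : MvPowerSeries σ ℝ} (h : Conv R f) :
    nrm i j R 1 f ≠ ∞ := by
  have h' : Summable fun n : σ →₀ ℕ => ‖coeff n f‖₊ * R ^ n.degree := by
    rw [← NNReal.summable_coe]
    simpa [Conv] using h
  refine ne_top_of_le_ne_top (ENNReal.tsum_coe_ne_top_iff_summable.2 h') ?_
  refine ENNReal.tsum_le_tsum fun n => ?_
  rw [enorm_eq_nnnorm, ← ENNReal.coe_mul, ENNReal.coe_le_coe]
  gcongr
  exact wt_le le_rfl n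

lemma conv_of_nrm_ne_top [Fintype σ] {i j : σ} (hij : i ≠ j) {R θ : ℝ≥0} (hθ : θ ≤ 1)
    {f : MvPowerSeries σ ℝ} (h : nrm i j R θ f ≠ ∞) : Conv (θ * R / 2 : ℝ≥0) f := by
  have h' : Summable fun n : σ →₀ ℕ => ‖coeff n f‖₊ * wt i j R θ n := by
    rw [← ENNReal.tsum_coe_ne_top_iff_summable]
    simpa [nrm, enorm_eq_nnnorm] using h
  have h2 : Summable fun n : σ →₀ ℕ => ‖coeff n f‖₊ * (θ * R / 2) ^ n.degree :=
    NNReal.summable_of_le (fun n => mul_le_mul_of_nonneg_left (le_wt hij hθ n) zero_le) h'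
  rw [← NNReal.summable_coe] at h2
  simpa [Conv] using h2

/-- The degree factor is absorbed by the geometric gain from shrinking the radius, as (k + 1)(r/s)ᵏ
is bounded. -/
lemma Conv.pderiv {r s : ℝ} {f : MvPowerSeries σ ℝ} (h : Conv s f) (hr : 0 < r) (hrs : r < s)
    (i : σ) : Conv r (pderiv ℝ i f) := by
  have hs : 0 < s := hr.trans hrs
  have hinj : Function.Injective fun n : σ →₀ ℕ => n + single i 1 := add_left_injective _
  have h1 : Summable fun n : σ →₀ ℕ => |coeff (n + single i 1) f| * s ^ (n.degree + 1) := by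
    refine (h.comp_injective hinj).congr fun n => ?_
    simp
  have hq : |r / s| < 1 := by
    rw [abs_of_pos (by positivity), div_lt_one hs]; exact hrs
  have hb : ∃ c, ∀ k : ℕ, ((k : ℝ) + 1) * (r / s) ^ k ≤ c := by
    have hs1 : Summable fun k : ℕ => ((k : ℝ) + 1) * (r / s) ^ k := by
      have h1 := summable_pow_mul_geometric_of_norm_lt_one 1 (r := r / s) hq
      have h2 := summable_geometric_of_norm_lt_one (x := r / s) hq
      exact (h1.add h2).congr fun k => by ring
    obtain ⟨c, hc⟩ := hs1.tendsto_atTop_zero.bddAbove_range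
    exact ⟨c, fun k => hc ⟨k, rfl⟩⟩
  obtain ⟨c, hc⟩ := hb
  refine Summable.of_nonneg_of_le (fun n => by positivity) (fun n => ?_) (h1.mul_left (c / s))
  rw [coeff_pderiv, abs_mul]
  have hni : (n i : ℝ) ≤ n.degree := by exact_mod_cast le_degree i n
  have hc0 := hc n.degree
  have hc1 : ((n.degree : ℝ) + 1) * r ^ n.degree ≤ c * s ^ n.degree := by
    rw [div_pow, ← mul_div_assoc, div_le_iff₀ (by positivity)] at hc0
    exact hc0
  have ha : |((n i : ℝ) + 1)| = n i + 1 := abs_of_pos (by positivity)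
  rw [ha]
  calc _ = |coeff (n + single i 1) f| * (((n i : ℝ) + 1) * r ^ n.degree) := by ring
    _ ≤ |coeff (n + single i 1) f| * (((n.degree : ℝ) + 1) * r ^ n.degree) := by gcongr
    _ ≤ |coeff (n + single i 1) f| * (c * s ^ n.degree) := by gcongr
    _ = _ := by rw [pow_succ]; field_simp

variable [Fintype σ]

/-- The sum of a power series at `x`. -/
def ev (f : MvPowerSeries σ ℝ) (x : σ → ℝ) : ℝ := ∑' n : σ →₀ ℕ, coeff n f * ∏ i, x i ^ n i

lemma abs_prod_pow_le {x : σ → ℝ} {r : ℝ} (hx : ‖x‖ ≤ r) (n : σ →₀ ℕ) :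
    |∏ i, x i ^ n i| ≤ r ^ n.degree := by
  rw [Finset.abs_prod, degree_eq_sum, ← Finset.prod_pow_eq_pow_sum]
  refine Finset.prod_le_prod (fun _ _ => abs_nonneg _) fun i _ => ?_
  rw [abs_pow]
  have := (norm_le_pi_norm x i).trans hx
  rw [Real.norm_eq_abs] at this
  gcongr

lemma Conv.summable_norm {r : ℝ} {f : MvPowerSeries σ ℝ} (h : Conv r f) {x : σ → ℝ}
    (hx : ‖x‖ ≤ r) : Summable fun n : σ →₀ ℕ => ‖coeff n f * ∏ i, x i ^ n i‖ := by
  refine Summable.of_nonneg_of_le (fun _ => norm_nonneg _) (fun n => ?_) h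
  rw [norm_mul, Real.norm_eq_abs, Real.norm_eq_abs]
  gcongr
  exact abs_prod_pow_le hx n

lemma Conv.hasSum {r : ℝ} {f : MvPowerSeries σ ℝ} (h : Conv r f) {x : σ → ℝ}
    (hx : ‖x‖ ≤ r) : HasSum (fun n : σ →₀ ℕ => coeff n f * ∏ i, x i ^ n i) (ev f x) :=
  (h.summable_norm hx).of_norm.hasSum

lemma ev_zero (f : MvPowerSeries σ ℝ) : ev f 0 = coeff 0 f := by
  unfold ev
  rw [tsum_eq_single 0]
  · simp
  · intro n hn
    obtain ⟨i, hi⟩ : ∃ i, n i ≠ 0 := by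
      by_contra! h
      exact hn (Finsupp.ext h)
    rw [Finset.prod_eq_zero (Finset.mem_univ i), mul_zero]
    simp [hi]

omit [Fintype σ] in
lemma conv_C (r : ℝ) (a : ℝ) : Conv r (C (σ := σ) a) := by
  classical
  refine summable_of_ne_finset_zero (s := {0}) fun n hn => ?_
  have : n ≠ 0 := by simpa using hn
  simp [coeff_C, this]

lemma ev_C (a : ℝ) (x : σ → ℝ) : ev (C a) x = a := by
  classical
  unfold ev
  rw [tsum_eq_single 0]
  · simp
  · intro n hn
    simp [coeff_C, hn]

variable {r : ℝ} {f g : MvPowerSeries σ ℝ} {x : σ → ℝ}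

omit [Fintype σ] in
lemma Conv.add (hf : Conv r f) (hg : Conv r g) (hr : 0 ≤ r) : Conv r (f + g) := by
  refine Summable.of_nonneg_of_le (fun _ => by positivity) (fun n => ?_) (Summable.add hf hg)
  rw [← add_mul, map_add]
  gcongr
  exact abs_add_le _ _

lemma ev_add (hf : Conv r f) (hg : Conv r g) (hx : ‖x‖ ≤ r) :
    ev (f + g) x = ev f x + ev g x := by
  refine HasSum.tsum_eq ?_
  refine ((hf.hasSum hx).add (hg.hasSum hx)).congr_fun ?_
  intro n
  rw [map_add, add_mul]

omit [Fintype σ] in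
lemma Conv.mul (hf : Conv r f) (hg : Conv r g) (hr : 0 ≤ r) : Conv r (f * g) := by
  classical
  have hf' : Summable fun n : σ →₀ ℕ => ‖|coeff n f| * r ^ n.degree‖ := Summable.norm hf
  have hg' : Summable fun n : σ →₀ ℕ => ‖|coeff n g| * r ^ n.degree‖ := Summable.norm hg
  have h2 := summable_sum_mul_antidiagonal_of_summable_mul (summable_mul_of_summable_norm hf' hg')
  refine Summable.of_nonneg_of_le (fun _ => by positivity) (fun n => ?_) h2
  rw [coeff_mul]
  refine (mul_le_mul_of_nonneg_right (Finset.abs_sum_le_sum_abs _ _) (pow_nonneg hr _)).trans ?_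
  rw [Finset.sum_mul]
  refine le_of_eq (Finset.sum_congr rfl fun pq hpq => ?_)
  have h3 : n.degree = pq.1.degree + pq.2.degree := by
    rw [← Finset.HasAntidiagonal.mem_antidiagonal.1 hpq, map_add]
  rw [abs_mul, h3, pow_add]
  ring

lemma ev_mul (hf : Conv r f) (hg : Conv r g) (hx : ‖x‖ ≤ r) :
    ev (f * g) x = ev f x * ev g x := by
  classical
  unfold ev
  have h1 := hf.summable_norm hx
  have h2 := hg.summable_norm hx
  rw [Summable.tsum_mul_tsum_eq_tsum_sum_antidiagonal h1.of_norm h2.of_norm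
    (summable_mul_of_summable_norm h1 h2)]
  refine tsum_congr fun n => ?_
  rw [coeff_mul, Finset.sum_mul]
  refine Finset.sum_congr rfl fun pq hpq => ?_
  rw [← Finset.HasAntidiagonal.mem_antidiagonal.1 hpq]
  simp only [Finsupp.add_apply, pow_add, Finset.prod_mul_distrib]
  ring

omit [Fintype σ] in
lemma conv_aeval {τ : Type*} {v : τ → MvPowerSeries σ ℝ} (hr : 0 ≤ r) (hv : ∀ k, Conv r (v k))
    (P : MvPolynomial τ ℝ) : Conv r (MvPolynomial.aeval v P) := by
  induction P using MvPolynomial.induction_on with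
  | C a => rw [MvPolynomial.aeval_C]; exact conv_C r a
  | add p q hp hq => rw [map_add]; exact hp.add hq hr
  | mul_X p k hp => rw [map_mul, MvPolynomial.aeval_X]; exact hp.mul (hv k) hr

lemma ev_aeval {τ : Type*} {v : τ → MvPowerSeries σ ℝ} (hv : ∀ k, Conv r (v k))
    (hx : ‖x‖ ≤ r) (P : MvPolynomial τ ℝ) :
    ev (MvPolynomial.aeval v P) x = MvPolynomial.eval (fun k => ev (v k) x) P := by
  have hr : 0 ≤ r := (norm_nonneg x).trans hx
  induction P using MvPolynomial.induction_on with
  | C a => rw [MvPolynomial.aeval_C, MvPolynomial.eval_C]; exact ev_C a x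
  | add p q hp hq => rw [map_add, map_add, ev_add (conv_aeval hr hv p) (conv_aeval hr hv q) hx,
      hp, hq]
  | mul_X p k hp => rw [map_mul, map_mul, MvPolynomial.aeval_X, MvPolynomial.eval_X,
      ev_mul (conv_aeval hr hv p) (hv k) hx, hp]

omit [Fintype σ] in
lemma conv_sum {ι : Type*} (s : Finset ι) {F : ι → MvPowerSeries σ ℝ} (hr : 0 ≤ r)
    (hF : ∀ k ∈ s, Conv r (F k)) : Conv r (∑ k ∈ s, F k) := by
  classical
  induction s using Finset.induction_on with
  | empty => simpa using conv_C (σ := σ) r 0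
  | insert a s ha ih =>
    rw [Finset.sum_insert ha]
    exact (hF a (Finset.mem_insert_self _ _)).add
      (ih fun k hk => hF k (Finset.mem_insert_of_mem hk)) hr

lemma ev_sum {ι : Type*} (s : Finset ι) {F : ι → MvPowerSeries σ ℝ} (hx : ‖x‖ ≤ r)
    (hF : ∀ k ∈ s, Conv r (F k)) : ev (∑ k ∈ s, F k) x = ∑ k ∈ s, ev (F k) x := by
  classical
  induction s using Finset.induction_on with
  | empty => simpa using ev_C (σ := σ) 0 x
  | insert a s ha ih =>
    have h' : ∀ k ∈ s, Conv r (F k) := fun k hk => hF k (Finset.mem_insert_of_mem hk)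
    rw [Finset.sum_insert ha, Finset.sum_insert ha,
      ev_add (hF a (Finset.mem_insert_self _ _)) (conv_sum s ((norm_nonneg x).trans hx) h') hx, ih h']

/-- The homogeneous parts of a power series, as continuous multilinear maps. -/
def toFMS (f : MvPowerSeries σ ℝ) : FormalMultilinearSeries ℝ (σ → ℝ) ℝ := fun k =>
  haveI := Classical.decEq σ
  -- Each multi-index is spelled out as a list of variables. The list has length `k`, so the default
  -- value 0 is never used.
  ∑ n ∈ Finset.finsuppAntidiag Finset.univ k, coeff n f •
    (ContinuousMultilinearMap.mkPiAlgebra ℝ (Fin k) ℝ).compContinuousLinearMap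
      fun m => (n.toMultiset.toList.map fun i : σ =>
        (ContinuousLinearMap.proj i : (σ → ℝ) →L[ℝ] ℝ)).getD m 0

omit [Fintype σ] in
lemma prod_getD_eq (L : List ((σ → ℝ) →L[ℝ] ℝ)) (k : ℕ) (hk : L.length = k) (x : σ → ℝ) :
    ∏ m : Fin k, (L.getD m 0) x = (L.map fun l => l x).prod := by
  subst hk
  rw [← List.prod_ofFn]
  congr 1
  refine List.ext_getElem (by simp) fun m h1 h2 => ?_
  simp

lemma norm_getD_proj_le (L : List σ) (m : ℕ) :
    ‖(L.map fun i : σ => (ContinuousLinearMap.proj i : (σ → ℝ) →L[ℝ] ℝ)).getD m 0‖ ≤ 1 := by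
  by_cases hm : m < L.length
  · rw [List.getD_eq_getElem _ _ (by simpa using hm), List.getElem_map]
    refine ContinuousLinearMap.opNorm_le_bound _ zero_le_one fun x => ?_
    rw [one_mul]
    exact norm_le_pi_norm x _
  · rw [List.getD_eq_default _ _ (by simpa using hm)]
    simp

lemma toFMS_apply [DecidableEq σ] (f : MvPowerSeries σ ℝ) (k : ℕ) (x : σ → ℝ) :
    toFMS f k (fun _ => x)
      = ∑ n ∈ Finset.finsuppAntidiag Finset.univ k, coeff n f * ∏ i, x i ^ n i := by
  unfold toFMS
  rw [_root_.sum_apply]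
  refine Finset.sum_congr (by congr!) fun n hn => ?_
  have hdeg : n.degree = k := by
    rw [degree_eq_sum]; simpa using hn
  rw [_root_.smul_apply, smul_eq_mul,
    ContinuousMultilinearMap.compContinuousLinearMap_apply,
    ContinuousMultilinearMap.mkPiAlgebra_apply, prod_getD_eq]
  · rw [List.map_map]
    congr 1
    rw [show ((fun l : (σ → ℝ) →L[ℝ] ℝ => l x) ∘ fun i : σ =>
      (ContinuousLinearMap.proj i : (σ → ℝ) →L[ℝ] ℝ)) = x from rfl]
    rw [Multiset.prod_map_toList, Finsupp.toMultiset_map, Finsupp.prod_toMultiset]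
    rw [Finsupp.prod_mapDomain_index (by simp) (by simp [pow_add]), Finsupp.prod_fintype]
    simp
  · rw [List.length_map, Multiset.length_toList, Finsupp.card_toMultiset, ← hdeg]
    rfl

lemma norm_toFMS_le [DecidableEq σ] (f : MvPowerSeries σ ℝ) (k : ℕ) :
    ‖toFMS f k‖ ≤ ∑ n ∈ Finset.finsuppAntidiag Finset.univ k, |coeff n f| := by
  unfold toFMS
  refine (norm_sum_le _ _).trans (le_of_eq_of_le (Finset.sum_congr (by congr!) fun _ _ => rfl)
    (Finset.sum_le_sum fun n _ => ?_))
  rw [norm_smul, Real.norm_eq_abs]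
  refine mul_le_of_le_one_right (abs_nonneg _) ?_
  refine (ContinuousMultilinearMap.norm_compContinuousLinearMap_le _ _).trans ?_
  rw [ContinuousMultilinearMap.norm_mkPiAlgebra, one_mul]
  exact Finset.prod_le_one (fun _ _ => norm_nonneg _) fun m _ => norm_getD_proj_le _ _

lemma HasSum.degree_fiberwise [DecidableEq σ] {F : (σ →₀ ℕ) → ℝ} {s : ℝ} (h : HasSum F s) :
    HasSum (fun k : ℕ => ∑ n ∈ Finset.finsuppAntidiag Finset.univ k, F n) s := by
  have := HasSum.tsum_fiberwise h (fun n : σ →₀ ℕ => n.degree)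
  refine this.congr_fun fun k => ?_
  have hset : (fun n : σ →₀ ℕ => n.degree) ⁻¹' {k}
      = (Finset.finsuppAntidiag (Finset.univ : Finset σ) k : Set (σ →₀ ℕ)) := by
    ext n
    simp [degree_eq_sum]
  rw [hset]
  exact (Finset.tsum_subtype' _ F).symm

lemma Conv.hasFPowerSeriesOnBall (hf : Conv r f) (hr : 0 < r) :
    HasFPowerSeriesOnBall (ev f) (toFMS f) 0 (ENNReal.ofReal r) := by
  classical
  refine ⟨?_, by simpa using hr, fun {y} hy => ?_⟩
  · lift r to ℝ≥0 using hr.le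
    rw [ENNReal.ofReal_coe_nnreal]
    refine FormalMultilinearSeries.le_radius_of_summable _ ?_
    refine Summable.of_nonneg_of_le (fun _ => by positivity) (fun k => ?_)
      (HasSum.degree_fiberwise (Summable.hasSum hf)).summable
    refine (mul_le_mul_of_nonneg_right (norm_toFMS_le f k) (by positivity)).trans ?_
    rw [Finset.sum_mul]
    refine le_of_eq (Finset.sum_congr rfl fun n hn => ?_)
    have hdeg : n.degree = k := by rw [degree_eq_sum]; simpa using hn
    rw [hdeg]
  · rw [zero_add]
    have hy' : ‖y‖ ≤ r := by
      rw [Metric.mem_eball, edist_zero_right, ← ofReal_norm] at hy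
      exact ((ENNReal.ofReal_lt_ofReal_iff hr).1 hy).le
    refine (HasSum.degree_fiberwise (hf.hasSum hy')).congr_fun fun k => ?_
    exact toFMS_apply f k y

lemma Conv.analyticAt (hf : Conv r f) (hx : ‖x‖ < r) : AnalyticAt ℝ (ev f) x := by
  refine (hf.hasFPowerSeriesOnBall ((norm_nonneg x).trans_lt hx)).analyticAt_of_mem ?_
  rw [Metric.mem_eball, edist_zero_right, ← ofReal_norm]
  exact (ENNReal.ofReal_lt_ofReal_iff ((norm_nonneg x).trans_lt hx)).2 hx

end FormalCauchy

/-! ### Termwise differentiation, the identity principle and expansion of analytic functions -/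

namespace FormalCauchy

open MvPowerSeries Finsupp
open scoped NNReal ENNReal Topology

variable {σ : Type*}

lemma eq_add_single_of_ne_zero {i : σ} {n : σ →₀ ℕ} (hn : n i ≠ 0) :
    ∃ m : σ →₀ ℕ, m + Finsupp.single i 1 = n := by
  classical
  refine ⟨n - Finsupp.single i 1, ?_⟩
  ext k
  by_cases hk : k = i
  · subst hk; simp; omega
  · simp [hk]

variable [Fintype σ] {r s : ℝ} {f g : MvPowerSeries σ ℝ} {x : σ → ℝ}

/-- Differentiation term by term in one variable. The majorant `b` is, after a shift of the index,
dominated by the series of ∂ᵢf at a radius strictly between ‖x‖ and s. -/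
lemma Conv.hasDerivAt_ev_update [DecidableEq σ] (hf : Conv s f) (hx : ‖x‖ < s) (i : σ) :
    HasDerivAt (fun u => ev f (Function.update x i u)) (ev (MvPowerSeries.pderiv ℝ i f) x) (x i) := by
  obtain ⟨r, hxr, hrs⟩ := exists_between hx
  have hr : 0 < r := (norm_nonneg x).trans_lt hxr
  have hinj : Function.Injective fun n : σ →₀ ℕ => n + Finsupp.single i 1 := add_left_injective _
  set q : (σ →₀ ℕ) → ℝ := fun n => ∏ k ∈ Finset.univ.erase i, x k ^ n k with hq
  have hsplit : ∀ (n : σ →₀ ℕ) (u : ℝ),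
      ∏ k, Function.update x i u k ^ n k = u ^ n i * q n := by
    intro n u
    rw [← Finset.mul_prod_erase _ _ (Finset.mem_univ i), Function.update_self]
    congr 1
    refine Finset.prod_congr rfl fun k hk => ?_
    rw [Function.update_of_ne (Finset.ne_of_mem_erase hk)]
  have hqle : ∀ n : σ →₀ ℕ, |q n| * r ^ n i ≤ r ^ n.degree := by
    intro n
    rw [hq, Finset.abs_prod, degree_eq_sum, ← Finset.add_sum_erase _ _ (Finset.mem_univ i), pow_add,
      mul_comm, ← Finset.prod_pow_eq_pow_sum]
    refine mul_le_mul_of_nonneg_left (Finset.prod_le_prod (fun k _ => abs_nonneg _) fun k _ => ?_)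
      (by positivity)
    rw [abs_pow]
    have h1 : |x k| ≤ r := (norm_le_pi_norm x k).trans hxr.le
    gcongr
  have h2 : ∀ n, q (n + Finsupp.single i 1) = q n := fun n => by
    refine Finset.prod_congr rfl fun k hk => ?_
    have : (Finsupp.single i 1 : σ →₀ ℕ) k = 0 := by
      rw [Finsupp.single_apply, if_neg (Finset.ne_of_mem_erase hk).symm]
    simp [this]
  set b : (σ →₀ ℕ) → ℝ := fun n => |coeff n f| * (n i * r ^ (n i - 1) * |q n|) with hb
  have hbsum : Summable b := by
    refine (hinj.summable_iff fun n hn => ?_).1 ?_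
    · have : n i = 0 := by
        by_contra h
        exact hn (eq_add_single_of_ne_zero h)
      simp [hb, this]
    · refine Summable.of_nonneg_of_le (fun n => by simp only [hb, Function.comp]; positivity)
        (fun n => ?_) (hf.pderiv hr hrs i)
      rw [coeff_pderiv, abs_mul]
      have h1 : |((n i : ℝ) + 1)| = n i + 1 := abs_of_pos (by positivity)
      simp only [hb, Function.comp, Finsupp.add_apply, single_eq_same, Nat.add_sub_cancel, h1, h2]
      push_cast
      calc _ = |coeff (n + Finsupp.single i 1) f| * (n i + 1) * (|q n| * r ^ n i) := by ring
        _ ≤ _ := by gcongr; exact hqle n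
  have hmem : x i ∈ Metric.ball (0 : ℝ) r := by
    rw [mem_ball_zero_iff]; exact (norm_le_pi_norm x i).trans_lt hxr
  have key := hasDerivAt_tsum_of_isPreconnected (𝕜 := ℝ) (F := ℝ) (u := b)
    (g := fun (n : σ →₀ ℕ) u => coeff n f * ∏ k, Function.update x i u k ^ n k)
    (g' := fun (n : σ →₀ ℕ) u => coeff n f * (n i * u ^ (n i - 1) * q n)) hbsum
    Metric.isOpen_ball (convex_ball (0 : ℝ) r).isPreconnected
    (fun n u _ => by
      simp only [hsplit]
      exact ((hasDerivAt_pow (n i) u).mul_const _).const_mul _)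
    (fun n u hu => by
      rw [mem_ball_zero_iff, Real.norm_eq_abs] at hu
      rw [hb, norm_mul, norm_mul, norm_mul, norm_pow]
      simp only [Real.norm_eq_abs, Nat.abs_cast]
      gcongr)
    hmem (by simpa using (hf.summable_norm hx.le).of_norm) hmem
  refine key.congr_deriv ?_
  unfold ev
  rw [← hinj.tsum_eq]
  · refine tsum_congr fun n => ?_
    rw [coeff_pderiv]
    have h3 := hsplit n (x i)
    rw [Function.update_eq_self] at h3
    simp only [Finsupp.add_apply, single_eq_same, Nat.add_sub_cancel, h2, h3]
    push_cast
    ring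
  · intro n hn
    by_contra h
    have : n i = 0 := by
      by_contra h'
      exact h (eq_add_single_of_ne_zero h')
    simp [this] at hn

lemma Conv.fderiv_ev [DecidableEq σ] (hf : Conv s f) (hx : ‖x‖ < s) (i : σ) :
    fderiv ℝ (ev f) x (Pi.single i 1) = ev (MvPowerSeries.pderiv ℝ i f) x := by
  have h1 := (hf.analyticAt hx).differentiableAt.hasFDerivAt
  have h2 := _root_.hasDerivAt_update x i (x i)
  have h1' : HasFDerivAt (ev f) (fderiv ℝ (ev f) x) (Function.update x i (x i)) := by
    rwa [Function.update_eq_self]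
  exact (h1'.comp_hasDerivAt (x i) h2).unique (hf.hasDerivAt_ev_update hx i)

/-- A power series vanishing as a function near the origin is zero. -/
lemma Conv.eq_zero_of_eventually_ev (hf : Conv s f) (hs : 0 < s) (h : ∀ᶠ x in 𝓝 0, ev f x = 0) :
    f = 0 := by
  classical
  ext n
  rw [map_zero]
  induction hn : n.degree generalizing n f s with
  | zero =>
    rw [degree_eq_zero_iff] at hn
    rw [hn, ← ev_zero]
    exact h.self_of_nhds
  | succ k ih =>
    obtain ⟨i, hi⟩ : ∃ i, n i ≠ 0 := by
      by_contra! h0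
      rw [Finsupp.ext (g := 0) h0] at hn
      simp at hn
    obtain ⟨m, rfl⟩ := eq_add_single_of_ne_zero hi
    have hm : m.degree = k := by simpa using hn
    -- Local vanishing passes to the derivative, whose coefficient at `m` is a positive multiple of
    -- the coefficient in question; the degree has dropped by one.
    have hev : ∀ᶠ x in 𝓝 (0 : σ → ℝ), ev (MvPowerSeries.pderiv ℝ i f) x = 0 := by
      have hball : ∀ᶠ x in 𝓝 (0 : σ → ℝ), ‖x‖ < s := by
        simpa [Metric.ball, dist_zero_right] using! Metric.ball_mem_nhds (0 : σ → ℝ) hs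
      filter_upwards [h.eventually_nhds, hball] with x hx hxs
      rw [← hf.fderiv_ev hxs]
      have : ev f =ᶠ[𝓝 x] fun _ => 0 := hx
      rw [this.fderiv_eq]
      simp
    have := ih (hf.pderiv (half_pos hs) (half_lt_self hs) i) (half_pos hs) hev m hm
    rw [coeff_pderiv] at this
    exact (mul_eq_zero.1 this).resolve_right (by positivity)

/-- The multi-index counting the letters of a word. -/
def wordType {k : ℕ} (a : Fin k → σ) : σ →₀ ℕ := ∑ m, Finsupp.single (a m) 1

omit [Fintype σ] in
lemma degree_wordType {k : ℕ} (a : Fin k → σ) : (wordType a).degree = k := by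
  simp [wordType, map_sum]

lemma prod_wordType {k : ℕ} (a : Fin k → σ) (x : σ → ℝ) :
    ∏ i, x i ^ wordType a i = ∏ m, x (a m) := by
  classical
  have : ∀ i, x i ^ wordType a i = ∏ m, x i ^ (Finsupp.single (a m) 1 : σ →₀ ℕ) i := by
    intro i
    rw [Finset.prod_pow_eq_pow_sum, wordType, Finsupp.finsetSum_apply]
  simp only [this]
  rw [Finset.prod_comm]
  refine Finset.prod_congr rfl fun m _ => ?_
  rw [Finset.prod_eq_single (a m)]
  · simp
  · intro i _ hi
    rw [Finsupp.single_apply, if_neg (Ne.symm hi), pow_zero]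
  · simp

/-- A real analytic function is the sum of a convergent power series. -/
lemma exists_conv_of_analyticAt {F : (σ → ℝ) → ℝ} (hF : AnalyticAt ℝ F 0) :
    ∃ (r : ℝ) (f : MvPowerSeries σ ℝ), 0 < r ∧ Conv r f ∧ ∀ x, ‖x‖ < r → ev f x = F x := by
  classical
  obtain ⟨p, ρ, hp⟩ := hF
  set e : σ → (σ → ℝ) := fun i => Pi.single i 1 with he
  -- By multilinearity the values of `p` on words in the basis vectors determine it on the diagonal;
  -- the coefficient at `n` collects all words of type `n`.
  set f : MvPowerSeries σ ℝ := fun n =>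
    ∑ a : Fin n.degree → σ with wordType a = n, p n.degree (fun m => e (a m)) with hf
  have hcoeff : ∀ (n : σ →₀ ℕ) (k : ℕ), n.degree = k →
      coeff n f = ∑ a : Fin k → σ with wordType a = n, p k (fun m => e (a m)) := by
    rintro n k rfl
    rfl
  have hmaps : ∀ (k : ℕ), ∀ a ∈ (Finset.univ : Finset (Fin k → σ)),
      wordType a ∈ Finset.finsuppAntidiag (Finset.univ : Finset σ) k := by
    intro k a _
    have := degree_wordType a
    rw [degree_eq_sum] at this
    simpa using this
  have hnorm_e : ∀ i, ‖e i‖ ≤ 1 := by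
    intro i
    refine (pi_norm_le_iff_of_nonneg zero_le_one).2 fun k => ?_
    rw [he]
    by_cases hk : k = i
    · subst hk; simp
    · simp [Pi.single_eq_of_ne hk]
  have hpe : ∀ (k : ℕ) (a : Fin k → σ), |p k (fun m => e (a m))| ≤ ‖p k‖ := by
    intro k a
    rw [← Real.norm_eq_abs]
    refine ((p k).le_opNorm _).trans (mul_le_of_le_one_right (norm_nonneg _) ?_)
    exact Finset.prod_le_one (fun _ _ => norm_nonneg _) fun m _ => hnorm_e _
  have hsum_abs : ∀ k : ℕ, ∑ n ∈ Finset.finsuppAntidiag (Finset.univ : Finset σ) k, |coeff n f|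
      ≤ (Fintype.card σ : ℝ) ^ k * ‖p k‖ := by
    intro k
    calc _ ≤ ∑ n ∈ Finset.finsuppAntidiag (Finset.univ : Finset σ) k,
          ∑ a : Fin k → σ with wordType a = n, ‖p k‖ := by
          refine Finset.sum_le_sum fun n hn => ?_
          rw [hcoeff n k (by rw [degree_eq_sum]; simpa using hn)]
          exact (Finset.abs_sum_le_sum_abs _ _).trans (Finset.sum_le_sum fun a _ => hpe k a)
      _ = ∑ a : Fin k → σ, ‖p k‖ := Finset.sum_fiberwise_of_maps_to (hmaps k) _
      _ = _ := by simp
  obtain ⟨s, hs0, hsρ⟩ := ENNReal.lt_iff_exists_nnreal_btwn.1 hp.r_pos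
  have hs : 0 < s := by exact_mod_cast hs0
  have hsr : (s : ℝ≥0∞) < p.radius := hsρ.trans_le hp.r_le
  have hsum := p.summable_norm_mul_pow hsr
  -- There are `card σ ^ k` words of length `k`, so the radius has to be divided by the number of
  -- variables; the added 1 avoids division by zero.
  set N : ℝ := Fintype.card σ + 1 with hN
  have hN1 : 0 < N := by positivity
  set r : ℝ := s / N with hr
  have hr0 : 0 < r := by positivity
  have hrs : r ≤ s := div_le_self s.2 (by simp [hN])
  have hconv : Conv r f := by
    refine summable_of_sum_le (fun n => by positivity) (c := ∑' k, ‖p k‖ * (s : ℝ) ^ k) fun u => ?_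
    obtain ⟨K, hK⟩ : ∃ K, ∀ n ∈ u, n.degree ∈ Finset.range K :=
      ⟨u.sup degree + 1, fun n hn => Finset.mem_range.2
        (Nat.lt_succ_of_le (Finset.le_sup (f := degree) hn))⟩
    rw [← Finset.sum_fiberwise_of_maps_to hK]
    refine le_trans (Finset.sum_le_sum fun k _ => ?_)
      (hsum.sum_le_tsum (Finset.range K) fun k _ => by positivity)
    calc _ ≤ ∑ n ∈ Finset.finsuppAntidiag (Finset.univ : Finset σ) k, |coeff n f| * r ^ k := by
          refine le_trans (le_of_eq (Finset.sum_congr rfl fun n hn => ?_))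
            (Finset.sum_le_sum_of_subset_of_nonneg (s := u.filter fun n => n.degree = k) ?_
              fun _ _ _ => by positivity)
          · rw [(Finset.mem_filter.1 hn).2]
          · intro n hn
            have := (Finset.mem_filter.1 hn).2
            rw [degree_eq_sum] at this
            simpa using this
      _ ≤ (Fintype.card σ : ℝ) ^ k * ‖p k‖ * r ^ k := by
          rw [← Finset.sum_mul]; gcongr; exact hsum_abs k
      _ ≤ N ^ k * ‖p k‖ * r ^ k := by gcongr; simp [hN]
      _ = ‖p k‖ * (s : ℝ) ^ k := by rw [hr, div_pow]; field_simp
  refine ⟨r, f, hr0, hconv, fun x hx => ?_⟩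
  have hxs : x ∈ Metric.eball (0 : σ → ℝ) ρ := by
    rw [Metric.mem_eball, edist_zero_right]
    refine lt_of_le_of_lt ?_ hsρ
    rw [enorm_eq_nnnorm]
    exact_mod_cast (hx.le.trans hrs)
  have h1 := hp.hasSum hxs
  have h2 := HasSum.degree_fiberwise (hconv.hasSum hx.le)
  rw [zero_add] at h1
  refine h2.unique (h1.congr_fun fun k => ?_)
  have hx' : x = ∑ i, x i • e i := by
    ext k
    simp [he, Finset.sum_apply, Pi.single_apply]
  have hexp : p k (fun _ => x) = ∑ a : Fin k → σ, (∏ m, x (a m)) * p k (fun m => e (a m)) := by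
    conv_lhs => rw [hx']
    rw [ContinuousMultilinearMap.map_sum (p k) (fun (_ : Fin k) i => x i • e i)]
    refine Finset.sum_congr rfl fun a _ => ?_
    rw [(p k).map_smul_univ, smul_eq_mul]
  rw [hexp, ← Finset.sum_fiberwise_of_maps_to (hmaps k)]
  refine Finset.sum_congr rfl fun n hn => ?_
  rw [hcoeff n k (by rw [degree_eq_sum]; simpa using hn), Finset.sum_mul]
  refine Finset.sum_congr rfl fun a ha => ?_
  rw [← prod_wordType, (Finset.mem_filter.1 ha).2, mul_comm]

end FormalCauchy

/-! ### Initial data on the hyperplane xᵢ = 0 -/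

namespace FormalCauchy

open MvPowerSeries Finsupp
open scoped NNReal ENNReal Topology

variable {σ : Type*}

/-- The terms of a power series not involving the variable `i`. -/
def restrict (i : σ) (f : MvPowerSeries σ ℝ) : MvPowerSeries σ ℝ :=
  fun n => if n i = 0 then coeff n f else 0

lemma coeff_restrict (i : σ) (f : MvPowerSeries σ ℝ) (n : σ →₀ ℕ) :
    coeff n (restrict i f) = if n i = 0 then coeff n f else 0 := rfl

lemma pderiv_restrict (i : σ) (f : MvPowerSeries σ ℝ) :
    MvPowerSeries.pderiv ℝ i (restrict i f) = 0 := by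
  ext n
  rw [coeff_pderiv, coeff_restrict, if_neg (by simp)]
  simp

lemma Conv.restrict {r : ℝ} {f : MvPowerSeries σ ℝ} (h : Conv r f) (hr : 0 ≤ r) (i : σ) :
    Conv r (restrict i f) := by
  refine Summable.of_nonneg_of_le (fun _ => by positivity) (fun n => ?_) h
  rw [coeff_restrict]
  split_ifs with h0
  · exact le_rfl
  · rw [abs_zero, zero_mul]; positivity

variable [Fintype σ]

lemma AgreeUpTo.ev_eq {i : σ} {f g : MvPowerSeries σ ℝ} (h : AgreeUpTo i 1 f g) {x : σ → ℝ}
    (hx : x i = 0) : ev f x = ev g x := by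
  refine tsum_congr fun n => ?_
  by_cases hn : n i = 0
  · rw [h n (by omega)]
  · rw [Finset.prod_eq_zero (Finset.mem_univ i) (by rw [hx, zero_pow hn]), mul_zero, mul_zero]

omit [Fintype σ] in
lemma agreeUpTo_restrict (i : σ) (f : MvPowerSeries σ ℝ) : AgreeUpTo i 1 (restrict i f) f :=
  fun n hn => by rw [coeff_restrict, if_pos (by omega)]

lemma ev_restrict_update [DecidableEq σ] (i : σ) (f : MvPowerSeries σ ℝ) (x : σ → ℝ) (u : ℝ) :
    ev (restrict i f) (Function.update x i u) = ev (restrict i f) x := by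
  refine tsum_congr fun n => ?_
  rw [coeff_restrict]
  split_ifs with hn
  · congr 1
    refine Finset.prod_congr rfl fun k _ => ?_
    by_cases hk : k = i
    · subst hk; simp [hn]
    · rw [Function.update_of_ne hk]
  · simp

/-- Convergence is stated for all sufficiently small radii so that several families can be given a
common radius. -/
lemma exists_expansion {ι : Type*} [Finite ι] {F : ι → (σ → ℝ) → ℝ}
    (hF : ∀ k, AnalyticAt ℝ (F k) 0) :
    ∃ f : ι → MvPowerSeries σ ℝ, (∀ᶠ r in 𝓝[>] (0 : ℝ), ∀ k, Conv r (f k)) ∧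
      ∀ᶠ x in 𝓝 0, ∀ k, ev (f k) x = F k x := by
  choose r f hr hc he using fun k => exists_conv_of_analyticAt (hF k)
  refine ⟨f, ?_, ?_⟩
  · rw [Filter.eventually_all]
    intro k
    filter_upwards [Ioo_mem_nhdsGT (hr k)] with s hs
    exact (hc k).mono hs.1.le hs.2.le
  · rw [Filter.eventually_all]
    intro k
    filter_upwards [Metric.ball_mem_nhds (0 : σ → ℝ) (hr k)] with x hx
    exact he k x (by simpa using hx)

omit [Fintype σ] in
-- ∂ᵢ undoes the formal integration and kills the restricted initial data, so the fixed-point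
-- equation differentiates to the differential equation.
lemma pderiv_picard_fixedPoint {ι κ : Type*} [Fintype ι] {i j : σ}
    {P : ι → ι → MvPolynomial (κ ⊕ ι) ℝ} {Q : ι → MvPolynomial (κ ⊕ ι) ℝ}
    {a : κ → MvPowerSeries σ ℝ} {u U : ι → MvPowerSeries σ ℝ}
    (h : ∀ k, U k = picard i j P Q a (fun k => restrict i (u k)) U k) (k : ι) :
    MvPowerSeries.pderiv ℝ i (U k) = ∑ l, MvPolynomial.aeval (Sum.elim a U) (P k l) *
      MvPowerSeries.pderiv ℝ j (U l) + MvPolynomial.aeval (Sum.elim a U) (Q k) := by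
  conv_lhs => rw [h k]
  rw [picard, map_add, map_add, map_sum, pderiv_restrict, zero_add, pderiv_integ]
  simp only [pderiv_integ]

omit [Fintype σ] in
lemma agreeUpTo_integ (i : σ) (f : MvPowerSeries σ ℝ) : AgreeUpTo i 1 (integ i f) 0 :=
  fun n hn => by rw [coeff_integ, if_pos (by omega), map_zero]

omit [Fintype σ] in
lemma picard_agreeUpTo {ι κ : Type*} [Fintype ι] {i j : σ}
    {P : ι → ι → MvPolynomial (κ ⊕ ι) ℝ} {Q : ι → MvPolynomial (κ ⊕ ι) ℝ}
    {a : κ → MvPowerSeries σ ℝ} {u U : ι → MvPowerSeries σ ℝ} (k : ι) :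
    AgreeUpTo i 1 (picard i j P Q a u U k) (u k) := by
  have h := ((AgreeUpTo.rfl' (i := i) (k := 1) (f := u k)).add
    (AgreeUpTo.sum (s := Finset.univ) fun l _ => agreeUpTo_integ i
      (MvPolynomial.aeval (Sum.elim a U) (P k l) * MvPowerSeries.pderiv ℝ j (U l)))).add
    (agreeUpTo_integ i (MvPolynomial.aeval (Sum.elim a U) (Q k)))
  simpa [picard] using h

end FormalCauchy

/-! ### Cauchy–Kovalevskaya existence and linear uniqueness -/

open FormalCauchy MvPowerSeries in
/-- The Cauchy–Kovalevskaya theorem for quasilinear systems with polynomial nonlinearities, on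
`σ → ℝ` with data on the hyperplane `xᵢ = 0`. -/
theorem exists_analytic_cauchy_pi {σ ι κ : Type*} [Fintype σ] [DecidableEq σ] [Fintype ι]
    [Finite κ] {i j : σ} (hij : i ≠ j)
    (P : ι → ι → MvPolynomial (κ ⊕ ι) ℝ) (Q : ι → MvPolynomial (κ ⊕ ι) ℝ)
    {a : κ → (σ → ℝ) → ℝ} (ha : ∀ k, AnalyticAt ℝ (a k) 0)
    {u : ι → (σ → ℝ) → ℝ} (hu : ∀ k, AnalyticAt ℝ (u k) 0) :
    ∃ U : ι → (σ → ℝ) → ℝ, (∀ k, AnalyticAt ℝ (U k) 0) ∧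
      (∀ᶠ x in nhds 0, ∀ k, fderiv ℝ (U k) x (Pi.single i 1)
        = ∑ l, MvPolynomial.eval (Sum.elim (fun k => a k x) fun k => U k x) (P k l) *
            fderiv ℝ (U l) x (Pi.single j 1)
          + MvPolynomial.eval (Sum.elim (fun k => a k x) fun k => U k x) (Q k)) ∧
      ∀ᶠ x in nhds 0, x i = 0 → ∀ k, U k x = u k x := by
  have := Fintype.ofFinite κ
  obtain ⟨fa, hfa, hfa'⟩ := exists_expansion ha
  obtain ⟨fu, hfu, hfu'⟩ := exists_expansion hu
  obtain ⟨R, ⟨hRa, hRu⟩, hR0⟩ := ((hfa.and hfu).and self_mem_nhdsWithin).exists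
  lift R to NNReal using le_of_lt hR0
  have hR0' : 0 < R := by simpa using hR0
  obtain ⟨θ, hθ0, hθ1, U, hU, hUn⟩ := exists_fixedPoint hij R P Q fa
    (fun k => restrict i (fu k)) (fun k => (hRa k).nrm_one_ne_top)
    (fun k => ((hRu k).restrict R.2 i).nrm_one_ne_top)
  set s : ℝ := ((θ * R / 2 : NNReal) : ℝ) with hs
  have hs0 : 0 < s := by rw [hs]; positivity
  have hUs : ∀ k, Conv s (U k) := fun k => conv_of_nrm_ne_top hij hθ1 (hUn k)
  have hsR : s ≤ R := by
    rw [hs]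
    have h1 : (θ : ℝ) ≤ 1 := hθ1
    have h2 : (0 : ℝ) ≤ R := R.2
    push_cast
    nlinarith
  -- Derivatives of the solution are only known to converge on strictly smaller polydiscs, hence the
  -- halved radius.
  have hs2 : 0 < s / 2 := half_pos hs0
  have hs2' : s / 2 < s := half_lt_self hs0
  have hv : ∀ k, Conv (s / 2) (Sum.elim fa U k) := by
    rintro (k | k)
    · exact (hRa k).mono hs2.le (hs2'.le.trans hsR)
    · exact (hUs k).mono hs2.le hs2'.le
  have hball : ∀ᶠ x in nhds (0 : σ → ℝ), ‖x‖ < s / 2 := by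
    simpa [Metric.ball, dist_zero_right] using! Metric.ball_mem_nhds (0 : σ → ℝ) hs2
  refine ⟨fun k => ev (U k), fun k => (hUs k).analyticAt (by simpa using hs0), ?_, ?_⟩
  · filter_upwards [hball, hfa'] with x hx hax k
    have hxs := hx.trans hs2'
    have hev : (Sum.elim (fun k => a k x) fun k => ev (U k) x)
        = fun k => ev (Sum.elim fa U k) x := by
      funext k
      rcases k with k | k
      · exact (hax k).symm
      · rfl
    rw [(hUs k).fderiv_ev hxs, pderiv_picard_fixedPoint hU k, hev, ev_add _ _ hx.le,
      ev_sum _ hx.le, ev_aeval hv hx.le]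
    · congr 1
      refine Finset.sum_congr rfl fun l _ => ?_
      rw [ev_mul (conv_aeval hs2.le hv _) ((hUs l).pderiv hs2 hs2' j) hx.le, ev_aeval hv hx.le,
        (hUs l).fderiv_ev hxs]
    · exact fun l _ => (conv_aeval hs2.le hv _).mul ((hUs l).pderiv hs2 hs2' j) hs2.le
    · exact conv_sum _ hs2.le fun l _ =>
        (conv_aeval hs2.le hv _).mul ((hUs l).pderiv hs2 hs2' j) hs2.le
    · exact conv_aeval hs2.le hv _
  · filter_upwards [hfu'] with x hx hxi k
    rw [← hx k]
    refine AgreeUpTo.ev_eq ?_ hxi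
    rw [hU k]
    exact (picard_agreeUpTo k).trans (agreeUpTo_restrict i _)

open FormalCauchy MvPowerSeries in
/-- Uniqueness of the zero solution of a linear homogeneous analytic Cauchy problem. -/
theorem eventually_eq_zero_of_linear_cauchy_pi {σ ι : Type*} [Fintype σ] [DecidableEq σ]
    [Fintype ι] {i j : σ} (hij : i ≠ j)
    {b c : ι → ι → (σ → ℝ) → ℝ} (hb : ∀ k l, AnalyticAt ℝ (b k l) 0)
    (hc : ∀ k l, AnalyticAt ℝ (c k l) 0)
    {W : ι → (σ → ℝ) → ℝ} (hW : ∀ k, AnalyticAt ℝ (W k) 0)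
    (heq : ∀ᶠ x in nhds 0, ∀ k, fderiv ℝ (W k) x (Pi.single i 1)
      = ∑ l, (b k l x * fderiv ℝ (W l) x (Pi.single j 1) + c k l x * W l x))
    (h0 : ∀ᶠ x in nhds 0, x i = 0 → ∀ k, W k x = 0) :
    ∀ᶠ x in nhds 0, ∀ k, W k x = 0 := by
  obtain ⟨w, hw, hw'⟩ := exists_expansion hW
  obtain ⟨fb, hfb, hfb'⟩ := exists_expansion (F := fun kl : ι × ι => b kl.1 kl.2)
    fun kl => hb kl.1 kl.2
  obtain ⟨fc, hfc, hfc'⟩ := exists_expansion (F := fun kl : ι × ι => c kl.1 kl.2)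
    fun kl => hc kl.1 kl.2
  obtain ⟨s, ⟨⟨hws, hbs⟩, hcs⟩, hs⟩ :=
    (((hw.and hfb).and hfc).and self_mem_nhdsWithin).exists
  have hs0 : 0 < s := hs
  have hs2 : 0 < s / 2 := half_pos hs0
  have hs2' : s / 2 < s := half_lt_self hs0
  have hball : ∀ᶠ x in nhds (0 : σ → ℝ), ‖x‖ < s / 2 := by
    simpa [Metric.ball, dist_zero_right] using! Metric.ball_mem_nhds (0 : σ → ℝ) hs2
  have hbs' : ∀ kl, Conv (s / 2) (fb kl) := fun kl => (hbs kl).mono hs2.le hs2'.le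
  have hcs' : ∀ kl, Conv (s / 2) (fc kl) := fun kl => (hcs kl).mono hs2.le hs2'.le
  have hws' : ∀ k, Conv (s / 2) (w k) := fun k => (hws k).mono hs2.le hs2'.le
  -- The identity principle turns the differential equation near 0 into an identity of formal power
  -- series.
  have hformal : ∀ k, MvPowerSeries.pderiv ℝ i (w k)
      = ∑ l, (fb (k, l) * MvPowerSeries.pderiv ℝ j (w l) + fc (k, l) * w l) := by
    intro k
    have hc1 : ∀ l ∈ Finset.univ, Conv (s / 2)
        (fb (k, l) * MvPowerSeries.pderiv ℝ j (w l) + fc (k, l) * w l) := fun l _ =>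
      ((hbs' _).mul ((hws l).pderiv hs2 hs2' j) hs2.le).add ((hcs' _).mul (hws' l) hs2.le) hs2.le
    have hc2 := conv_sum Finset.univ hs2.le hc1
    have hc3 := (hws k).pderiv hs2 hs2' i
    have hneg : Conv (s / 2) (C (σ := σ) (-1 : ℝ) * ∑ l, (fb (k, l) *
        MvPowerSeries.pderiv ℝ j (w l) + fc (k, l) * w l)) := (conv_C _ _).mul hc2 hs2.le
    have hz : MvPowerSeries.pderiv ℝ i (w k) + C (σ := σ) (-1 : ℝ) * ∑ l, (fb (k, l) *
        MvPowerSeries.pderiv ℝ j (w l) + fc (k, l) * w l) = 0 := by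
      refine (hc3.add hneg hs2.le).eq_zero_of_eventually_ev hs2 ?_
      filter_upwards [hball, heq, hw'.eventually_nhds, hfb', hfc'] with x hx hxe hxw hxb hxc
      have hd : ∀ l v, fderiv ℝ (ev (w l)) x v = fderiv ℝ (W l) x v := by
        intro l v
        have : ev (w l) =ᶠ[nhds x] W l := hxw.mono fun y hy => hy l
        rw [this.fderiv_eq]
      have hxs := hx.trans hs2'
      rw [ev_add hc3 hneg hx.le, ev_mul (conv_C _ _) hc2 hx.le, ev_C, ev_sum _ hx.le hc1,
        ← (hws k).fderiv_ev hxs, hd, hxe k, neg_one_mul, ← sub_eq_add_neg, sub_eq_zero]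
      refine Finset.sum_congr rfl fun l _ => ?_
      rw [ev_add ((hbs' _).mul ((hws l).pderiv hs2 hs2' j) hs2.le) ((hcs' _).mul (hws' l) hs2.le)
        hx.le, ev_mul (hbs' _) ((hws l).pderiv hs2 hs2' j) hx.le, ev_mul (hcs' _) (hws' l) hx.le,
        ← (hws l).fderiv_ev hxs, hd, hxb (k, l), hxc (k, l), hxw.self_of_nhds l]
    rw [map_neg, map_one, neg_one_mul, ← sub_eq_add_neg, sub_eq_zero] at hz
    exact hz
  -- Evaluating at points projected to xᵢ = 0 shows that the xᵢ-free part of the series vanishes as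
  -- a function.
  have hrestr : ∀ k, restrict i (w k) = 0 := by
    intro k
    refine ((hws k).restrict hs0.le i).eq_zero_of_eventually_ev hs0 ?_
    have hcont : Filter.Tendsto (fun x : σ → ℝ => Function.update x i 0) (nhds 0) (nhds 0) := by
      have : Continuous fun x : σ → ℝ => Function.update x i (0 : ℝ) :=
        continuous_id.update i continuous_const
      simpa using! this.tendsto 0
    filter_upwards [hcont.eventually h0, hcont.eventually hw'] with x hx hxw
    rw [← ev_restrict_update i (w k) x 0,
      (agreeUpTo_restrict i (w k)).ev_eq (Function.update_self i 0 x), hxw k]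
    exact hx (Function.update_self i 0 x) k
  -- Induction on the order in xᵢ: the equation expresses ∂ᵢw through terms that already vanish to
  -- order `m`, because ∂ⱼ does not lower that order.
  have hagree : ∀ m k, AgreeUpTo i m (w k) 0 := by
    intro m
    induction m with
    | zero => intro k n hn; omega
    | succ m ih =>
      intro k n hn
      by_cases hni : n i = 0
      · have := congrArg (coeff n) (hrestr k)
        rwa [coeff_restrict, if_pos hni] at this
      · obtain ⟨n, rfl⟩ := eq_add_single_of_ne_zero hni
        have h1 : AgreeUpTo i m (MvPowerSeries.pderiv ℝ i (w k)) 0 := by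
          rw [hformal k]
          have : AgreeUpTo i m
              (∑ l, (fb (k, l) * MvPowerSeries.pderiv ℝ j (w l) + fc (k, l) * w l))
              (∑ l, (fb (k, l) * MvPowerSeries.pderiv ℝ j 0 + fc (k, l) * 0)) :=
            AgreeUpTo.sum fun l _ => (AgreeUpTo.rfl'.mul ((ih l).pderiv hij)).add
              (AgreeUpTo.rfl'.mul (ih l))
          simpa using this
        have h2 := h1 n (by simpa using hn)
        rw [coeff_pderiv, map_zero] at h2
        rw [map_zero]
        exact (mul_eq_zero.1 h2).resolve_right (by positivity)
  filter_upwards [hw'] with x hx k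
  have : w k = 0 := by
    ext n
    exact hagree (n i + 1) k n (Nat.lt_succ_self _)
  rw [← hx k, this]
  simp [ev]

/-! ### Transfer to linear coordinates centred at a point -/

section Transfer

variable {σ ι κ : Type*}
  {E : Type*} [NormedAddCommGroup E] [NormedSpace ℝ E]

lemma tendsto_chart (φ : E ≃L[ℝ] (σ → ℝ)) (p : E) :
    Filter.Tendsto (fun x => φ (x - p)) (nhds p) (nhds 0) := by
  have : Continuous fun x => φ (x - p) := by fun_prop
  simpa using this.tendsto p

lemma tendsto_chart_symm (φ : E ≃L[ℝ] (σ → ℝ)) (p : E) :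
    Filter.Tendsto (fun x => p + φ.symm x) (nhds 0) (nhds p) := by
  have : Continuous fun x => p + φ.symm x := by fun_prop
  simpa using this.tendsto 0

variable [Fintype σ]

lemma analyticAt_comp_chart_symm (φ : E ≃L[ℝ] (σ → ℝ)) {p : E} {f : E → ℝ} (hf : AnalyticAt ℝ f p) :
    AnalyticAt ℝ (fun x => f (p + φ.symm x)) 0 := by
  have h1 : AnalyticAt ℝ (fun x : σ → ℝ => p + φ.symm x) 0 :=
    analyticAt_const.add (φ.symm.toContinuousLinearMap.analyticAt 0)
  exact AnalyticAt.fun_comp (by simpa using hf) h1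

lemma analyticAt_comp_chart (φ : E ≃L[ℝ] (σ → ℝ)) {p x : E} {f : (σ → ℝ) → ℝ}
    (hf : AnalyticAt ℝ f (φ (x - p))) :
    AnalyticAt ℝ (fun x => f (φ (x - p))) x := by
  have h1 : AnalyticAt ℝ (fun x : E => φ (x - p)) x :=
    (φ.toContinuousLinearMap.analyticAt _).fun_comp (analyticAt_id.sub analyticAt_const)
  exact AnalyticAt.fun_comp hf h1

lemma fderiv_comp_chart (φ : E ≃L[ℝ] (σ → ℝ)) {p x : E} {f : (σ → ℝ) → ℝ}
    (hf : DifferentiableAt ℝ f (φ (x - p))) (v : E) :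
    fderiv ℝ (fun x => f (φ (x - p))) x v = fderiv ℝ f (φ (x - p)) (φ v) := by
  have h1 : HasFDerivAt (fun x : E => φ (x - p)) (φ : E →L[ℝ] (σ → ℝ)) x := by
    have := φ.hasFDerivAt (x := x - p)
    simpa using! this.comp x ((hasFDerivAt_id x).sub_const p)
  exact congrArg (fun l => l v) (hf.hasFDerivAt.comp x h1).fderiv

lemma fderiv_comp_chart_symm (φ : E ≃L[ℝ] (σ → ℝ)) {p : E} {x : σ → ℝ} {f : E → ℝ}
    (hf : DifferentiableAt ℝ f (p + φ.symm x)) (v : σ → ℝ) :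
    fderiv ℝ (fun x => f (p + φ.symm x)) x v = fderiv ℝ f (p + φ.symm x) (φ.symm v) := by
  have h1 : HasFDerivAt (fun x => p + φ.symm x) (φ.symm : (σ → ℝ) →L[ℝ] E) x :=
    φ.symm.hasFDerivAt.const_add p
  exact congrArg (fun l => l v) (hf.hasFDerivAt.comp x h1).fderiv

variable [DecidableEq σ] [Fintype ι]

/-- The Cauchy–Kovalevskaya theorem for quasilinear systems with polynomial nonlinearities, in
linear coordinates `φ` centred at `p`. -/
theorem exists_analytic_cauchy [Finite κ] (φ : E ≃L[ℝ] (σ → ℝ)) (p : E) {i j : σ} (hij : i ≠ j)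
    (P : ι → ι → MvPolynomial (κ ⊕ ι) ℝ) (Q : ι → MvPolynomial (κ ⊕ ι) ℝ)
    {a : κ → E → ℝ} (ha : ∀ k, AnalyticAt ℝ (a k) p)
    {u : ι → E → ℝ} (hu : ∀ k, AnalyticAt ℝ (u k) p) :
    ∃ U : ι → E → ℝ, (∀ k, AnalyticAt ℝ (U k) p) ∧
      (∀ᶠ x in nhds p, ∀ k, fderiv ℝ (U k) x (φ.symm (Pi.single i 1))
        = ∑ l, MvPolynomial.eval (Sum.elim (fun k => a k x) fun k => U k x) (P k l) *
            fderiv ℝ (U l) x (φ.symm (Pi.single j 1))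
          + MvPolynomial.eval (Sum.elim (fun k => a k x) fun k => U k x) (Q k)) ∧
      ∀ᶠ x in nhds p, φ (x - p) i = 0 → ∀ k, U k x = u k x := by
  obtain ⟨U, hU, heq, h0⟩ := exists_analytic_cauchy_pi hij P Q
    (fun k => analyticAt_comp_chart_symm φ (ha k)) (fun k => analyticAt_comp_chart_symm φ (hu k))
  have hcancel : ∀ x, p + φ.symm (φ (x - p)) = x := fun x => by simp
  refine ⟨fun k x => U k (φ (x - p)), fun k => analyticAt_comp_chart φ (by simpa using hU k), ?_, ?_⟩
  · have hA : ∀ᶠ x in nhds (0 : σ → ℝ), ∀ k, AnalyticAt ℝ (U k) x :=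
      Filter.eventually_all.2 fun k => (hU k).eventually_analyticAt
    filter_upwards [(tendsto_chart φ p).eventually heq, (tendsto_chart φ p).eventually hA]
      with x hx hxA k
    have hd : ∀ l v, fderiv ℝ (fun x => U l (φ (x - p))) x (φ.symm v)
        = fderiv ℝ (U l) (φ (x - p)) v := by
      intro l v
      rw [fderiv_comp_chart φ (hxA l).differentiableAt, φ.apply_symm_apply]
    simp only [hd]
    have := hx k
    simp only [hcancel] at this
    exact this
  · filter_upwards [(tendsto_chart φ p).eventually h0] with x hx hxi k
    have := hx hxi k
    simp only [hcancel] at this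
    exact this

/-- Uniqueness of the zero solution of a linear homogeneous analytic Cauchy problem, in linear
coordinates `φ` centred at `p`. -/
theorem eventually_eq_zero_of_linear_cauchy (φ : E ≃L[ℝ] (σ → ℝ)) (p : E) {i j : σ} (hij : i ≠ j)
    {b c : ι → ι → E → ℝ} (hb : ∀ k l, AnalyticAt ℝ (b k l) p)
    (hc : ∀ k l, AnalyticAt ℝ (c k l) p)
    {W : ι → E → ℝ} (hW : ∀ k, AnalyticAt ℝ (W k) p)
    (heq : ∀ᶠ x in nhds p, ∀ k, fderiv ℝ (W k) x (φ.symm (Pi.single i 1))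
      = ∑ l, (b k l x * fderiv ℝ (W l) x (φ.symm (Pi.single j 1)) + c k l x * W l x))
    (h0 : ∀ᶠ x in nhds p, φ (x - p) i = 0 → ∀ k, W k x = 0) :
    ∀ᶠ x in nhds p, ∀ k, W k x = 0 := by
  have hA : ∀ᶠ x in nhds p, ∀ k, AnalyticAt ℝ (W k) x :=
    Filter.eventually_all.2 fun k => (hW k).eventually_analyticAt
  have key := eventually_eq_zero_of_linear_cauchy_pi hij
    (fun k l => analyticAt_comp_chart_symm φ (hb k l))
    (fun k l => analyticAt_comp_chart_symm φ (hc k l))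
    (W := fun k x => W k (p + φ.symm x))
    (fun k => analyticAt_comp_chart_symm φ (hW k)) ?_ ?_
  · filter_upwards [(tendsto_chart φ p).eventually key] with x hx k
    have := hx k
    simpa using this
  · filter_upwards [(tendsto_chart_symm φ p).eventually heq,
      (tendsto_chart_symm φ p).eventually hA] with x hx hxA k
    simp only [fun l v => fderiv_comp_chart_symm φ (hxA l).differentiableAt v]
    exact hx k
  · filter_upwards [(tendsto_chart_symm φ p).eventually h0] with x hx hxi k
    exact hx (by simpa using hxi) k

omit [Fintype σ] in
/-- Functions agreeing on the hyperplane `xᵢ = pᵢ` have the same tangential derivatives there. -/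
lemma eventually_fderiv_eq_of_eq_on_hyperplane (φ : E ≃L[ℝ] (σ → ℝ)) (p : E) {i j : σ}
    (hij : i ≠ j) {U u : E → ℝ} (hU : AnalyticAt ℝ U p) (hu : AnalyticAt ℝ u p)
    (h : ∀ᶠ x in nhds p, φ (x - p) i = 0 → U x = u x) :
    ∀ᶠ x in nhds p, φ (x - p) i = 0 →
      fderiv ℝ U x (φ.symm (Pi.single j 1)) = fderiv ℝ u x (φ.symm (Pi.single j 1)) := by
  filter_upwards [h.eventually_nhds, hU.eventually_analyticAt, hu.eventually_analyticAt]
    with x hx hxU hxu hxi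
  set v := φ.symm (Pi.single j (1 : ℝ)) with hv
  -- The line through `x` in the j-th direction stays in the hyperplane since `i ≠ j`; both
  -- functions agree along it.
  have hline : HasDerivAt (fun t : ℝ => x + t • v) v 0 := by
    simpa using! ((hasDerivAt_id (0 : ℝ)).smul_const v).const_add x
  have hUd : HasFDerivAt U (fderiv ℝ U x) (x + (0 : ℝ) • v) := by
    simpa using hxU.differentiableAt.hasFDerivAt
  have hud : HasFDerivAt u (fderiv ℝ u x) (x + (0 : ℝ) • v) := by
    simpa using hxu.differentiableAt.hasFDerivAt
  have h1 := hUd.comp_hasDerivAt (0 : ℝ) hline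
  have h2 := hud.comp_hasDerivAt (0 : ℝ) hline
  refine h1.unique (h2.congr_of_eventuallyEq ?_)
  have ht : Filter.Tendsto (fun t : ℝ => x + t • v) (nhds 0) (nhds x) := by
    simpa using hline.continuousAt.tendsto
  filter_upwards [ht.eventually hx] with t ht
  refine ht ?_
  have : φ (x + t • v - p) = φ (x - p) + t • Pi.single j (1 : ℝ) := by
    rw [add_sub_right_comm, map_add, map_smul, hv, φ.apply_symm_apply]
  rw [this]
  rw [Pi.add_apply, hxi]
  simp [hij]

end Transfer

/-! ### Differential calculus of dot and cross products -/

section VectorCalculus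

variable {E : Type*} [NormedAddCommGroup E] [NormedSpace ℝ E]

lemma fderiv_apply_coord {f : E → Fin 3 → ℝ} {x : E} (hf : DifferentiableAt ℝ f x) (v : E)
    (k : Fin 3) : fderiv ℝ (fun x => f x k) x v = fderiv ℝ f x v k := by
  have h : HasFDerivAt (fun x => f x k) _ x := hasFDerivAt_pi'.1 hf.hasFDerivAt k
  rw [h.fderiv]
  rfl

lemma fderiv_mul_apply {f g : E → ℝ} {x : E} (hf : DifferentiableAt ℝ f x)
    (hg : DifferentiableAt ℝ g x) (v : E) :
    fderiv ℝ (fun x => f x * g x) x v = fderiv ℝ f x v * g x + f x * fderiv ℝ g x v := by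
  rw [fderiv_fun_mul hf hg]
  simp
  ring

lemma fderiv_sub_apply {F : Type*} [NormedAddCommGroup F] [NormedSpace ℝ F] {f g : E → F} {x : E}
    (hf : DifferentiableAt ℝ f x) (hg : DifferentiableAt ℝ g x) (v : E) :
    fderiv ℝ (fun x => f x - g x) x v = fderiv ℝ f x v - fderiv ℝ g x v := by
  rw [fderiv_fun_sub hf hg]
  rfl

lemma fderiv_add_apply {F : Type*} [NormedAddCommGroup F] [NormedSpace ℝ F] {f g : E → F} {x : E}
    (hf : DifferentiableAt ℝ f x) (hg : DifferentiableAt ℝ g x) (v : E) :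
    fderiv ℝ (fun x => f x + g x) x v = fderiv ℝ f x v + fderiv ℝ g x v := by
  rw [fderiv_fun_add hf hg]
  rfl

lemma differentiableAt_coord {f : E → Fin 3 → ℝ} {x : E} (hf : DifferentiableAt ℝ f x)
    (k : Fin 3) : DifferentiableAt ℝ (fun x => f x k) x := differentiableAt_pi.1 hf k

lemma fderiv_dotProduct_apply {f g : E → Fin 3 → ℝ} {x : E} (hf : DifferentiableAt ℝ f x)
    (hg : DifferentiableAt ℝ g x) (v : E) :
    fderiv ℝ (fun x => f x ⬝ᵥ g x) x v = fderiv ℝ f x v ⬝ᵥ g x + f x ⬝ᵥ fderiv ℝ g x v := by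
  have hf' := differentiableAt_coord hf
  have hg' := differentiableAt_coord hg
  simp only [vec3_dotProduct]
  rw [fderiv_add_apply (((hf' 0).fun_mul (hg' 0)).fun_add ((hf' 1).fun_mul (hg' 1))) ((hf' 2).fun_mul (hg' 2)),
    fderiv_add_apply ((hf' 0).fun_mul (hg' 0)) ((hf' 1).fun_mul (hg' 1)),
    fderiv_mul_apply (hf' 0) (hg' 0), fderiv_mul_apply (hf' 1) (hg' 1),
    fderiv_mul_apply (hf' 2) (hg' 2)]
  simp only [fderiv_apply_coord hf, fderiv_apply_coord hg]
  ring

lemma differentiableAt_dotProduct {f g : E → Fin 3 → ℝ} {x : E} (hf : DifferentiableAt ℝ f x)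
    (hg : DifferentiableAt ℝ g x) : DifferentiableAt ℝ (fun x => f x ⬝ᵥ g x) x := by
  have hf' := differentiableAt_coord hf
  have hg' := differentiableAt_coord hg
  simp only [vec3_dotProduct]
  exact (((hf' 0).fun_mul (hg' 0)).fun_add ((hf' 1).fun_mul (hg' 1))).fun_add ((hf' 2).fun_mul (hg' 2))

lemma analyticAt_coord {f : E → Fin 3 → ℝ} {x : E} (hf : AnalyticAt ℝ f x) (k : Fin 3) :
    AnalyticAt ℝ (fun x => f x k) x :=
  ((ContinuousLinearMap.proj k : (Fin 3 → ℝ) →L[ℝ] ℝ).analyticAt _).fun_comp hf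

lemma analyticAt_dotProduct {f g : E → Fin 3 → ℝ} {x : E} (hf : AnalyticAt ℝ f x)
    (hg : AnalyticAt ℝ g x) : AnalyticAt ℝ (fun x => f x ⬝ᵥ g x) x := by
  have hf' := analyticAt_coord hf
  have hg' := analyticAt_coord hg
  simp only [vec3_dotProduct]
  exact (((hf' 0).fun_mul (hg' 0)).fun_add ((hf' 1).fun_mul (hg' 1))).fun_add ((hf' 2).fun_mul (hg' 2))

lemma analyticAt_crossProduct {f g : E → Fin 3 → ℝ} {x : E} (hf : AnalyticAt ℝ f x)
    (hg : AnalyticAt ℝ g x) : AnalyticAt ℝ (fun x => crossProduct (f x) (g x)) x := by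
  have hf' := analyticAt_coord hf
  have hg' := analyticAt_coord hg
  refine analyticAt_pi_iff.2 fun k => ?_
  simp only [cross_apply]
  fin_cases k
  · exact ((hf' 1).fun_mul (hg' 2)).fun_sub ((hf' 2).fun_mul (hg' 1))
  · exact ((hf' 2).fun_mul (hg' 0)).fun_sub ((hf' 0).fun_mul (hg' 2))
  · exact ((hf' 0).fun_mul (hg' 1)).fun_sub ((hf' 1).fun_mul (hg' 0))

lemma differentiableAt_crossProduct {f g : E → Fin 3 → ℝ} {x : E} (hf : DifferentiableAt ℝ f x)
    (hg : DifferentiableAt ℝ g x) :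
    DifferentiableAt ℝ (fun x => crossProduct (f x) (g x)) x := by
  have hf' := differentiableAt_coord hf
  have hg' := differentiableAt_coord hg
  refine differentiableAt_pi.2 fun k => ?_
  simp only [cross_apply]
  fin_cases k
  · exact ((hf' 1).fun_mul (hg' 2)).fun_sub ((hf' 2).fun_mul (hg' 1))
  · exact ((hf' 2).fun_mul (hg' 0)).fun_sub ((hf' 0).fun_mul (hg' 2))
  · exact ((hf' 0).fun_mul (hg' 1)).fun_sub ((hf' 1).fun_mul (hg' 0))

lemma fderiv_crossProduct_apply {f g : E → Fin 3 → ℝ} {x : E} (hf : DifferentiableAt ℝ f x)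
    (hg : DifferentiableAt ℝ g x) (v : E) :
    fderiv ℝ (fun x => crossProduct (f x) (g x)) x v
      = crossProduct (fderiv ℝ f x v) (g x) + crossProduct (f x) (fderiv ℝ g x v) := by
  have hf' := differentiableAt_coord hf
  have hg' := differentiableAt_coord hg
  ext k
  rw [← fderiv_apply_coord (differentiableAt_crossProduct hf hg)]
  have key : ∀ a b : Fin 3, fderiv ℝ (fun x => f x a * g x b - f x b * g x a) x v
      = (fderiv ℝ f x v a * g x b - fderiv ℝ f x v b * g x a)
        + (f x a * fderiv ℝ g x v b - f x b * fderiv ℝ g x v a) := by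
    intro a b
    rw [fderiv_sub_apply ((hf' a).fun_mul (hg' b)) ((hf' b).fun_mul (hg' a)),
      fderiv_mul_apply (hf' a) (hg' b), fderiv_mul_apply (hf' b) (hg' a)]
    simp only [fderiv_apply_coord hf, fderiv_apply_coord hg]
    ring
  simp only [cross_apply]
  fin_cases k
  · exact key 1 2
  · exact key 2 0
  · exact key 0 1

lemma fderiv_fderiv_comm {F : Type*} [NormedAddCommGroup F] [NormedSpace ℝ F] [CompleteSpace F]
    {f : E → F} {x : E} (hf : AnalyticAt ℝ f x) (v w : E) :
    fderiv ℝ (fun x => fderiv ℝ f x w) x v = fderiv ℝ (fun x => fderiv ℝ f x v) x w := by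
  have hd : DifferentiableAt ℝ (fderiv ℝ f) x := hf.fderiv.differentiableAt
  have hs : IsSymmSndFDerivAt ℝ f x := hf.contDiffAt.isSymmSndFDerivAt (n := 2) (by simp)
  have h : ∀ u : E, HasFDerivAt (fun x => fderiv ℝ f x u) ((fderiv ℝ (fderiv ℝ f) x).flip u) x :=
    fun u => by simpa using! hd.hasFDerivAt.clm_apply (hasFDerivAt_const u x)
  rw [(h v).fderiv, (h w).fderiv]
  exact hs v w

lemma analyticAt_fderiv_apply {F : Type*} [NormedAddCommGroup F] [NormedSpace ℝ F]
    [CompleteSpace F] {f : E → F} {x : E} (hf : AnalyticAt ℝ f x) (v : E) :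
    AnalyticAt ℝ (fun x => fderiv ℝ f x v) x :=
  ((ContinuousLinearMap.apply ℝ F v).analyticAt _).fun_comp hf.fderiv

end VectorCalculus

/-! ### Frames (z, w, z × w) and the defects of the second fundamental form -/

namespace SurfaceFrame

/-- The (non-normalised) normal of the frame `(z, w)`. -/
def nor (z w : Fin 3 → ℝ) : Fin 3 → ℝ := crossProduct z w

/-- The squared area of the frame `(z, w)`. -/
def area2 (z w : Fin 3 → ℝ) : ℝ := nor z w ⬝ᵥ nor z w

/-- The coefficient of `z` in the expansion of `v` in the frame `(z, w, z × w)`. -/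
def coef₁ (z w v : Fin 3 → ℝ) : ℝ := (v ⬝ᵥ crossProduct w (nor z w)) / area2 z w

/-- The coefficient of `w` in the expansion of `v` in the frame `(z, w, z × w)`. -/
def coef₂ (z w v : Fin 3 → ℝ) : ℝ := (v ⬝ᵥ crossProduct (nor z w) z) / area2 z w

/-- The coefficient of `z × w` in the expansion of `v` in the frame `(z, w, z × w)`. -/
def coef₃ (z w v : Fin 3 → ℝ) : ℝ := (nor z w ⬝ᵥ v) / area2 z w

lemma nor_apply (z w : Fin 3 → ℝ) :
    nor z w = ![z 1 * w 2 - z 2 * w 1, z 2 * w 0 - z 0 * w 2, z 0 * w 1 - z 1 * w 0] :=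
  cross_apply z w

/-- Cramer's rule for the basis (z, w, z × w), whose determinant is the squared area. -/
lemma eq_expansion {z w : Fin 3 → ℝ} (h : area2 z w ≠ 0) (v : Fin 3 → ℝ) :
    v = coef₁ z w v • z + coef₂ z w v • w + coef₃ z w v • nor z w := by
  have key : ∀ k, area2 z w * v k = (v ⬝ᵥ crossProduct w (nor z w)) * z k
      + (v ⬝ᵥ crossProduct (nor z w) z) * w k + (nor z w ⬝ᵥ v) * nor z w k := by
    intro k
    simp only [area2, nor_apply, cross_apply, vec3_dotProduct]
    fin_cases k <;> simp <;> ring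
  ext k
  simp only [coef₁, coef₂, coef₃, Pi.add_apply, Pi.smul_apply, smul_eq_mul]
  field_simp
  linarith [key k]

section Algebra

variable {z w : Fin 3 → ℝ}

lemma nor_dot_expansion (a b c : ℝ) :
    nor z w ⬝ᵥ (a • z + b • w + c • nor z w) = c * area2 z w := by
  simp only [area2, nor_apply, vec3_dotProduct, Pi.add_apply, Pi.smul_apply, smul_eq_mul,
    Matrix.cons_val]
  ring

/-- Supplies the pairings of a derivative of the normal with a second derivative of the surface,
both written in the frame. -/
lemma dnor_dot_expansion (a b c a' b' c' a'' b'' c'' : ℝ) :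
    (crossProduct (a • z + b • w + c • nor z w) w
      + crossProduct z (a' • z + b' • w + c' • nor z w)) ⬝ᵥ (a'' • z + b'' • w + c'' • nor z w)
      = area2 z w * ((a + b') * c'' - c * a'' - c' * b'') := by
  simp only [area2, nor_apply, cross_apply, vec3_dotProduct, Pi.add_apply, Pi.smul_apply,
    smul_eq_mul, Matrix.cons_val]
  ring

lemma nor_dot_dnor (a b c a' b' c' : ℝ) :
    nor z w ⬝ᵥ (crossProduct (a • z + b • w + c • nor z w) w
      + crossProduct z (a' • z + b' • w + c' • nor z w)) = area2 z w * (a + b') := by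
  simp only [area2, nor_apply, cross_apply, vec3_dotProduct, Pi.add_apply, Pi.smul_apply,
    smul_eq_mul, Matrix.cons_val]
  ring

end Algebra

variable {E : Type*} [NormedAddCommGroup E] [NormedSpace ℝ E] {z w : E → Fin 3 → ℝ}
  {L M N : E → ℝ} {x : E}

lemma differentiableAt_nor (hz : DifferentiableAt ℝ z x) (hw : DifferentiableAt ℝ w x) :
    DifferentiableAt ℝ (fun y => nor (z y) (w y)) x := differentiableAt_crossProduct hz hw

lemma fderiv_nor_apply (hz : DifferentiableAt ℝ z x) (hw : DifferentiableAt ℝ w x) (v : E) :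
    fderiv ℝ (fun y => nor (z y) (w y)) x v
      = crossProduct (fderiv ℝ z x v) (w x) + crossProduct (z x) (fderiv ℝ w x v) :=
  fderiv_crossProduct_apply hz hw v

lemma differentiableAt_area2 (hz : DifferentiableAt ℝ z x) (hw : DifferentiableAt ℝ w x) :
    DifferentiableAt ℝ (fun y => area2 (z y) (w y)) x :=
  differentiableAt_dotProduct (differentiableAt_nor hz hw) (differentiableAt_nor hz hw)

lemma fderiv_area2_apply (hz : DifferentiableAt ℝ z x) (hw : DifferentiableAt ℝ w x) (v : E) :
    fderiv ℝ (fun y => area2 (z y) (w y)) x v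
      = 2 * (nor (z x) (w x) ⬝ᵥ fderiv ℝ (fun y => nor (z y) (w y)) x v) := by
  have := differentiableAt_nor hz hw
  unfold area2
  rw [fderiv_dotProduct_apply this this, dotProduct_comm]
  ring

/-- Derivative of `x ↦ (z × w) · u`. -/
lemma fderiv_nor_dot {u : E → Fin 3 → ℝ} (hz : DifferentiableAt ℝ z x)
    (hw : DifferentiableAt ℝ w x) (hu : DifferentiableAt ℝ u x) (v : E) :
    fderiv ℝ (fun y => nor (z y) (w y) ⬝ᵥ u y) x v
      = fderiv ℝ (fun y => nor (z y) (w y)) x v ⬝ᵥ u x + nor (z x) (w x) ⬝ᵥ fderiv ℝ u x v :=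
  fderiv_dotProduct_apply (differentiableAt_nor hz hw) hu v

/-- The defect in `(z × w) · u = |z × w|² K`. -/
def defect (z w u : E → Fin 3 → ℝ) (K : E → ℝ) (y : E) : ℝ :=
  nor (z y) (w y) ⬝ᵥ u y - area2 (z y) (w y) * K y

lemma fderiv_defect {u : E → Fin 3 → ℝ} {K : E → ℝ} (hz : DifferentiableAt ℝ z x)
    (hw : DifferentiableAt ℝ w x) (hu : DifferentiableAt ℝ u x) (hK : DifferentiableAt ℝ K x)
    (v : E) :
    fderiv ℝ (defect z w u K) x v
      = fderiv ℝ (fun y => nor (z y) (w y)) x v ⬝ᵥ u x + nor (z x) (w x) ⬝ᵥ fderiv ℝ u x v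
        - (2 * (nor (z x) (w x) ⬝ᵥ fderiv ℝ (fun y => nor (z y) (w y)) x v) * K x
          + area2 (z x) (w x) * fderiv ℝ K x v) := by
  have h : defect z w u K = fun y => nor (z y) (w y) ⬝ᵥ u y - area2 (z y) (w y) * K y := rfl
  rw [h, fderiv_sub_apply (differentiableAt_dotProduct (differentiableAt_nor hz hw) hu)
    ((differentiableAt_area2 hz hw).fun_mul hK), fderiv_nor_dot hz hw hu,
    fderiv_mul_apply (differentiableAt_area2 hz hw) hK, fderiv_area2_apply hz hw]

/-- Evolution of the defects of a frame with `∂ₑ w = ∂_f z` and `(z × w) · ∂ₑ z = |z × w|² L`. -/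
lemma fderiv_defects {e f : E} (hz : AnalyticAt ℝ z x) (hw : AnalyticAt ℝ w x)
    (hL : DifferentiableAt ℝ L x) (hM : DifferentiableAt ℝ M x) (hN : DifferentiableAt ℝ N x)
    (hzw : ∀ᶠ y in nhds x, fderiv ℝ w y e = fderiv ℝ z y f)
    (hdL : ∀ᶠ y in nhds x, defect z w (fun y => fderiv ℝ z y e) L y = 0)
    (hD : area2 (z x) (w x) ≠ 0) :
    let R := defect z w (fun y => fderiv ℝ z y f) M
    let P := defect z w (fun y => fderiv ℝ w y f) N
    let A := coef₁ (z x) (w x) (fderiv ℝ z x e)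
    let B := coef₂ (z x) (w x) (fderiv ℝ z x e)
    let α₁₂ := coef₁ (z x) (w x) (fderiv ℝ z x f)
    let β₁₂ := coef₂ (z x) (w x) (fderiv ℝ z x f)
    let α₂₂ := coef₁ (z x) (w x) (fderiv ℝ w x f)
    let β₂₂ := coef₂ (z x) (w x) (fderiv ℝ w x f)
    fderiv ℝ R x e = 2 * A * R x + B * P x + area2 (z x) (w x) *
        (N x * B + β₂₂ * L x - 2 * β₁₂ * M x - (fderiv ℝ M x e - fderiv ℝ L x f)) ∧
    fderiv ℝ P x e = fderiv ℝ R x f + (A + 2 * β₁₂) * P x - 2 * β₂₂ * R x + area2 (z x) (w x) *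
        (-(N x * A) + 2 * α₁₂ * M x - α₂₂ * L x + (fderiv ℝ M x f - fderiv ℝ N x e)) := by
  intro R P A B α₁₂ β₁₂ α₂₂ β₂₂
  have hz' := hz.differentiableAt
  have hw' := hw.differentiableAt
  have hze := (analyticAt_fderiv_apply hz e).differentiableAt
  have hzf := (analyticAt_fderiv_apply hz f).differentiableAt
  have hwf := (analyticAt_fderiv_apply hw f).differentiableAt
  have hwe : fderiv ℝ w x e = fderiv ℝ z x f := hzw.self_of_nhds
  have hR : ∀ v, fderiv ℝ R x v = _ := fderiv_defect hz' hw' hzf hM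
  have hP : ∀ v, fderiv ℝ P x v = _ := fderiv_defect hz' hw' hwf hN
  -- The `e`-derivative of `R` contains ∂ₑ∂_f z = ∂_f∂ₑ z. Differentiating the vanishing L defect
  -- along `f` eliminates this term.
  have hLf : fderiv ℝ (defect z w (fun y => fderiv ℝ z y e) L) x f = 0 := by
    have : defect z w (fun y => fderiv ℝ z y e) L =ᶠ[nhds x] fun _ => 0 := hdL
    rw [this.fderiv_eq]
    simp
  rw [fderiv_defect hz' hw' hze hL] at hLf
  -- The same second derivative ∂_f∂_f z occurs in ∂ₑP and in ∂_f R, which is why the latter appears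
  -- in the formula for the former.
  have hwef : fderiv ℝ (fun y => fderiv ℝ w y f) x e = fderiv ℝ (fun y => fderiv ℝ z y f) x f := by
    rw [fderiv_fderiv_comm hw e f]
    have : (fun y => fderiv ℝ w y e) =ᶠ[nhds x] fun y => fderiv ℝ z y f := hzw
    rw [this.fderiv_eq]
  have hL0 : defect z w (fun y => fderiv ℝ z y e) L x = 0 := hdL.self_of_nhds
  have hRx : R x = nor (z x) (w x) ⬝ᵥ fderiv ℝ z x f - area2 (z x) (w x) * M x := rfl
  have hPx : P x = nor (z x) (w x) ⬝ᵥ fderiv ℝ w x f - area2 (z x) (w x) * N x := rfl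
  have hL0' : nor (z x) (w x) ⬝ᵥ fderiv ℝ z x e - area2 (z x) (w x) * L x = 0 := hL0
  rw [hR e, hP e, hR f, hwef, fderiv_fderiv_comm hz e f]
  have e1 := eq_expansion hD (fderiv ℝ z x e)
  have e2 := eq_expansion hD (fderiv ℝ z x f)
  have e3 := eq_expansion hD (fderiv ℝ w x f)
  set γ₁₁ := coef₃ (z x) (w x) (fderiv ℝ z x e)
  set γ₁₂ := coef₃ (z x) (w x) (fderiv ℝ z x f)
  set γ₂₂ := coef₃ (z x) (w x) (fderiv ℝ w x f)
  have d1 : nor (z x) (w x) ⬝ᵥ fderiv ℝ z x e = γ₁₁ * area2 (z x) (w x) := by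
    rw [e1]; exact nor_dot_expansion _ _ _
  have d2 : nor (z x) (w x) ⬝ᵥ fderiv ℝ z x f = γ₁₂ * area2 (z x) (w x) := by
    rw [e2]; exact nor_dot_expansion _ _ _
  have d3 : nor (z x) (w x) ⬝ᵥ fderiv ℝ w x f = γ₂₂ * area2 (z x) (w x) := by
    rw [e3]; exact nor_dot_expansion _ _ _
  have s1 : fderiv ℝ (fun y => nor (z y) (w y)) x e ⬝ᵥ fderiv ℝ z x f
      = area2 (z x) (w x) * ((A + β₁₂) * γ₁₂ - γ₁₁ * α₁₂ - γ₁₂ * β₁₂) := by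
    rw [fderiv_nor_apply hz' hw', hwe, e1, e2]; exact dnor_dot_expansion _ _ _ _ _ _ _ _ _
  have s2 : fderiv ℝ (fun y => nor (z y) (w y)) x e ⬝ᵥ fderiv ℝ w x f
      = area2 (z x) (w x) * ((A + β₁₂) * γ₂₂ - γ₁₁ * α₂₂ - γ₁₂ * β₂₂) := by
    rw [fderiv_nor_apply hz' hw', hwe, e1, e2, e3]; exact dnor_dot_expansion _ _ _ _ _ _ _ _ _
  have s3 : fderiv ℝ (fun y => nor (z y) (w y)) x f ⬝ᵥ fderiv ℝ z x e
      = area2 (z x) (w x) * ((α₁₂ + β₂₂) * γ₁₁ - γ₁₂ * A - γ₂₂ * B) := by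
    rw [fderiv_nor_apply hz' hw', e1, e2, e3]; exact dnor_dot_expansion _ _ _ _ _ _ _ _ _
  have s4 : fderiv ℝ (fun y => nor (z y) (w y)) x f ⬝ᵥ fderiv ℝ z x f
      = area2 (z x) (w x) * ((α₁₂ + β₂₂) * γ₁₂ - γ₁₂ * α₁₂ - γ₂₂ * β₁₂) := by
    rw [fderiv_nor_apply hz' hw', e2, e3]; exact dnor_dot_expansion _ _ _ _ _ _ _ _ _
  have s5 : nor (z x) (w x) ⬝ᵥ fderiv ℝ (fun y => nor (z y) (w y)) x e
      = area2 (z x) (w x) * (A + β₁₂) := by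
    rw [fderiv_nor_apply hz' hw', hwe, e1, e2]; exact nor_dot_dnor _ _ _ _ _ _
  have s6 : nor (z x) (w x) ⬝ᵥ fderiv ℝ (fun y => nor (z y) (w y)) x f
      = area2 (z x) (w x) * (α₁₂ + β₂₂) := by
    rw [fderiv_nor_apply hz' hw', e2, e3]; exact nor_dot_dnor _ _ _ _ _ _
  rw [s3, s6] at hLf
  rw [hRx, hPx, s1, s2, s4, s5, s6, d2, d3]
  have hγ : γ₁₁ = L x := by
    rw [d1, mul_comm, ← mul_sub] at hL0'
    linarith [(mul_eq_zero.1 hL0').resolve_left hD]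
  rw [hγ] at hLf ⊢
  constructor
  · linear_combination hLf
  · ring

end SurfaceFrame

/-! ### The frame system in Cauchy–Kovalevskaya form -/

namespace SurfaceFrame

/-- Labels of the unknowns of the frame system: position, two frame vectors, inverse area. -/
abbrev Unknown : Type := Fin 3 ⊕ Fin 3 ⊕ Fin 3 ⊕ Unit

/-- Polynomials in the coefficients and unknowns of the frame system. -/
abbrev Pol : Type := MvPolynomial (Fin 5 ⊕ Unknown) ℝ

namespace Pol

open MvPolynomial

/-- The `k`-th coefficient; these stand for `L`, `M`, `1 / N`, `∂_f M - ∂ₑ N`, `∂ₑ M - ∂_f L`. -/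
def par (k : Fin 5) : Pol := X (Sum.inl k)

/-- The first frame vector. -/
def z (k : Fin 3) : Pol := X (Sum.inr (Sum.inr (Sum.inl k)))

/-- The second frame vector. -/
def w (k : Fin 3) : Pol := X (Sum.inr (Sum.inr (Sum.inr (Sum.inl k))))

/-- The inverse squared area. -/
def q : Pol := X (Sum.inr (Sum.inr (Sum.inr (Sum.inr ()))))

/-- The normal. -/
def m : Fin 3 → Pol := crossProduct z w

/-- The covector computing the first frame coefficient, up to the factor `q`. -/
def zDual : Fin 3 → Pol := crossProduct w m

/-- The covector computing the second frame coefficient, up to the factor `q`. -/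
def wDual : Fin 3 → Pol := crossProduct m z

/-- The coefficients of the derivatives in the frame system. -/
def principal : Unknown → Unknown → Pol
  | Sum.inr (Sum.inl k), Sum.inr (Sum.inl l) =>
    2 * par 2 * par 1 * q * (zDual l * z k + wDual l * w k)
  | Sum.inr (Sum.inl k), Sum.inr (Sum.inr (Sum.inl l)) =>
    -(par 2 * par 0 * q * (zDual l * z k + wDual l * w k))
  | Sum.inr (Sum.inr (Sum.inl k)), Sum.inr (Sum.inl l) => if k = l then 1 else 0
  | Sum.inr (Sum.inr (Sum.inr ())), Sum.inr (Sum.inl l) =>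
    -(2 * q * (2 * par 2 * par 1 * q * zDual l + q * wDual l))
  | Sum.inr (Sum.inr (Sum.inr ())), Sum.inr (Sum.inr (Sum.inl l)) =>
    2 * q * (par 2 * par 0 * q * zDual l)
  | _, _ => 0

/-- The terms of order zero of the frame system. -/
def lower : Unknown → Pol
  | Sum.inl k => z k
  | Sum.inr (Sum.inl k) => par 2 * (par 3 * z k + par 4 * w k) + par 0 * m k
  | Sum.inr (Sum.inr (Sum.inl _)) => 0
  | Sum.inr (Sum.inr (Sum.inr ())) => -(2 * q * par 2 * par 3)

end Pol

section FrameSystem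

variable (a : Fin 5 → ℝ) (z w : Fin 3 → ℝ) (q : ℝ) (zf wf : Fin 3 → ℝ)

/-- First frame coefficient of `∂ₑ z` imposed by the Codazzi equations. -/
def codazziCoef₁ : ℝ :=
  a 2 * (a 3 - a 0 * (q * (wf ⬝ᵥ crossProduct w (nor z w)))
    + 2 * a 1 * (q * (zf ⬝ᵥ crossProduct w (nor z w))))

/-- Second frame coefficient of `∂ₑ z` imposed by the Codazzi equations. -/
def codazziCoef₂ : ℝ :=
  a 2 * (a 4 - a 0 * (q * (wf ⬝ᵥ crossProduct (nor z w) z))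
    + 2 * a 1 * (q * (zf ⬝ᵥ crossProduct (nor z w) z)))

variable {a z w q zf wf} {U : Unknown → ℝ} {V : Unknown → ℝ}

/-- This and the next three lemmas decode the polynomial system into vector equations. Treating `q`
as an unknown replaces division by the squared area, which keeps the system polynomial. -/
lemma eval_frame_y (hz : ∀ k, U (Sum.inr (Sum.inl k)) = z k) (k : Fin 3) :
    ∑ l, MvPolynomial.eval (Sum.elim a U) (Pol.principal (Sum.inl k) l) * V l
      + MvPolynomial.eval (Sum.elim a U) (Pol.lower (Sum.inl k)) = z k := by
  simp [Pol.principal, Pol.lower, Pol.z, hz]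

lemma eval_frame_w (hzf : ∀ k, V (Sum.inr (Sum.inl k)) = zf k) (k : Fin 3) :
    ∑ l, MvPolynomial.eval (Sum.elim a U)
        (Pol.principal (Sum.inr (Sum.inr (Sum.inl k))) l) * V l
      + MvPolynomial.eval (Sum.elim a U) (Pol.lower (Sum.inr (Sum.inr (Sum.inl k)))) = zf k := by
  simp only [Fintype.sum_sum_type, Fin.sum_univ_three, Pol.principal, Pol.lower, hzf]
  fin_cases k <;> simp

lemma eval_frame_z (hz : ∀ k, U (Sum.inr (Sum.inl k)) = z k)
    (hw : ∀ k, U (Sum.inr (Sum.inr (Sum.inl k))) = w k)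
    (hq : U (Sum.inr (Sum.inr (Sum.inr ()))) = q)
    (hzf : ∀ k, V (Sum.inr (Sum.inl k)) = zf k)
    (hwf : ∀ k, V (Sum.inr (Sum.inr (Sum.inl k))) = wf k) (k : Fin 3) :
    ∑ l, MvPolynomial.eval (Sum.elim a U) (Pol.principal (Sum.inr (Sum.inl k)) l) * V l
      + MvPolynomial.eval (Sum.elim a U) (Pol.lower (Sum.inr (Sum.inl k)))
      = codazziCoef₁ a z w q zf wf * z k + codazziCoef₂ a z w q zf wf * w k
        + a 0 * nor z w k := by
  simp only [Fintype.sum_sum_type, Fin.sum_univ_three, Pol.principal, Pol.lower, hzf, hwf,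
    Pol.zDual, Pol.wDual, Pol.m, codazziCoef₁, codazziCoef₂, vec3_dotProduct, nor_apply,
    cross_apply, Matrix.cons_val, map_zero, map_add, map_mul, map_neg, map_sub, Pol.z, Pol.w,
    Pol.q, Pol.par, MvPolynomial.eval_X, Sum.elim_inl, Sum.elim_inr, hz, hw, hq, map_ofNat]
  fin_cases k <;>
  · simp [hz, hw]
    ring

lemma eval_frame_q (hz : ∀ k, U (Sum.inr (Sum.inl k)) = z k)
    (hw : ∀ k, U (Sum.inr (Sum.inr (Sum.inl k))) = w k)
    (hq : U (Sum.inr (Sum.inr (Sum.inr ()))) = q)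
    (hzf : ∀ k, V (Sum.inr (Sum.inl k)) = zf k)
    (hwf : ∀ k, V (Sum.inr (Sum.inr (Sum.inl k))) = wf k) :
    ∑ l, MvPolynomial.eval (Sum.elim a U)
        (Pol.principal (Sum.inr (Sum.inr (Sum.inr ()))) l) * V l
      + MvPolynomial.eval (Sum.elim a U) (Pol.lower (Sum.inr (Sum.inr (Sum.inr ()))))
      = -(2 * q * (codazziCoef₁ a z w q zf wf + q * (zf ⬝ᵥ crossProduct (nor z w) z))) := by
  simp only [Fintype.sum_sum_type, Fin.sum_univ_three, Pol.principal, Pol.lower, hzf, hwf,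
    Pol.zDual, Pol.wDual, Pol.m, codazziCoef₁, vec3_dotProduct, nor_apply,
    cross_apply, Matrix.cons_val, map_zero, map_add, map_mul, map_neg, map_sub, Pol.z, Pol.w,
    Pol.q, Pol.par, MvPolynomial.eval_X, Sum.elim_inl, Sum.elim_inr, hz, hw, hq, map_ofNat]
  simp
  ring

end FrameSystem

/-- Local solvability of the frame system. -/
theorem exists_frame_system {σ : Type*} [Fintype σ] [DecidableEq σ]
    {E : Type*} [NormedAddCommGroup E] [NormedSpace ℝ E] (φ : E ≃L[ℝ] (σ → ℝ)) (p : E) {i j : σ}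
    (hij : i ≠ j) {a : Fin 5 → E → ℝ} (ha : ∀ k, AnalyticAt ℝ (a k) p)
    {y₀ z₀ w₀ : E → Fin 3 → ℝ} {q₀ : E → ℝ} (hy₀ : AnalyticAt ℝ y₀ p) (hz₀ : AnalyticAt ℝ z₀ p)
    (hw₀ : AnalyticAt ℝ w₀ p) (hq₀ : AnalyticAt ℝ q₀ p) :
    let e := φ.symm (Pi.single i 1)
    let f := φ.symm (Pi.single j 1)
    ∃ (y z w : E → Fin 3 → ℝ) (q : E → ℝ), AnalyticAt ℝ y p ∧ AnalyticAt ℝ z p ∧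
      AnalyticAt ℝ w p ∧ AnalyticAt ℝ q p ∧
      (∀ᶠ x in nhds p, φ (x - p) i = 0 → y x = y₀ x ∧ z x = z₀ x ∧ w x = w₀ x ∧ q x = q₀ x) ∧
      ∀ᶠ x in nhds p, fderiv ℝ y x e = z x ∧ fderiv ℝ w x e = fderiv ℝ z x f ∧
        fderiv ℝ z x e =
          codazziCoef₁ (fun k => a k x) (z x) (w x) (q x) (fderiv ℝ z x f) (fderiv ℝ w x f) • z x +
          codazziCoef₂ (fun k => a k x) (z x) (w x) (q x) (fderiv ℝ z x f) (fderiv ℝ w x f) • w x +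
          a 0 x • nor (z x) (w x) ∧
        fderiv ℝ q x e = -(2 * q x *
          (codazziCoef₁ (fun k => a k x) (z x) (w x) (q x) (fderiv ℝ z x f) (fderiv ℝ w x f)
            + q x * (fderiv ℝ z x f ⬝ᵥ crossProduct (nor (z x) (w x)) (z x)))) := by
  intro e f
  set u : Unknown → E → ℝ := fun l x =>
    Sum.elim (y₀ x) (Sum.elim (z₀ x) (Sum.elim (w₀ x) fun _ => q₀ x)) l with hu
  have hua : ∀ l, AnalyticAt ℝ (u l) p := by
    rintro (k | k | k | k)
    · exact analyticAt_coord hy₀ k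
    · exact analyticAt_coord hz₀ k
    · exact analyticAt_coord hw₀ k
    · exact hq₀
  obtain ⟨U, hU, heq, h0⟩ := exists_analytic_cauchy φ p hij Pol.principal Pol.lower ha hua
  have hvec : ∀ g : Fin 3 → Unknown, AnalyticAt ℝ (fun x k => U (g k) x) p := fun g =>
    analyticAt_pi_iff.2 fun k => hU (g k)
  have hU' : ∀ᶠ x in nhds p, ∀ l, DifferentiableAt ℝ (U l) x :=
    Filter.eventually_all.2 fun l => (hU l).eventually_analyticAt.mono fun x h => h.differentiableAt
  refine ⟨fun x k => U (Sum.inl k) x, fun x k => U (Sum.inr (Sum.inl k)) x,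
    fun x k => U (Sum.inr (Sum.inr (Sum.inl k))) x, U (Sum.inr (Sum.inr (Sum.inr ()))),
    hvec _, hvec _, hvec _, hU _, ?_, ?_⟩
  · filter_upwards [h0] with x hx hxi
    have := hx hxi
    refine ⟨?_, ?_, ?_, ?_⟩
    · ext k; exact this (Sum.inl k)
    · ext k; exact this (Sum.inr (Sum.inl k))
    · ext k; exact this (Sum.inr (Sum.inr (Sum.inl k)))
    · exact this (Sum.inr (Sum.inr (Sum.inr ())))
  · filter_upwards [heq, hU'] with x hx hd
    have hfd : ∀ (g : Fin 3 → Unknown) (v : E) (k : Fin 3),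
        fderiv ℝ (fun x k => U (g k) x) x v k = fderiv ℝ (U (g k)) x v := fun g v k =>
      (fderiv_apply_coord (differentiableAt_pi.2 fun k => hd (g k)) v k).symm
    have hfd' := fun (g : Fin 3 → Unknown) (v : E) (k : Fin 3) => (hfd g v k).symm
    refine ⟨?_, ?_, ?_, ?_⟩
    · ext k
      rw [hfd Sum.inl, hx (Sum.inl k)]
      exact eval_frame_y (fun _ => rfl) k
    · ext k
      rw [hfd fun k => Sum.inr (Sum.inr (Sum.inl k)), hx (Sum.inr (Sum.inr (Sum.inl k)))]
      exact eval_frame_w (V := fun l => fderiv ℝ (U l) x f)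
        (hfd' (fun k => Sum.inr (Sum.inl k)) f) k
    · ext k
      rw [hfd fun k => Sum.inr (Sum.inl k), hx (Sum.inr (Sum.inl k))]
      exact eval_frame_z (V := fun l => fderiv ℝ (U l) x f) (fun _ => rfl) (fun _ => rfl) rfl
        (hfd' (fun k => Sum.inr (Sum.inl k)) f)
        (hfd' (fun k => Sum.inr (Sum.inr (Sum.inl k))) f) k
    · rw [hx (Sum.inr (Sum.inr (Sum.inr ())))]
      exact eval_frame_q (V := fun l => fderiv ℝ (U l) x f) (fun _ => rfl) (fun _ => rfl) rfl
        (hfd' (fun k => Sum.inr (Sum.inl k)) f)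
        (hfd' (fun k => Sum.inr (Sum.inr (Sum.inl k))) f)

end SurfaceFrame

/-! ### Initial strip and local existence of the surface -/

namespace SurfaceFrame

lemma coef₁_expansion {z w : Fin 3 → ℝ} (h : area2 z w ≠ 0) (a b c : ℝ) :
    coef₁ z w (a • z + b • w + c • nor z w) = a := by
  rw [coef₁, div_eq_iff h]
  simp only [area2, nor_apply, cross_apply, vec3_dotProduct, Pi.add_apply, Pi.smul_apply,
    smul_eq_mul, Matrix.cons_val]
  ring

lemma coef₂_expansion {z w : Fin 3 → ℝ} (h : area2 z w ≠ 0) (a b c : ℝ) :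
    coef₂ z w (a • z + b • w + c • nor z w) = b := by
  rw [coef₂, div_eq_iff h]
  simp only [area2, nor_apply, cross_apply, vec3_dotProduct, Pi.add_apply, Pi.smul_apply,
    smul_eq_mul, Matrix.cons_val]
  ring

lemma inv_area2_mul_eq {z w : Fin 3 → ℝ} {q : ℝ} (h : q * area2 z w = 1) (c : ℝ) :
    q * c = c / area2 z w := by
  have h0 : area2 z w ≠ 0 := right_ne_zero_of_mul (h.symm ▸ one_ne_zero)
  rw [eq_div_iff h0]
  linear_combination c * h

variable {E : Type*} [NormedAddCommGroup E] [NormedSpace ℝ E]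

section Analytic

variable {z w v : E → Fin 3 → ℝ} {x : E}

lemma analyticAt_nor (hz : AnalyticAt ℝ z x) (hw : AnalyticAt ℝ w x) :
    AnalyticAt ℝ (fun y => nor (z y) (w y)) x := analyticAt_crossProduct hz hw

lemma analyticAt_area2 (hz : AnalyticAt ℝ z x) (hw : AnalyticAt ℝ w x) :
    AnalyticAt ℝ (fun y => area2 (z y) (w y)) x :=
  analyticAt_dotProduct (analyticAt_nor hz hw) (analyticAt_nor hz hw)

lemma analyticAt_coef₁ (hz : AnalyticAt ℝ z x) (hw : AnalyticAt ℝ w x) (hv : AnalyticAt ℝ v x)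
    (h : area2 (z x) (w x) ≠ 0) : AnalyticAt ℝ (fun y => coef₁ (z y) (w y) (v y)) x :=
  (analyticAt_dotProduct hv (analyticAt_crossProduct hw (analyticAt_nor hz hw))).fun_div
    (analyticAt_area2 hz hw) h

lemma analyticAt_coef₂ (hz : AnalyticAt ℝ z x) (hw : AnalyticAt ℝ w x) (hv : AnalyticAt ℝ v x)
    (h : area2 (z x) (w x) ≠ 0) : AnalyticAt ℝ (fun y => coef₂ (z y) (w y) (v y)) x :=
  (analyticAt_dotProduct hv (analyticAt_crossProduct (analyticAt_nor hz hw) hz)).fun_div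
    (analyticAt_area2 hz hw) h

lemma analyticAt_defect {K : E → ℝ} (hz : AnalyticAt ℝ z x) (hw : AnalyticAt ℝ w x)
    (hv : AnalyticAt ℝ v x) (hK : AnalyticAt ℝ K x) : AnalyticAt ℝ (defect z w v K) x :=
  (analyticAt_dotProduct (analyticAt_nor hz hw) hv).fun_sub ((analyticAt_area2 hz hw).fun_mul hK)

end Analytic

variable {σ : Type*} [Fintype σ] [DecidableEq σ] (φ : E ≃L[ℝ] (σ → ℝ)) (p : E) {i j : σ}

omit [Fintype σ] in
lemma eventually_fderiv_eq_of_eq_on_hyperplane_vec (hij : i ≠ j) {U u : E → Fin 3 → ℝ}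
    (hU : AnalyticAt ℝ U p) (hu : AnalyticAt ℝ u p)
    (h : ∀ᶠ x in nhds p, φ (x - p) i = 0 → U x = u x) :
    ∀ᶠ x in nhds p, φ (x - p) i = 0 →
      fderiv ℝ U x (φ.symm (Pi.single j 1)) = fderiv ℝ u x (φ.symm (Pi.single j 1)) := by
  have hk : ∀ k, ∀ᶠ x in nhds p, φ (x - p) i = 0 →
      fderiv ℝ (fun x => U x k) x (φ.symm (Pi.single j 1))
        = fderiv ℝ (fun x => u x k) x (φ.symm (Pi.single j 1)) := fun k =>
    eventually_fderiv_eq_of_eq_on_hyperplane φ p hij (analyticAt_coord hU k)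
      (analyticAt_coord hu k) (h.mono fun x hx hxi => by rw [hx hxi])
  filter_upwards [Filter.eventually_all.2 hk, hU.eventually_analyticAt, hu.eventually_analyticAt]
    with x hx hxU hxu hxi
  ext k
  rw [← fderiv_apply_coord hxU.differentiableAt, ← fderiv_apply_coord hxu.differentiableAt]
  exact hx k hxi

variable {L M N : E → ℝ}

/-- Initial frame data along the hyperplane, with `ρ` the tangential coordinate. -/
def initZ (ρ M N : E → ℝ) (x : E) : Fin 3 → ℝ :=
  ![M x / N x, M x / N x * ρ x, 1 / (N x * (1 + ρ x ^ 2))]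

/-- Initial tangent along the hyperplane. -/
def initW (ρ : E → ℝ) (x : E) : Fin 3 → ℝ := ![1, ρ x, 0]

/-- Initial curve along the hyperplane. -/
def initY (ρ : E → ℝ) (x : E) : Fin 3 → ℝ := ![ρ x, ρ x ^ 2 / 2, 0]

section Init

variable {ρ : E → ℝ} {x : E}

lemma one_add_sq_ne_zero (r : ℝ) : 1 + r ^ 2 ≠ 0 := by positivity

lemma analyticAt_vec3 {a b c : E → ℝ} (ha : AnalyticAt ℝ a x) (hb : AnalyticAt ℝ b x)
    (hc : AnalyticAt ℝ c x) : AnalyticAt ℝ (fun x => ![a x, b x, c x]) x := by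
  refine analyticAt_pi_iff.2 fun k => ?_
  fin_cases k
  exacts [ha, hb, hc]

lemma fderiv_vec3_apply {a b c : E → ℝ} (ha : DifferentiableAt ℝ a x)
    (hb : DifferentiableAt ℝ b x) (hc : DifferentiableAt ℝ c x) (v : E) :
    fderiv ℝ (fun x => ![a x, b x, c x]) x v
      = ![fderiv ℝ a x v, fderiv ℝ b x v, fderiv ℝ c x v] := by
  have hd : DifferentiableAt ℝ (fun x => ![a x, b x, c x]) x := by
    refine differentiableAt_pi.2 fun k => ?_
    fin_cases k
    exacts [ha, hb, hc]
  ext k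
  rw [← fderiv_apply_coord hd]
  fin_cases k <;> rfl

lemma analyticAt_one_div_mul (hρ : AnalyticAt ℝ ρ x) (hN : AnalyticAt ℝ N x) (h : N x ≠ 0) :
    AnalyticAt ℝ (fun x => 1 / (N x * (1 + ρ x ^ 2))) x :=
  analyticAt_const.fun_div (hN.fun_mul (analyticAt_const.fun_add (hρ.fun_pow 2)))
    (mul_ne_zero h (one_add_sq_ne_zero _))

lemma analyticAt_initZ (hρ : AnalyticAt ℝ ρ x) (hM : AnalyticAt ℝ M x) (hN : AnalyticAt ℝ N x)
    (h : N x ≠ 0) : AnalyticAt ℝ (initZ ρ M N) x :=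
  analyticAt_vec3 (hM.fun_div hN h) ((hM.fun_div hN h).fun_mul hρ) (analyticAt_one_div_mul hρ hN h)

lemma analyticAt_initW (hρ : AnalyticAt ℝ ρ x) : AnalyticAt ℝ (initW ρ) x :=
  analyticAt_vec3 analyticAt_const hρ analyticAt_const

lemma analyticAt_initY (hρ : AnalyticAt ℝ ρ x) : AnalyticAt ℝ (initY ρ) x :=
  analyticAt_vec3 hρ ((hρ.fun_pow 2).fun_div analyticAt_const two_ne_zero) analyticAt_const

/-- Compatibility of the initial curve with the initial tangent: it gives ∂_f y = w on the
hyperplane. -/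
lemma fderiv_initY (hρ : DifferentiableAt ℝ ρ x) {f : E} (hf : fderiv ℝ ρ x f = 1) :
    fderiv ℝ (initY ρ) x f = initW ρ x := by
  have h2 : fderiv ℝ (fun x => ρ x ^ 2 / 2) x f = ρ x := by
    have : (fun x => ρ x ^ 2 / 2) = fun x => (fun x => ρ x * (1 / 2)) x * ρ x := by
      funext x; ring
    rw [this, fderiv_mul_apply (hρ.mul_const _) hρ, fderiv_mul_apply hρ (differentiableAt_const _)]
    simp [hf]
    ring
  have := fderiv_vec3_apply hρ (b := fun x => ρ x ^ 2 / 2)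
    (by fun_prop) (differentiableAt_const (0 : ℝ)) f
  rw [hf, h2] at this
  exact this.trans (by simp [initW])

lemma fderiv_initW (hρ : DifferentiableAt ℝ ρ x) {f : E} (hf : fderiv ℝ ρ x f = 1) :
    fderiv ℝ (initW ρ) x f = ![0, 1, 0] := by
  have := fderiv_vec3_apply (differentiableAt_const (1 : ℝ)) hρ (differentiableAt_const (0 : ℝ)) f
  rw [hf] at this
  exact this.trans (by simp)

/-- The initial normal is proportional to (-ρ, 1, 0), so `s` and `t` cancel against it and only `M /
N` survives, as the M component requires. -/
lemma fderiv_initZ (hρ : AnalyticAt ℝ ρ x) (hM : AnalyticAt ℝ M x) (hN : AnalyticAt ℝ N x)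
    (h : N x ≠ 0) {f : E} (hf : fderiv ℝ ρ x f = 1) :
    ∃ s t : ℝ, fderiv ℝ (initZ ρ M N) x f = ![s, s * ρ x + M x / N x, t] := by
  have hMN := (hM.fun_div hN h).differentiableAt
  have := fderiv_vec3_apply hMN (hMN.fun_mul hρ.differentiableAt)
    (analyticAt_one_div_mul hρ hN h).differentiableAt f
  rw [fderiv_mul_apply hMN hρ.differentiableAt, hf, mul_one] at this
  exact ⟨_, _, this⟩

omit [NormedAddCommGroup E] [NormedSpace ℝ E] in
lemma nor_init : nor (initZ ρ M N x) (initW ρ x)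
    = (1 / (N x * (1 + ρ x ^ 2))) • ![-ρ x, 1, 0] := by
  rw [nor_apply]
  ext k
  fin_cases k <;> simp [initZ, initW]

omit [NormedAddCommGroup E] [NormedSpace ℝ E] in
-- Explains the initial value chosen for the inverse squared area.
lemma area2_init (h : N x ≠ 0) :
    N x ^ 2 * (1 + ρ x ^ 2) * area2 (initZ ρ M N x) (initW ρ x) = 1 := by
  have := one_add_sq_ne_zero (ρ x)
  rw [area2, nor_init, vec3_dotProduct]
  simp
  field_simp
  ring

end Init

/-- Local existence of a surface with prescribed analytic fundamental form `(L, M, N)` relative to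
the area, when the hyperplane of initial data is not asymptotic. -/
theorem exists_surface_of_forms (hij : i ≠ j) (hL : AnalyticAt ℝ L p) (hM : AnalyticAt ℝ M p)
    (hN : AnalyticAt ℝ N p) (hN0 : N p ≠ 0) :
    let e := φ.symm (Pi.single i 1)
    let f := φ.symm (Pi.single j 1)
    ∃ y : E → Fin 3 → ℝ, AnalyticAt ℝ y p ∧ ∀ᶠ x in nhds p,
      area2 (fderiv ℝ y x e) (fderiv ℝ y x f) ≠ 0 ∧
      nor (fderiv ℝ y x e) (fderiv ℝ y x f) ⬝ᵥ fderiv ℝ (fun x => fderiv ℝ y x e) x e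
        = area2 (fderiv ℝ y x e) (fderiv ℝ y x f) * L x ∧
      nor (fderiv ℝ y x e) (fderiv ℝ y x f) ⬝ᵥ fderiv ℝ (fun x => fderiv ℝ y x e) x f
        = area2 (fderiv ℝ y x e) (fderiv ℝ y x f) * M x ∧
      nor (fderiv ℝ y x e) (fderiv ℝ y x f) ⬝ᵥ fderiv ℝ (fun x => fderiv ℝ y x f) x f
        = area2 (fderiv ℝ y x e) (fderiv ℝ y x f) * N x := by
  intro e f
  set ρ : E → ℝ := fun x => φ (x - p) j with hρdef
  have hρd : ∀ x, HasFDerivAt ρ ((ContinuousLinearMap.proj j : (σ → ℝ) →L[ℝ] ℝ).comp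
      (φ : E →L[ℝ] (σ → ℝ))) x := by
    intro x
    have h1 := ((ContinuousLinearMap.proj j : (σ → ℝ) →L[ℝ] ℝ).comp
      (φ : E →L[ℝ] (σ → ℝ))).hasFDerivAt (x := x - p)
    simpa using! h1.comp x ((hasFDerivAt_id x).sub_const p)
  have hρ : ∀ x, AnalyticAt ℝ ρ x := fun x =>
    (((ContinuousLinearMap.proj j : (σ → ℝ) →L[ℝ] ℝ).comp
      (φ : E →L[ℝ] (σ → ℝ))).analyticAt _).fun_comp (analyticAt_id.sub analyticAt_const)
  have hρf : ∀ x, fderiv ℝ ρ x f = 1 := by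
    intro x
    rw [(hρd x).fderiv]
    simp [f]
  set a : Fin 5 → E → ℝ := fun k x => ![L x, M x, 1 / N x,
    fderiv ℝ M x f - fderiv ℝ N x e, fderiv ℝ M x e - fderiv ℝ L x f] k with ha_def
  have ha : ∀ k, AnalyticAt ℝ (a k) p := by
    intro k
    fin_cases k
    · exact hL
    · exact hM
    · exact analyticAt_const.fun_div hN hN0
    · exact (analyticAt_fderiv_apply hM f).fun_sub (analyticAt_fderiv_apply hN e)
    · exact (analyticAt_fderiv_apply hM e).fun_sub (analyticAt_fderiv_apply hL f)
  obtain ⟨y, z, w, q, hy, hz, hw, hq, hinit, hsys⟩ := exists_frame_system φ p hij ha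
    (analyticAt_initY (hρ p)) (analyticAt_initZ (hρ p) hM hN hN0) (analyticAt_initW (hρ p))
    (q₀ := fun x => N x ^ 2 * (1 + ρ x ^ 2))
    ((hN.fun_pow 2).fun_mul (analyticAt_const.fun_add ((hρ p).fun_pow 2)))
  have hAn : ∀ᶠ x in nhds p, (AnalyticAt ℝ y x ∧ AnalyticAt ℝ z x ∧ AnalyticAt ℝ w x ∧
      AnalyticAt ℝ q x) ∧ (AnalyticAt ℝ L x ∧ AnalyticAt ℝ M x ∧ AnalyticAt ℝ N x) ∧ N x ≠ 0 :=
    (hy.eventually_analyticAt.and (hz.eventually_analyticAt.and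
      (hw.eventually_analyticAt.and hq.eventually_analyticAt))).and
      ((hL.eventually_analyticAt.and (hM.eventually_analyticAt.and
      hN.eventually_analyticAt)).and (hN.continuousAt.eventually_ne hN0))
  -- The frame is tangent to the surface
  have hyf : ∀ᶠ x in nhds p, fderiv ℝ y x f = w x := by
    have hW : AnalyticAt ℝ (fun x => fderiv ℝ y x f - w x) p :=
      (analyticAt_fderiv_apply hy f).fun_sub hw
    have key := eventually_eq_zero_of_linear_cauchy φ p hij (ι := Fin 3)
      (b := fun _ _ _ => 0) (c := fun _ _ _ => 0) (fun _ _ => analyticAt_const)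
      (fun _ _ => analyticAt_const) (W := fun k x => (fderiv ℝ y x f - w x) k)
      (fun k => analyticAt_coord hW k) ?_ ?_
    · filter_upwards [key] with x hx
      exact sub_eq_zero.1 (funext hx)
    -- Here ∂ₑ(∂_f y - w) = ∂_f z - ∂ₑw = 0, so the coefficients of the linear problem are zero.
    · filter_upwards [hsys.eventually_nhds, hAn] with x hx ⟨⟨hyx, hzx, hwx, hqx⟩, _⟩ k
      have hd := (analyticAt_fderiv_apply hyx f).differentiableAt
      rw [fderiv_apply_coord (f := fun x => fderiv ℝ y x f - w x)
        (hd.fun_sub hwx.differentiableAt), fderiv_sub_apply hd hwx.differentiableAt,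
        fderiv_fderiv_comm hyx]
      have h1 : (fun x => fderiv ℝ y x e) =ᶠ[nhds x] z := hx.mono fun x h => h.1
      have h2 := hx.self_of_nhds.2.1
      rw [h1.fderiv_eq, h2]
      simp [f]
    · filter_upwards [hinit, eventually_fderiv_eq_of_eq_on_hyperplane_vec φ p hij hy
        (analyticAt_initY (hρ p)) (hinit.mono fun x hx hxi => (hx hxi).1)] with x hx hx' hxi k
      have h1 : fderiv ℝ y x f = initW ρ x :=
        (hx' hxi).trans (fderiv_initY (hρ x).differentiableAt (hρf x))
      rw [h1, (hx hxi).2.2.1, sub_self]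
      rfl
  -- `q` is the inverse squared area
  have hqa : ∀ᶠ x in nhds p, q x * area2 (z x) (w x) = 1 := by
    have hW : AnalyticAt ℝ (fun x => q x * area2 (z x) (w x) - 1) p :=
      (hq.fun_mul (analyticAt_area2 hz hw)).fun_sub analyticAt_const
    have key := eventually_eq_zero_of_linear_cauchy φ p hij (ι := Unit)
      (b := fun _ _ _ => 0)
      (c := fun _ _ x => -(2 * (q x * (fderiv ℝ z x f ⬝ᵥ crossProduct (nor (z x) (w x)) (z x)))))
      (fun _ _ => analyticAt_const)
      (fun _ _ => (analyticAt_const.fun_mul (hq.fun_mul (analyticAt_dotProduct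
        (analyticAt_fderiv_apply hz f) (analyticAt_crossProduct (analyticAt_nor hz hw) hz)))).fun_neg)
      (W := fun _ x => q x * area2 (z x) (w x) - 1) (fun _ => hW) ?_ ?_
    · filter_upwards [key] with x hx
      exact sub_eq_zero.1 (hx ())
    · filter_upwards [hsys, hAn] with x ⟨_, hx2, hx3, hx4⟩ ⟨⟨_, hzx, hwx, hqx⟩, _⟩ k
      have hz' := hzx.differentiableAt
      have hw' := hwx.differentiableAt
      have h1 : fderiv ℝ (fun x => q x * area2 (z x) (w x) - 1) x e
          = fderiv ℝ q x e * area2 (z x) (w x) + q x * (2 * (nor (z x) (w x) ⬝ᵥ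
            (crossProduct (fderiv ℝ z x e) (w x) + crossProduct (z x) (fderiv ℝ w x e)))) := by
        rw [fderiv_sub_apply (hqx.differentiableAt.fun_mul (differentiableAt_area2 hz' hw'))
          (differentiableAt_const _), fderiv_mul_apply hqx.differentiableAt
          (differentiableAt_area2 hz' hw'), fderiv_area2_apply hz' hw', fderiv_nor_apply hz' hw']
        simp
      rw [Fintype.sum_unique, h1, hx4, hx3, hx2]
      generalize codazziCoef₁ (fun k => a k x) (z x) (w x) (q x) _ _ = A
      generalize codazziCoef₂ (fun k => a k x) (z x) (w x) (q x) _ _ = B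
      generalize fderiv ℝ z x f = v
      generalize a 0 x = l
      have h2 : nor (z x) (w x) ⬝ᵥ (crossProduct (A • z x + B • w x + l • nor (z x) (w x)) (w x)
          + crossProduct (z x) v) = A * area2 (z x) (w x)
            + v ⬝ᵥ crossProduct (nor (z x) (w x)) (z x) := by
        simp only [area2, nor_apply, cross_apply, vec3_dotProduct, Pi.add_apply, Pi.smul_apply,
          smul_eq_mul, Matrix.cons_val]
        ring
      rw [h2]
      ring
    · filter_upwards [hinit, hAn] with x hx ⟨_, _, hNx⟩ hxi k
      obtain ⟨-, hx2, hx3, hx4⟩ := hx hxi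
      rw [hx2, hx3, hx4, area2_init hNx, sub_self]
  have harea : ∀ᶠ x in nhds p, area2 (z x) (w x) ≠ 0 :=
    hqa.mono fun x hx => right_ne_zero_of_mul (hx.symm ▸ one_ne_zero)
  have hareap := harea.self_of_nhds
  have hze := analyticAt_fderiv_apply hz e
  have hzf := analyticAt_fderiv_apply hz f
  have hwf := analyticAt_fderiv_apply hw f
  -- The L component is imposed outright, as the normal coefficient of ∂ₑz.
  have hdL : ∀ᶠ x in nhds p, defect z w (fun x => fderiv ℝ z x e) L x = 0 := by
    filter_upwards [hsys] with x ⟨_, _, hx, _⟩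
    rw [defect, hx, nor_dot_expansion]
    simp [a]
    ring
  -- The remaining two components of the second fundamental form
  have hPR : ∀ᶠ x in nhds p, ∀ k : Fin 2, (![defect z w (fun x => fderiv ℝ w x f) N,
      defect z w (fun x => fderiv ℝ z x f) M] : Fin 2 → E → ℝ) k x = 0 := by
    -- Component 0 is the N defect and component 1 the M defect; the only principal term is the
    -- `f`-derivative of the M defect in the equation for the N defect.
    refine eventually_eq_zero_of_linear_cauchy φ p hij (ι := Fin 2)
      (b := fun k l _ => !![0, 1; 0, 0] k l)
      (c := !![fun x => coef₁ (z x) (w x) (fderiv ℝ z x e)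
          + 2 * coef₂ (z x) (w x) (fderiv ℝ z x f),
        fun x => -2 * coef₂ (z x) (w x) (fderiv ℝ w x f);
        fun x => coef₂ (z x) (w x) (fderiv ℝ z x e),
        fun x => 2 * coef₁ (z x) (w x) (fderiv ℝ z x e)])
      (fun _ _ => analyticAt_const) ?_ ?_ ?_ ?_
    · intro k l
      fin_cases k <;> fin_cases l
      · exact (analyticAt_coef₁ hz hw hze hareap).fun_add
          (analyticAt_const.fun_mul (analyticAt_coef₂ hz hw hzf hareap))
      · exact analyticAt_const.fun_mul (analyticAt_coef₂ hz hw hwf hareap)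
      · exact analyticAt_coef₂ hz hw hze hareap
      · exact analyticAt_const.fun_mul (analyticAt_coef₁ hz hw hze hareap)
    · intro k
      fin_cases k
      · exact analyticAt_defect hz hw hwf hN
      · exact analyticAt_defect hz hw hzf hM
    · filter_upwards [hsys.eventually_nhds, hAn, harea, hqa, hdL.eventually_nhds] with x hx
        ⟨⟨_, hzx, hwx, _⟩, ⟨hLx, hMx, hNx⟩, hNx0⟩ hax hqx hdLx
      obtain ⟨hR, hP⟩ := fderiv_defects hzx hwx hLx.differentiableAt hMx.differentiableAt
        hNx.differentiableAt (hx.mono fun x h => h.2.1) hdLx hax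
      have h3 := hx.self_of_nhds.2.2.1
      have hA := congrArg (coef₁ (z x) (w x)) h3
      have hB := congrArg (coef₂ (z x) (w x)) h3
      rw [coef₁_expansion hax, codazziCoef₁, inv_area2_mul_eq hqx, inv_area2_mul_eq hqx] at hA
      rw [coef₂_expansion hax, codazziCoef₂, inv_area2_mul_eq hqx, inv_area2_mul_eq hqx] at hB
      -- The frame system was designed so that these two Codazzi equations hold; they cancel the
      -- inhomogeneous terms in the defect equations.
      have hA' : N x * coef₁ (z x) (w x) (fderiv ℝ z x e) = fderiv ℝ M x f - fderiv ℝ N x e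
          - L x * coef₁ (z x) (w x) (fderiv ℝ w x f)
          + 2 * M x * coef₁ (z x) (w x) (fderiv ℝ z x f) := by
        rw [hA]
        simp only [a, coef₁, Matrix.cons_val]
        field_simp
        rfl
      have hB' : N x * coef₂ (z x) (w x) (fderiv ℝ z x e) = fderiv ℝ M x e - fderiv ℝ L x f
          - L x * coef₂ (z x) (w x) (fderiv ℝ w x f)
          + 2 * M x * coef₂ (z x) (w x) (fderiv ℝ z x f) := by
        rw [hB]
        simp only [a, coef₂, Matrix.cons_val]
        field_simp
        rfl
      intro k
      rw [Fin.sum_univ_two]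
      fin_cases k
      · refine hP.trans ?_
        simp only [Fin.zero_eta, Matrix.of_apply, Matrix.cons_val]
        linear_combination -area2 (z x) (w x) * hA'
      · refine hR.trans ?_
        simp only [Fin.mk_one, Matrix.of_apply, Matrix.cons_val]
        linear_combination area2 (z x) (w x) * hB'
    · filter_upwards [hinit, hAn,
        eventually_fderiv_eq_of_eq_on_hyperplane_vec φ p hij hz
          (analyticAt_initZ (hρ p) hM hN hN0) (hinit.mono fun x hx hxi => (hx hxi).2.1),
        eventually_fderiv_eq_of_eq_on_hyperplane_vec φ p hij hw
          (analyticAt_initW (hρ p)) (hinit.mono fun x hx hxi => (hx hxi).2.2.1)]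
        with x hx ⟨_, ⟨_, hMx, hNx⟩, hNx0⟩ hzx hwx hxi k
      obtain ⟨-, hx2, hx3, -⟩ := hx hxi
      have hz1 : fderiv ℝ z x f = fderiv ℝ (initZ ρ M N) x f := hzx hxi
      have hw1 : fderiv ℝ w x f = fderiv ℝ (initW ρ) x f := hwx hxi
      obtain ⟨s, t, hst⟩ := fderiv_initZ (hρ x) hMx hNx hNx0 (hρf x)
      have h1 := one_add_sq_ne_zero (ρ x)
      fin_cases k
      · simp only [Fin.zero_eta, Matrix.cons_val, defect]
        rw [hw1, fderiv_initW (hρ x).differentiableAt (hρf x), hx2, hx3, area2, nor_init,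
          vec3_dotProduct, vec3_dotProduct]
        simp
        field_simp
        ring
      · simp only [Fin.mk_one, Matrix.cons_val, defect]
        rw [hz1, hst, hx2, hx3, area2, nor_init, vec3_dotProduct, vec3_dotProduct]
        simp
        field_simp
        ring
  refine ⟨y, hy, ?_⟩
  filter_upwards [hsys.eventually_nhds, hyf.eventually_nhds, harea, hdL, hPR]
    with x hx hfx hax hLx hPRx
  have h1 : (fun x => fderiv ℝ y x e) =ᶠ[nhds x] z := hx.mono fun x h => h.1
  have h2 : (fun x => fderiv ℝ y x f) =ᶠ[nhds x] w := hfx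
  have h1' : fderiv ℝ y x e = z x := h1.self_of_nhds
  have h2' : fderiv ℝ y x f = w x := h2.self_of_nhds
  rw [h1.fderiv_eq, h2.fderiv_eq, h1', h2']
  exact ⟨hax, sub_eq_zero.1 hLx, sub_eq_zero.1 (hPRx 1), sub_eq_zero.1 (hPRx 0)⟩

end SurfaceFrame

/-! ### Gram matrices -/

namespace SurfaceFrame

lemma area2_eq (z w : Fin 3 → ℝ) :
    area2 z w = (z ⬝ᵥ z) * (w ⬝ᵥ w) - (z ⬝ᵥ w) ^ 2 := by
  simp only [area2, nor_apply, vec3_dotProduct, Matrix.cons_val]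
  ring

/-- The Gram matrix of two vectors. -/
def gram (z w : Fin 3 → ℝ) : Matrix (Fin 2) (Fin 2) ℝ :=
  Matrix.of fun i j => ![z, w] i ⬝ᵥ ![z, w] j

lemma det_gram (z w : Fin 3 → ℝ) : (gram z w).det = area2 z w := by
  rw [Matrix.det_fin_two, area2_eq]
  simp only [gram, Matrix.of_apply, Matrix.cons_val]
  rw [dotProduct_comm w z]
  ring

lemma area2_nonneg (z w : Fin 3 → ℝ) : 0 ≤ area2 z w := by
  rw [area2, vec3_dotProduct]
  nlinarith [sq_nonneg (nor z w 0), sq_nonneg (nor z w 1), sq_nonneg (nor z w 2)]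

/-- The quadratic form is the squared length of v = x₀z + x₁w. If v = 0, then replacing z or w by v
in the squared area shows that both coefficients vanish. -/
lemma posDef_gram {z w : Fin 3 → ℝ} (h : area2 z w ≠ 0) : (gram z w).PosDef := by
  refine Matrix.PosDef.of_dotProduct_mulVec_pos ?_ fun x hx => ?_
  · ext i j
    simp [gram, dotProduct_comm]
  · set v : Fin 3 → ℝ := x 0 • z + x 1 • w with hv
    have hq : star x ⬝ᵥ (gram z w *ᵥ x) = v ⬝ᵥ v := by
      simp only [hv, gram, dotProduct, mulVec, Fin.sum_univ_two, Fin.sum_univ_three,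
        Matrix.of_apply, Matrix.cons_val, Pi.add_apply, Pi.smul_apply, smul_eq_mul, Pi.star_apply,
        star_trivial]
      ring
    rw [hq]
    have hnn : 0 ≤ v ⬝ᵥ v := by
      rw [vec3_dotProduct]
      nlinarith [sq_nonneg (v 0), sq_nonneg (v 1), sq_nonneg (v 2)]
    refine lt_of_le_of_ne hnn fun h0 => hx ?_
    have hv0 : v = 0 := dotProduct_self_eq_zero.1 h0.symm
    have h1 : area2 v w = x 0 ^ 2 * area2 z w := by
      simp only [hv, area2, nor_apply, vec3_dotProduct, Matrix.cons_val, Pi.add_apply,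
        Pi.smul_apply, smul_eq_mul]
      ring
    have h2 : area2 z v = x 1 ^ 2 * area2 z w := by
      simp only [hv, area2, nor_apply, vec3_dotProduct, Matrix.cons_val, Pi.add_apply,
        Pi.smul_apply, smul_eq_mul]
      ring
    have h3 : area2 0 w = 0 := by simp [area2, nor_apply]
    have h4 : area2 z 0 = 0 := by simp [area2, nor_apply]
    rw [hv0, h3] at h1
    rw [hv0, h4] at h2
    have h5 := (mul_eq_zero.1 h1.symm).resolve_right h
    have h6 := (mul_eq_zero.1 h2.symm).resolve_right h
    ext k
    fin_cases k
    · simpa using h5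
    · simpa using h6

/-- Raising the index with the inverse metric extracts the tangential frame coefficients, as needed
for the Christoffel symbols. -/
lemma inv_gram_mul_dot {z w : Fin 3 → ℝ} (h : area2 z w ≠ 0) (v : Fin 3 → ℝ) :
    ∑ l, (gram z w)⁻¹ 0 l * (v ⬝ᵥ ![z, w] l) = coef₁ z w v ∧
      ∑ l, (gram z w)⁻¹ 1 l * (v ⬝ᵥ ![z, w] l) = coef₂ z w v := by
  rw [Matrix.inv_def, det_gram, Matrix.adjugate_fin_two, Ring.inverse_eq_inv', coef₁, coef₂]
  simp only [Fin.sum_univ_two, gram, Matrix.smul_apply, Matrix.of_apply, Matrix.cons_val,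
    smul_eq_mul]
  constructor
  · field_simp
    simp only [nor_apply, cross_apply, vec3_dotProduct, Matrix.cons_val]
    ring
  · field_simp
    simp only [nor_apply, cross_apply, vec3_dotProduct, Matrix.cons_val]
    ring

end SurfaceFrame

/-! ### The induced metric: Christoffel symbols, Codazzi and Gauss equations -/

namespace Continuum

open SurfaceFrame

lemma dx_add {F : Type*} [NormedAddCommGroup F] [NormedSpace ℝ F] {f g : SpaceTime → F}
    {p : SpaceTime} (hf : DifferentiableAt ℝ f p) (hg : DifferentiableAt ℝ g p) (i : Fin 2) :
    dx i (fun q => f q + g q) p = dx i f p + dx i g p := fderiv_add_apply hf hg _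

lemma dx_congr {F : Type*} [NormedAddCommGroup F] [NormedSpace ℝ F] {f g : SpaceTime → F}
    {p : SpaceTime} (h : f =ᶠ[nhds p] g) (i : Fin 2) : dx i f p = dx i g p := by
  rw [dx, dx, h.fderiv_eq]

lemma dx_comm {F : Type*} [NormedAddCommGroup F] [NormedSpace ℝ F] [CompleteSpace F]
    {f : SpaceTime → F} {p : SpaceTime} (hf : AnalyticAt ℝ f p) (i j : Fin 2) :
    dx i (dx j f) p = dx j (dx i f) p := fderiv_fderiv_comm hf _ _

lemma analyticAt_dx {F : Type*} [NormedAddCommGroup F] [NormedSpace ℝ F] [CompleteSpace F]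
    {f : SpaceTime → F} {p : SpaceTime} (hf : AnalyticAt ℝ f p) (i : Fin 2) :
    AnalyticAt ℝ (dx i f) p := analyticAt_fderiv_apply hf _

/-- The metric induced by an immersion. -/
def induced (Y : SpaceTime → Fin 3 → ℝ) : MetricField := fun p => gram (dx 0 Y p) (dx 1 Y p)

variable {Y : SpaceTime → Fin 3 → ℝ} {p : SpaceTime}

lemma induced_apply (i j : Fin 2) : induced Y p i j = dx i Y p ⬝ᵥ dx j Y p := by
  fin_cases i <;> fin_cases j <;> rfl

lemma det_induced : (induced Y p).det = area2 (dx 0 Y p) (dx 1 Y p) := det_gram _ _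

lemma analyticAt_induced (hY : AnalyticAt ℝ Y p) (i j : Fin 2) :
    AnalyticAt ℝ (fun q => induced Y q i j) p := by
  simp only [induced_apply]
  exact analyticAt_dotProduct (analyticAt_dx hY i) (analyticAt_dx hY j)

lemma dx_induced (hY : AnalyticAt ℝ Y p) (k i j : Fin 2) :
    dx k (fun q => induced Y q i j) p
      = dx k (dx i Y) p ⬝ᵥ dx j Y p + dx i Y p ⬝ᵥ dx k (dx j Y) p := by
  simp only [induced_apply]
  exact fderiv_dotProduct_apply (analyticAt_dx hY i).differentiableAt
    (analyticAt_dx hY j).differentiableAt _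

/-- The Christoffel symbols of the induced metric are the tangential coefficients of the second
derivatives. -/
lemma christoffel_induced (hY : AnalyticAt ℝ Y p) (h : area2 (dx 0 Y p) (dx 1 Y p) ≠ 0)
    (i j : Fin 2) :
    christoffel (induced Y) 0 i j p = coef₁ (dx 0 Y p) (dx 1 Y p) (dx i (dx j Y) p) ∧
      christoffel (induced Y) 1 i j p = coef₂ (dx 0 Y p) (dx 1 Y p) (dx i (dx j Y) p) := by
  obtain ⟨h0, h1⟩ := inv_gram_mul_dot h (dx i (dx j Y) p)
  -- In the Christoffel combination of metric derivatives everything cancels by symmetry of second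
  -- derivatives, except twice the pairing of ∂ᵢ∂ⱼY with ∂ₗY.
  have hsum : ∀ l, dx j (fun q => induced Y q i l) p + dx i (fun q => induced Y q j l) p
      - dx l (fun q => induced Y q i j) p
      = 2 * (dx i (dx j Y) p ⬝ᵥ ![dx 0 Y p, dx 1 Y p] l) := by
    intro l
    have hl : ![dx 0 Y p, dx 1 Y p] l = dx l Y p := by fin_cases l <;> rfl
    rw [dx_induced hY, dx_induced hY, dx_induced hY, hl, dx_comm hY j i, dx_comm hY j l,
      dx_comm hY i l, dotProduct_comm (dx j Y p), dotProduct_comm (dx i Y p)]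
    ring
  simp only [christoffel, hsum]
  constructor
  · rw [← h0, Finset.mul_sum]
    exact Finset.sum_congr rfl fun l _ => by rw [induced]; ring
  · rw [← h1, Finset.mul_sum]
    exact Finset.sum_congr rfl fun l _ => by rw [induced]; ring

section Surface

variable {S : Fields}

/-- The second fundamental form of `Y`, divided by the area density, is `S.form` at `p`. -/
def HasForm (S : Fields) (Y : SpaceTime → Fin 3 → ℝ) (p : SpaceTime) : Prop :=
  area2 (dx 0 Y p) (dx 1 Y p) ≠ 0 ∧ ∀ i j, nor (dx 0 Y p) (dx 1 Y p) ⬝ᵥ dx i (dx j Y) p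
    = area2 (dx 0 Y p) (dx 1 Y p) * S.form p i j

/-- The Gauss formula, with the normal left unnormalised. -/
lemma HasForm.second_deriv (h : HasForm S Y p) (hY : AnalyticAt ℝ Y p) (i j : Fin 2) :
    dx i (dx j Y) p = christoffel (induced Y) 0 i j p • dx 0 Y p
      + christoffel (induced Y) 1 i j p • dx 1 Y p
      + S.form p i j • nor (dx 0 Y p) (dx 1 Y p) := by
  have h1 := eq_expansion h.1 (dx i (dx j Y) p)
  rw [(christoffel_induced hY h.1 i j).1, (christoffel_induced hY h.1 i j).2]
  have h3 : coef₃ (dx 0 Y p) (dx 1 Y p) (dx i (dx j Y) p) = S.form p i j := by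
    rw [coef₃, h.2 i j, mul_div_cancel_left₀ _ h.1]
  rwa [h3] at h1

/-- The Codazzi equations of a surface. -/
lemma codazzi_of_hasForm (hY : AnalyticAt ℝ Y p) (hL : AnalyticAt ℝ S.L p)
    (hM : AnalyticAt ℝ S.M p) (hN : AnalyticAt ℝ S.N p) (h : ∀ᶠ q in nhds p, HasForm S Y q) :
    dx 0 S.N p - dx 1 S.M p = -codazziTerm S (induced Y) 0 p ∧
      dx 0 S.M p - dx 1 S.L p = codazziTerm S (induced Y) 1 p := by
  have hp := h.self_of_nhds
  -- Both defects vanish near `p`, so the identity that drove the existence proof reduces to the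
  -- Codazzi residuals multiplied by the nonzero squared area.
  have hd := fderiv_defects (x := p) (z := dx 0 Y) (w := dx 1 Y) (L := S.L) (M := S.M) (N := S.N)
    (e := (0, EuclideanSpace.single 0 1)) (f := (0, EuclideanSpace.single 1 1))
    (analyticAt_dx hY 0) (analyticAt_dx hY 1) hL.differentiableAt hM.differentiableAt
    hN.differentiableAt (hY.eventually_analyticAt.mono fun q hq => dx_comm hq 0 1)
    (h.mono fun q hq => sub_eq_zero.2 (hq.2 0 0)) hp.1
  have hR : defect (dx 0 Y) (dx 1 Y) (dx 1 (dx 0 Y)) S.M =ᶠ[nhds p] fun _ => 0 :=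
    h.mono fun q hq => sub_eq_zero.2 (hq.2 1 0)
  have hP : defect (dx 0 Y) (dx 1 Y) (dx 1 (dx 1 Y)) S.N =ᶠ[nhds p] fun _ => 0 :=
    h.mono fun q hq => sub_eq_zero.2 (hq.2 1 1)
  have hR' : ∀ v, fderiv ℝ (defect (dx 0 Y) (dx 1 Y) (dx 1 (dx 0 Y)) S.M) p v = 0 := by
    intro v; rw [hR.fderiv_eq]; simp
  have hP' : ∀ v, fderiv ℝ (defect (dx 0 Y) (dx 1 Y) (dx 1 (dx 1 Y)) S.N) p v = 0 := by
    intro v; rw [hP.fderiv_eq]; simp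
  obtain ⟨h1, h2⟩ := hd
  have h1' := (hR' _).symm.trans h1
  have h2' := (hP' _).symm.trans h2
  rw [show (defect (dx 0 Y) (dx 1 Y) (fun y => fderiv ℝ (dx 0 Y) y
    (0, EuclideanSpace.single 1 1)) S.M) p = 0 from hR.self_of_nhds,
    show (defect (dx 0 Y) (dx 1 Y) (fun y => fderiv ℝ (dx 1 Y) y
    (0, EuclideanSpace.single 1 1)) S.N) p = 0 from hP.self_of_nhds] at h1' h2'
  rw [show fderiv ℝ (defect (dx 0 Y) (dx 1 Y) (fun y => fderiv ℝ (dx 0 Y) y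
    (0, EuclideanSpace.single 1 1)) S.M) p (0, EuclideanSpace.single 1 1) = 0 from hR' _] at h2'
  simp only [mul_zero, zero_add, sub_zero, add_zero, zero_eq_mul, hp.1, false_or] at h1' h2'
  simp only [codazziTerm, (christoffel_induced hY hp.1 _ _).1,
    (christoffel_induced hY hp.1 _ _).2, dx_comm hY 0 1]
  constructor
  · simp only [dx] at h2' ⊢
    linear_combination -h2'
  · simp only [dx] at h1' ⊢
    linear_combination -h1'

/-- The normal is orthogonal to ∂₂Y, so its own derivative contributes only through -ν·∂ₖ∂₂Y. -/
lemma dx_expansion_dot {a b c : SpaceTime → ℝ} (hY : AnalyticAt ℝ Y p)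
    (ha : DifferentiableAt ℝ a p) (hb : DifferentiableAt ℝ b p) (hc : DifferentiableAt ℝ c p)
    (k : Fin 2) :
    dx k (fun q => a q • dx 0 Y q + b q • dx 1 Y q + c q • nor (dx 0 Y q) (dx 1 Y q)) p ⬝ᵥ dx 1 Y p
      = dx k a p * (dx 0 Y p ⬝ᵥ dx 1 Y p) + a p * (dx k (dx 0 Y) p ⬝ᵥ dx 1 Y p)
        + dx k b p * (dx 1 Y p ⬝ᵥ dx 1 Y p) + b p * (dx k (dx 1 Y) p ⬝ᵥ dx 1 Y p)
        - c p * (nor (dx 0 Y p) (dx 1 Y p) ⬝ᵥ dx k (dx 1 Y) p) := by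
  have hz := (analyticAt_dx hY 0).differentiableAt
  have hw := (analyticAt_dx hY 1).differentiableAt
  have hm := differentiableAt_nor hz hw
  have hsm : ∀ {f : SpaceTime → ℝ} {u : SpaceTime → Fin 3 → ℝ}, DifferentiableAt ℝ f p →
      DifferentiableAt ℝ u p →
      dx k (fun q => f q • u q) p = f p • dx k u p + dx k f p • u p := by
    intro f u hf hu
    rw [dx, fderiv_fun_smul hf hu]
    rfl
  have hn : dx k (fun q => nor (dx 0 Y q) (dx 1 Y q)) p
      = crossProduct (dx k (dx 0 Y) p) (dx 1 Y p) + crossProduct (dx 0 Y p) (dx k (dx 1 Y) p) :=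
    fderiv_nor_apply hz hw _
  rw [dx_add ((ha.fun_smul hz).fun_add (hb.fun_smul hw)) (hc.fun_smul hm),
    dx_add (ha.fun_smul hz) (hb.fun_smul hw), hsm ha hz, hsm hb hw, hsm hc hm, hn]
  simp only [nor_apply, cross_apply, vec3_dotProduct, Pi.add_apply, Pi.smul_apply, smul_eq_mul,
    Matrix.cons_val]
  ring

lemma differentiableAt_christoffel (hY : AnalyticAt ℝ Y p)
    (h : area2 (dx 0 Y p) (dx 1 Y p) ≠ 0) (k i j : Fin 2) :
    DifferentiableAt ℝ (christoffel (induced Y) k i j) p := by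
  have hz := analyticAt_dx hY 0
  have hw := analyticAt_dx hY 1
  have hv := analyticAt_dx (analyticAt_dx hY j) i
  have hA : ∀ᶠ q in nhds p, AnalyticAt ℝ Y q ∧ area2 (dx 0 Y q) (dx 1 Y q) ≠ 0 :=
    hY.eventually_analyticAt.and ((analyticAt_area2 hz hw).continuousAt.eventually_ne h)
  fin_cases k
  · exact (analyticAt_coef₁ hz hw hv h).differentiableAt.congr_of_eventuallyEq
      (hA.mono fun q hq => (christoffel_induced hq.1 hq.2 i j).1)
  · exact (analyticAt_coef₂ hz hw hv h).differentiableAt.congr_of_eventuallyEq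
      (hA.mono fun q hq => (christoffel_induced hq.1 hq.2 i j).2)

/-- The Gauss equation of a surface. -/
lemma gauss_of_hasForm (hY : AnalyticAt ℝ Y p) (hL : AnalyticAt ℝ S.L p)
    (hM : AnalyticAt ℝ S.M p) (h : ∀ᶠ q in nhds p, HasForm S Y q) :
    S.L p * S.N p - S.M p ^ 2 = gaussCurvature (induced Y) p := by
  have hp := h.self_of_nhds
  have hA := hY.eventually_analyticAt
  have hd := fun k i j => differentiableAt_christoffel hY hp.1 k i j
  have e00 : dx 0 (dx 0 Y) =ᶠ[nhds p] fun q => christoffel (induced Y) 0 0 0 q • dx 0 Y q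
      + christoffel (induced Y) 1 0 0 q • dx 1 Y q + S.L q • nor (dx 0 Y q) (dx 1 Y q) := by
    filter_upwards [h, hA] with q hq hqA using hq.second_deriv hqA 0 0
  have e01 : dx 1 (dx 0 Y) =ᶠ[nhds p] fun q => christoffel (induced Y) 0 0 1 q • dx 0 Y q
      + christoffel (induced Y) 1 0 1 q • dx 1 Y q + S.M q • nor (dx 0 Y q) (dx 1 Y q) := by
    filter_upwards [h, hA] with q hq hqA
    rw [dx_comm hqA]
    exact hq.second_deriv hqA 0 1
  -- Symmetry of third derivatives paired with ∂₂Y. Substituting the Gauss formula leaves the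
  -- curvature component on one side and (LN - M²)|ν|² on the other.
  have key : dx 1 (dx 0 (dx 0 Y)) p ⬝ᵥ dx 1 Y p = dx 0 (dx 1 (dx 0 Y)) p ⬝ᵥ dx 1 Y p := by
    rw [dx_comm (analyticAt_dx hY 0)]
  rw [dx_congr e00, dx_congr e01, dx_expansion_dot hY (hd 0 0 0) (hd 1 0 0) hL.differentiableAt,
    dx_expansion_dot hY (hd 0 0 1) (hd 1 0 1) hM.differentiableAt, hp.2 1 1, hp.2 0 1] at key
  have hz0 := hp.second_deriv hY 0 0
  have hz1 := hp.second_deriv hY 0 1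
  have hw1 := hp.second_deriv hY 1 1
  have hsymm : ∀ k, christoffel (induced Y) k 1 0 p = christoffel (induced Y) k 0 1 p := by
    intro k
    fin_cases k
    · exact (christoffel_induced hY hp.1 1 0).1.trans
        (dx_comm hY 1 0 ▸ (christoffel_induced hY hp.1 0 1).1.symm)
    · exact (christoffel_induced hY hp.1 1 0).2.trans
        (dx_comm hY 1 0 ▸ (christoffel_induced hY hp.1 0 1).2.symm)
  have hdot : ∀ a b c : ℝ, (a • dx 0 Y p + b • dx 1 Y p + c • nor (dx 0 Y p) (dx 1 Y p)) ⬝ᵥ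
      dx 1 Y p = a * (dx 0 Y p ⬝ᵥ dx 1 Y p) + b * (dx 1 Y p ⬝ᵥ dx 1 Y p) := by
    intro a b c
    simp only [nor_apply, vec3_dotProduct, Pi.add_apply, Pi.smul_apply, smul_eq_mul,
      Matrix.cons_val]
    ring
  rw [dx_comm hY 1 0, hz0, hz1, hw1, hdot, hdot, hdot] at key
  rw [gaussCurvature, det_induced, eq_div_iff hp.1, riemann]
  simp only [Fin.sum_univ_two, induced_apply, hsymm]
  rw [dotProduct_comm (dx 1 Y p) (dx 0 Y p)]
  have f01 : S.form p 0 1 = S.M p := rfl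
  have f11 : S.form p 1 1 = S.N p := rfl
  rw [f01, f11] at key
  linear_combination -key

end Surface

end Continuum

/-! ### Passage to Euclidean space, noncharacteristic directions and momentum -/

namespace Continuum

open SurfaceFrame

variable {S : Fields} {Y : SpaceTime → Fin 3 → ℝ} {p : SpaceTime}

lemma dx_toLp (i : Fin 2) (Y : SpaceTime → Fin 3 → ℝ) :
    dx i (fun q => (WithLp.toLp 2 (Y q) : E3)) = fun q => (WithLp.toLp 2 (dx i Y q) : E3) := by
  funext q
  have h := (EuclideanSpace.equiv (Fin 3) ℝ).symm.comp_fderiv (f := Y) (x := q)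
  exact congrArg (fun l : SpaceTime →L[ℝ] E3 => l (0, EuclideanSpace.single i 1)) h

lemma analyticAt_toLp (hY : AnalyticAt ℝ Y p) :
    AnalyticAt ℝ (fun q => (WithLp.toLp 2 (Y q) : E3)) p :=
  ((EuclideanSpace.equiv (Fin 3) ℝ).symm.toContinuousLinearMap.analyticAt _).fun_comp hY

lemma inner_toLp_eq (a b : Fin 3 → ℝ) :
    inner ℝ (WithLp.toLp 2 a : E3) (WithLp.toLp 2 b) = a ⬝ᵥ b := by
  rw [EuclideanSpace.inner_toLp_toLp, star_trivial, dotProduct_comm]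

lemma norm_toLp_nor (a b : Fin 3 → ℝ) :
    ‖(WithLp.toLp 2 (nor a b) : E3)‖ = Real.sqrt (area2 a b) := by
  rw [norm_eq_sqrt_real_inner, inner_toLp_eq]
  rfl

/-- The normal has length √(det g), so normalising it turns the factor det g into √(det g). -/
lemma realizesAt_of_hasForm (h : HasForm S Y p) :
    RealizesAt S (induced Y) (fun q => WithLp.toLp 2 (Y q)) p := by
  intro i j
  constructor
  · rw [firstForm, dx_toLp, dx_toLp, inner_toLp_eq, induced_apply]
  · have hc : cross (WithLp.toLp 2 (dx 0 Y p)) (WithLp.toLp 2 (dx 1 Y p))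
        = WithLp.toLp 2 (nor (dx 0 Y p) (dx 1 Y p)) := rfl
    have hpos : 0 < area2 (dx 0 Y p) (dx 1 Y p) := (area2_nonneg _ _).lt_of_ne' h.1
    rw [secondForm, unitNormal, dx_toLp, dx_toLp, dx_toLp, dx_toLp, hc, inner_smul_left,
      inner_toLp_eq, h.2 i j, norm_toLp_nor, det_induced]
    simp only [conj_trivial]
    have hs := Real.sqrt_pos.2 hpos
    nth_rewrite 2 [← Real.mul_self_sqrt hpos.le]
    field_simp

/-- Shear coordinates `(t, x₁ - c x₂, x₂)` on space-time. -/
def shear (c : ℝ) : SpaceTime ≃L[ℝ] (Fin 3 → ℝ) :=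
  LinearEquiv.toContinuousLinearEquiv
    { toFun := fun p => ![p.1, p.2 0 - c * p.2 1, p.2 1]
      invFun := fun v => (v 0, !₂[v 1 + c * v 2, v 2])
      map_add' := fun p q => by
        ext k
        fin_cases k <;> simp
        ring
      map_smul' := fun a p => by
        ext k
        fin_cases k <;> simp
        ring
      left_inv := fun p => by
        refine Prod.ext rfl ?_
        ext k; fin_cases k <;> simp
      right_inv := fun v => by
        ext k; fin_cases k <;> simp }

lemma shear_symm_one (c : ℝ) :
    (shear c).symm (Pi.single 1 1) = ((0, EuclideanSpace.single 0 1) : SpaceTime) := by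
  rw [ContinuousLinearEquiv.symm_apply_eq]
  ext k
  fin_cases k <;> simp [shear]

lemma shear_symm_two (c : ℝ) :
    (shear c).symm (Pi.single 2 1)
      = c • ((0, EuclideanSpace.single 0 1) : SpaceTime) + (0, EuclideanSpace.single 1 1) := by
  rw [ContinuousLinearEquiv.symm_apply_eq]
  ext k
  fin_cases k <;> simp [shear]

lemma fderiv_shear {F : Type*} [NormedAddCommGroup F] [NormedSpace ℝ F] (c : ℝ)
    (f : SpaceTime → F) (q : SpaceTime) :
    fderiv ℝ f q ((shear c).symm (Pi.single 1 1)) = dx 0 f q ∧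
      fderiv ℝ f q ((shear c).symm (Pi.single 2 1)) = c • dx 0 f q + dx 1 f q := by
  rw [shear_symm_one, shear_symm_two, map_add, map_smul]
  exact ⟨rfl, rfl⟩

lemma nor_add_smul (z w : Fin 3 → ℝ) (c : ℝ) : nor z (c • z + w) = nor z w := by
  simp [nor]

/-- A quadratic in c vanishing at 0, 1 and -1 has zero linear coefficient. -/
lemma exists_noncharacteristic {L M N : ℝ} (hM : M ≠ 0) : ∃ c : ℝ, N + 2 * c * M + c ^ 2 * L ≠ 0 := by
  by_contra! h
  have h0 := h 0
  have h1 := h 1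
  have h2 := h (-1)
  apply hM
  linarith

/-- Local existence of a surface with the fundamental form given by the mechanical fields. -/
theorem exists_hasForm (hL : AnalyticAt ℝ S.L p) (hM : AnalyticAt ℝ S.M p)
    (hN : AnalyticAt ℝ S.N p) (hM0 : S.M p ≠ 0) :
    ∃ Y : SpaceTime → Fin 3 → ℝ, AnalyticAt ℝ Y p ∧ ∀ᶠ q in nhds p, HasForm S Y q := by
  obtain ⟨c, hc⟩ := exists_noncharacteristic (L := S.L p) (N := S.N p) hM0
  -- The form is expressed in the directions ∂₁ and c∂₁ + ∂₂; the shear leaves ν, hence the area,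
  -- unchanged. Coordinate 0 is time and plays no part in the system.
  obtain ⟨Y, hY, h⟩ := exists_surface_of_forms (shear c) p (i := 1) (j := 2) (by decide)
    hL (M := fun q => S.M q + c * S.L q) (N := fun q => S.N q + 2 * c * S.M q + c ^ 2 * S.L q)
    (hM.fun_add (analyticAt_const.fun_mul hL))
    ((hN.fun_add (analyticAt_const.fun_mul hM)).fun_add (analyticAt_const.fun_mul hL)) hc
  refine ⟨Y, hY, ?_⟩
  filter_upwards [h, hY.eventually_analyticAt] with q hq hYq
  simp only [(fderiv_shear c _ _).1, (fderiv_shear c _ _).2, nor_add_smul, area2] at hq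
  obtain ⟨h0, h1, h2, h3⟩ := hq
  have hsum : ∀ k, dx k (fun x => c • dx 0 Y x + dx 1 Y x) q
      = c • dx k (dx 0 Y) q + dx k (dx 1 Y) q := by
    intro k
    have hd := (analyticAt_dx hYq 0).differentiableAt
    rw [dx_add (hd.fun_const_smul c) (analyticAt_dx hYq 1).differentiableAt]
    rw [dx, fderiv_fun_const_smul hd]
    rfl
  have h1' : nor (dx 0 Y q) (dx 1 Y q) ⬝ᵥ dx 0 (dx 0 Y) q
      = area2 (dx 0 Y q) (dx 1 Y q) * S.L q := h1
  have h2' : nor (dx 0 Y q) (dx 1 Y q) ⬝ᵥ dx 1 (dx 0 Y) q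
      = area2 (dx 0 Y q) (dx 1 Y q) * S.M q := by
    have := h2
    rw [show (fun x => dx 0 Y x) = dx 0 Y from rfl, dotProduct_add, dotProduct_smul, smul_eq_mul,
      h1'] at this
    rw [area2] at this ⊢
    linear_combination this
  have h3' : nor (dx 0 Y q) (dx 1 Y q) ⬝ᵥ dx 1 (dx 1 Y) q
      = area2 (dx 0 Y q) (dx 1 Y q) * S.N q := by
    have := h3
    rw [hsum, hsum, dx_comm hYq 0 1] at this
    simp only [dotProduct_add, dotProduct_smul, smul_eq_mul, smul_add] at this
    rw [h1', h2'] at this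
    rw [area2] at this ⊢
    linear_combination this
  refine ⟨h0, fun i j => ?_⟩
  fin_cases i <;> fin_cases j
  · exact h1'
  · exact (congrArg _ (dx_comm hYq 0 1)).trans h2'
  · exact h2'
  · exact h3'

/-- The spatial terms of the momentum balance are ∂₁N - ∂₂M and ∂₂L - ∂₁M, the left sides of the
Codazzi equations up to sign. -/
lemma geometricMomentum_of_codazzi {g : MetricField} (hmom : S.BalanceMomentum p)
    (h1 : dx 0 S.N p - dx 1 S.M p = -codazziTerm S g 0 p)
    (h2 : dx 0 S.M p - dx 1 S.L p = codazziTerm S g 1 p) : GeometricMomentum S g p := by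
  have hneg : ∀ k, dx k (fun q => S.ρ q * S.u q * S.v q - S.T12 q) p = -dx k S.M p := by
    intro k
    have : (fun q => S.ρ q * S.u q * S.v q - S.T12 q) = fun q => -S.M q := by
      funext q; simp only [Fields.M]; ring
    rw [this, dx, fderiv_fun_neg]
    rfl
  obtain ⟨m1, m2⟩ := hmom
  rw [hneg] at m1 m2
  change dx 0 S.N p + _ = _ at m1
  change _ + dx 1 S.L p = _ at m2
  constructor <;> linarith

end Continuum

end

/-! ### Assembly -/

theorem mainTheorem12 (S : Continuum.Fields) (Ω : Set Continuum.SpaceTime) (hΩ : IsOpen Ω)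
    (t₀ : ℝ) (x₀ : EuclideanSpace ℝ (Fin 2)) (hmem : (t₀, x₀) ∈ Ω)
    (hS : S.AnalyticOn Ω)
    (hmom : ∀ p ∈ Ω, S.BalanceMomentum p) (hmass : ∀ p ∈ Ω, S.BalanceMass p)
    (hM : S.T12 (t₀, x₀) - S.ρ (t₀, x₀) * S.u (t₀, x₀) * S.v (t₀, x₀) ≠ 0) :
    ∃ ε : ℝ, 0 < ε ∧ Metric.ball t₀ ε ×ˢ Metric.ball x₀ ε ⊆ Ω ∧
      ∃ (g : Continuum.MetricField) (y : Continuum.SpaceTime → Continuum.E3),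
        Continuum.IsEvolvingMetric g (Metric.ball t₀ ε ×ˢ Metric.ball x₀ ε) ∧
        AnalyticOnNhd ℝ y (Metric.ball t₀ ε ×ˢ Metric.ball x₀ ε) ∧
        ∀ p ∈ Metric.ball t₀ ε ×ˢ Metric.ball x₀ ε,
          Continuum.GaussCodazzi S g p ∧ Continuum.GeometricMomentum S g p ∧
          Continuum.RealizesAt S g y p := by
  obtain ⟨hu, hv, hT11, hT12, hT22, hρ⟩ := hS
  have hL : AnalyticOnNhd ℝ S.L Ω := fun p hp =>
    ((hρ p hp).fun_mul ((hv p hp).fun_pow 2)).fun_sub (hT22 p hp)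
  have hM' : AnalyticOnNhd ℝ S.M Ω := fun p hp =>
    (((hρ p hp).fun_mul (hu p hp)).fun_mul (hv p hp)).fun_neg.fun_add (hT12 p hp)
  have hN : AnalyticOnNhd ℝ S.N Ω := fun p hp =>
    ((hρ p hp).fun_mul ((hu p hp).fun_pow 2)).fun_sub (hT11 p hp)
  have hM0 : S.M (t₀, x₀) ≠ 0 := by
    rw [Continuum.Fields.M, neg_add_eq_sub]
    exact hM
  obtain ⟨Y, hY, hform⟩ := Continuum.exists_hasForm (hL _ hmem) (hM' _ hmem) (hN _ hmem) hM0
  -- The form is required in a neighbourhood of each point of the ball, because the Codazzi and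
  -- Gauss equations differentiate it. The product carries the sup metric, so the ball is a product
  -- of balls.
  obtain ⟨ε, hε, hball⟩ := Metric.eventually_nhds_iff_ball.1
    ((hY.eventually_analyticAt.and hform.eventually_nhds).and (hΩ.mem_nhds hmem))
  rw [← ball_prod_same] at hball
  refine ⟨ε, hε, fun p hp => (hball p hp).2, Continuum.induced Y, fun q => WithLp.toLp 2 (Y q),
    ⟨fun i j p hp => Continuum.analyticAt_induced (hball p hp).1.1 i j,
      fun p hp => SurfaceFrame.posDef_gram (hball p hp).1.2.self_of_nhds.1⟩,
    fun p hp => Continuum.analyticAt_toLp (hball p hp).1.1, fun p hp => ?_⟩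
  obtain ⟨⟨hYp, hfp⟩, hpΩ⟩ := hball p hp
  have hcod := Continuum.codazzi_of_hasForm hYp (hL p hpΩ) (hM' p hpΩ) (hN p hpΩ) hfp
  exact ⟨⟨hcod.1, hcod.2, Continuum.gauss_of_hasForm hYp (hL p hpΩ) (hM' p hpΩ) hfp⟩,
    Continuum.geometricMomentum_of_codazzi (hmom p hpΩ) hcod.1 hcod.2,
    Continuum.realizesAt_of_hasForm hfp.self_of_nhds⟩
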